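/- Let $\overline M$ be a smooth compact manifold of dimension $n\ge 1$ with smooth (possibly empty) boundary $\partial M$ and let $g$ be a smooth Riemannian metric on $\overline M$. Let $\mathrm C(\overline M)$ be the space of continuous functions $\overline M\to\mathbb C$, and let $\mathrm C_0(\overline M)$ be the subspace of those that vanish on $\partial M$. Let $W^{2,p}(M)$ be the Sobolev space of complex-valued functions whose weak derivatives up to order two (in smooth charts, up to the boundary) are in $L^p$. On $\mathrm C(\overline M)$ consider the Laplace–Beltrami operator with Dirichlet boundary conditions, given in local coordinates by $$\Delta^g_0 f := \Delta^g f = g^{ij}\,\partial_i\partial_j f - g^{ij}\,\Gamma^k_{ij}\,\partial_k f,\qquad \Gamma^k_{ij}=\tfrac12 g^{kl}\left(\partial_i g_{jl}+\partial_j g_{il}-\partial_l g_{ij}\right),$$ with domain $$D(\Delta^g_0) := \Big\{ f\in \bigcap_{1\le p<\infty} W^{2,p}(M)\cap \mathrm C_0(\overline M) : \Delta^g f\in \mathrm C(\overline M)\Big\}.$$ Then for every $\lambda\in\mathbb C\setminus(-\infty,0]$ the operator $\lambda-\Delta^g_0 : D(\Delta^g_0)\to \mathrm C(\overline M)$ is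 injective. -/

import Mathlib

open scoped Manifold ContDiff Topology
open MeasureTheory

/-! A compact manifold with boundary is modelled on the closed half-space `𝓡∂ n`; points of the
model vector space `EuclideanSpace ℝ (Fin n)` are the coordinates of a chart.  All function spaces
consist of complex-valued functions. -/

noncomputable section

namespace LaplaceBeltrami

/-- `v` is the weak (distributional) partial derivative `∂_i u` on the open set `Ω ⊆ ℝⁿ`. -/
def HasWeakPartial {n : ℕ} (Ω : Set (EuclideanSpace ℝ (Fin n))) (i : Fin n)
    (u v : EuclideanSpace ℝ (Fin n) → ℂ) : Prop :=
  LocallyIntegrableOn u Ω volume ∧ LocallyIntegrableOn v Ω volume ∧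
    ∀ ψ : EuclideanSpace ℝ (Fin n) → ℝ, ContDiff ℝ ∞ ψ → HasCompactSupport ψ → tsupport ψ ⊆ Ω →
      ∫ x in Ω, fderiv ℝ ψ x (EuclideanSpace.single i 1) • u x = - ∫ x in Ω, ψ x • v x

section Charts

variable {n : ℕ} [NeZero n] {M : Type*} [TopologicalSpace M] [ChartedSpace (EuclideanHalfSpace n) M]

/-- The image of a chart in `ℝⁿ`: a relatively open subset of the closed half-space. -/
def chartImage (φ : OpenPartialHomeomorph M (EuclideanHalfSpace n)) :
    Set (EuclideanSpace ℝ (Fin n)) :=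
  (φ.extend (𝓡∂ n)).target

/-- The part of the chart image which lies in the open half-space, an open subset of `ℝⁿ`. -/
def chartDomain (φ : OpenPartialHomeomorph M (EuclideanHalfSpace n)) :
    Set (EuclideanSpace ℝ (Fin n)) :=
  interior (chartImage φ)

/-- The inverse of a chart, as a map from `ℝⁿ` (meaningful on `chartImage φ`). -/
def chartInv (φ : OpenPartialHomeomorph M (EuclideanHalfSpace n)) :
    EuclideanSpace ℝ (Fin n) → M :=
  (φ.extend (𝓡∂ n)).symm

/-- In the chart `φ` the function `f` has the weak first partial derivatives `D₁ i = ∂_i f` and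
the weak second partial derivatives `D₂ i j = ∂_j ∂_i f`. -/
def HasWeakDerivs (φ : OpenPartialHomeomorph M (EuclideanHalfSpace n)) (f : M → ℂ)
    (D₁ : Fin n → EuclideanSpace ℝ (Fin n) → ℂ)
    (D₂ : Fin n → Fin n → EuclideanSpace ℝ (Fin n) → ℂ) : Prop :=
  (∀ i, HasWeakPartial (chartDomain φ) i (f ∘ chartInv φ) (D₁ i)) ∧
    ∀ i j, HasWeakPartial (chartDomain φ) j (D₁ i) (D₂ i j)

/-- Membership in the Sobolev space `W^{2,p}` of a compact manifold with boundary: in every smooth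
chart the weak derivatives up to order two exist, and they are `p`-integrable over every compact
subset of the chart image.  Such a compact set may touch the boundary hyperplane, so that the
integrability is required up to the boundary of the manifold. -/
def MemSobolevTwo (p : ENNReal) (f : M → ℂ) : Prop :=
  ∀ φ ∈ IsManifold.maximalAtlas (𝓡∂ n) ∞ M, ∃ D₁ D₂, HasWeakDerivs φ f D₁ D₂ ∧
    ∀ K ⊆ chartImage φ, IsCompact K →
      MemLp (f ∘ chartInv φ) p (volume.restrict (K ∩ chartDomain φ)) ∧
      (∀ i, MemLp (D₁ i) p (volume.restrict (K ∩ chartDomain φ))) ∧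
      ∀ i j, MemLp (D₂ i j) p (volume.restrict (K ∩ chartDomain φ))

variable [IsManifold (𝓡∂ n) ∞ M]

/-- The coordinate vector field `∂_i` of the chart `φ`, at the point with coordinates `x`. -/
def coordVector (φ : OpenPartialHomeomorph M (EuclideanHalfSpace n))
    (i : Fin n) (x : EuclideanSpace ℝ (Fin n)) : TangentSpace (𝓡∂ n) (chartInv φ x) :=
  mfderivWithin 𝓘(ℝ, EuclideanSpace ℝ (Fin n)) (𝓡∂ n) (chartInv φ) (Set.range (𝓡∂ n)) x
    (EuclideanSpace.single i 1 : EuclideanSpace ℝ (Fin n))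

variable (g : Bundle.ContMDiffRiemannianMetric (𝓡∂ n) ∞ (EuclideanSpace ℝ (Fin n))
    (fun q : M => TangentSpace (𝓡∂ n) q))

/-- The coefficients `g_{ij} = g(∂_i, ∂_j)` of the metric in the chart `φ`. -/
def metricCoeff (φ : OpenPartialHomeomorph M (EuclideanHalfSpace n))
    (x : EuclideanSpace ℝ (Fin n)) : Matrix (Fin n) (Fin n) ℝ :=
  Matrix.of fun i j => g.inner (chartInv φ x) (coordVector φ i x) (coordVector φ j x)

/-- The coefficients `g^{ij}` of the inverse matrix of `(g_{ij})`. -/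
def invMetricCoeff (φ : OpenPartialHomeomorph M (EuclideanHalfSpace n))
    (x : EuclideanSpace ℝ (Fin n)) : Matrix (Fin n) (Fin n) ℝ :=
  (metricCoeff g φ x)⁻¹

/-- The derivative `∂_l g_{ij}` of the metric coefficients. -/
def dMetricCoeff (φ : OpenPartialHomeomorph M (EuclideanHalfSpace n)) (l i j : Fin n)
    (x : EuclideanSpace ℝ (Fin n)) : ℝ :=
  fderiv ℝ (fun y => metricCoeff g φ y i j) x (EuclideanSpace.single l 1)

/-- The Christoffel symbols
`Γ^k_{ij} = (1/2) g^{kl} (∂_i g_{jl} + ∂_j g_{il} - ∂_l g_{ij})`. -/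
def christoffel (φ : OpenPartialHomeomorph M (EuclideanHalfSpace n)) (k i j : Fin n)
    (x : EuclideanSpace ℝ (Fin n)) : ℝ :=
  (1 / 2) * ∑ l, invMetricCoeff g φ x k l *
    (dMetricCoeff g φ i j l x + dMetricCoeff g φ j i l x - dMetricCoeff g φ l i j x)

/-- The coordinate expression `g^{ij} ∂_i ∂_j f - g^{ij} Γ^k_{ij} ∂_k f`, where `D₁` and `D₂` are
the first and second derivatives of `f`. -/
def laplaceExpr (φ : OpenPartialHomeomorph M (EuclideanHalfSpace n))
    (D₁ : Fin n → EuclideanSpace ℝ (Fin n) → ℂ)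
    (D₂ : Fin n → Fin n → EuclideanSpace ℝ (Fin n) → ℂ) (x : EuclideanSpace ℝ (Fin n)) : ℂ :=
  (∑ i, ∑ j, (invMetricCoeff g φ x i j : ℂ) * D₂ i j x) -
    ∑ i, ∑ j, ∑ k, (invMetricCoeff g φ x i j : ℂ) * (christoffel g φ k i j x : ℂ) * D₁ k x

/-- `h` represents `Δ^g f`: in every smooth chart, `h` agrees almost everywhere with the
coordinate expression of the Laplace-Beltrami operator applied to `f`. -/
def HasLaplacian (f h : M → ℂ) : Prop :=
  ∀ φ ∈ IsManifold.maximalAtlas (𝓡∂ n) ∞ M, ∃ D₁ D₂, HasWeakDerivs φ f D₁ D₂ ∧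
    ∀ᵐ x ∂volume.restrict (chartDomain φ), h (chartInv φ x) = laplaceExpr g φ D₁ D₂ x

end Charts

/-! ### Linearity and uniqueness, needed to make the Laplacian an operator -/

section Weak

variable {n : ℕ} {Ω : Set (EuclideanSpace ℝ (Fin n))} {i : Fin n}
  {u v u' v' : EuclideanSpace ℝ (Fin n) → ℂ}

lemma integrableOn_mul {ψ : EuclideanSpace ℝ (Fin n) → ℝ} (hψ : Continuous ψ)
    (hc : HasCompactSupport ψ) (hs : tsupport ψ ⊆ Ω) (hu : LocallyIntegrableOn u Ω volume) :
    IntegrableOn (fun x => ψ x • u x) Ω volume := by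
  have h1 : IntegrableOn u (tsupport ψ) volume := hu.integrableOn_compact_subset hs hc
  have h2 : IntegrableOn (fun x => ψ x • u x) (tsupport ψ) volume :=
    h1.continuousOn_smul hψ.continuousOn hc
  refine ((integrableOn_iff_integrable_of_support_subset ?_).1 h2).integrableOn
  intro x hx
  apply subset_tsupport
  intro h0
  exact hx (by simp [h0])

lemma fderiv_props {ψ : EuclideanSpace ℝ (Fin n) → ℝ} (hψ : ContDiff ℝ ∞ ψ)
    (hc : HasCompactSupport ψ) (hs : tsupport ψ ⊆ Ω) (w : EuclideanSpace ℝ (Fin n)) :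
    Continuous (fun x => fderiv ℝ ψ x w) ∧ HasCompactSupport (fun x => fderiv ℝ ψ x w) ∧
      tsupport (fun x => fderiv ℝ ψ x w) ⊆ Ω := by
  refine ⟨(hψ.continuous_fderiv (by simp)).clm_apply continuous_const, hc.fderiv_apply ℝ w, ?_⟩
  exact (tsupport_fderiv_apply_subset ℝ w).trans hs

lemma HasWeakPartial.add (h : HasWeakPartial Ω i u v) (h' : HasWeakPartial Ω i u' v') :
    HasWeakPartial Ω i (u + u') (v + v') := by
  refine ⟨h.1.add h'.1, h.2.1.add h'.2.1, fun ψ hψ hc hs => ?_⟩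
  obtain ⟨a, b, c⟩ := fderiv_props hψ hc hs (EuclideanSpace.single i 1)
  simp only [Pi.add_apply, smul_add]
  rw [integral_add (integrableOn_mul a b c h.1) (integrableOn_mul a b c h'.1),
    integral_add (integrableOn_mul hψ.continuous hc hs h.2.1)
      (integrableOn_mul hψ.continuous hc hs h'.2.1), h.2.2 ψ hψ hc hs, h'.2.2 ψ hψ hc hs]
  ring

lemma HasWeakPartial.smul (c : ℂ) (h : HasWeakPartial Ω i u v) :
    HasWeakPartial Ω i (c • u) (c • v) := by
  refine ⟨h.1.smul c, h.2.1.smul c, fun ψ hψ hc hs => ?_⟩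
  simp only [Pi.smul_apply]
  simp_rw [smul_comm _ c]
  rw [integral_smul, integral_smul, h.2.2 ψ hψ hc hs, smul_neg]

lemma HasWeakPartial.ae_zero (hΩ : IsOpen Ω) (h : HasWeakPartial Ω i u v)
    (hu : ∀ᵐ x ∂volume.restrict Ω, u x = 0) : ∀ᵐ x ∂volume.restrict Ω, v x = 0 := by
  rw [ae_restrict_iff' hΩ.measurableSet]
  refine hΩ.ae_eq_zero_of_integral_contDiff_smul_eq_zero h.2.1 fun ψ hψ hc hs => ?_
  have h0 := h.2.2 ψ hψ hc hs
  rw [integral_eq_zero_of_ae (by filter_upwards [hu] with x hx; simp [hx])] at h0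
  rw [← setIntegral_eq_integral_of_forall_compl_eq_zero (s := Ω)]
  · exact neg_eq_zero.1 h0.symm
  · intro x hx
    rw [image_eq_zero_of_notMem_tsupport (fun hx' => hx (hs hx')), zero_smul]

lemma hasWeakPartial_zero (Ω : Set (EuclideanSpace ℝ (Fin n))) (i : Fin n) :
    HasWeakPartial Ω i 0 0 :=
  ⟨locallyIntegrableOn_zero, locallyIntegrableOn_zero, fun ψ _ _ _ => by simp⟩

end Weak

section Operator

variable {n : ℕ} [NeZero n] {M : Type*} [TopologicalSpace M]

section

variable {φ : OpenPartialHomeomorph M (EuclideanHalfSpace n)} {f f' : M → ℂ}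
  {D₁ D₁' : Fin n → EuclideanSpace ℝ (Fin n) → ℂ}
  {D₂ D₂' : Fin n → Fin n → EuclideanSpace ℝ (Fin n) → ℂ}

lemma HasWeakDerivs.add (h : HasWeakDerivs φ f D₁ D₂) (h' : HasWeakDerivs φ f' D₁' D₂') :
    HasWeakDerivs φ (f + f') (D₁ + D₁') (D₂ + D₂') :=
  ⟨fun i => (h.1 i).add (h'.1 i), fun i j => (h.2 i j).add (h'.2 i j)⟩

lemma HasWeakDerivs.smul (c : ℂ) (h : HasWeakDerivs φ f D₁ D₂) :
    HasWeakDerivs φ (c • f) (c • D₁) (c • D₂) :=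
  ⟨fun i => (h.1 i).smul c, fun i j => (h.2 i j).smul c⟩

lemma hasWeakDerivs_zero : HasWeakDerivs φ (0 : M → ℂ) 0 0 :=
  ⟨fun i => hasWeakPartial_zero _ i, fun _ j => hasWeakPartial_zero _ j⟩

variable [ChartedSpace (EuclideanHalfSpace n) M]

lemma memSobolevTwo_zero (p : ENNReal) : MemSobolevTwo (n := n) p (0 : M → ℂ) :=
  fun _ _ => ⟨0, 0, hasWeakDerivs_zero, fun _ _ _ =>
    ⟨MemLp.zero, fun _ => MemLp.zero, fun _ _ => MemLp.zero⟩⟩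

lemma MemSobolevTwo.add {p : ENNReal} (h : MemSobolevTwo (n := n) p f)
    (h' : MemSobolevTwo (n := n) p f') : MemSobolevTwo (n := n) p (f + f') := by
  intro φ hφ
  obtain ⟨D₁, D₂, hD, hL⟩ := h φ hφ
  obtain ⟨D₁', D₂', hD', hL'⟩ := h' φ hφ
  refine ⟨_, _, hD.add hD', fun K hK hc => ?_⟩
  obtain ⟨a, b, c⟩ := hL K hK hc
  obtain ⟨a', b', c'⟩ := hL' K hK hc
  exact ⟨a.add a', fun i => (b i).add (b' i), fun i j => (c i j).add (c' i j)⟩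

lemma MemSobolevTwo.smul {p : ENNReal} (z : ℂ) (h : MemSobolevTwo (n := n) p f) :
    MemSobolevTwo (n := n) p (z • f) := by
  intro φ hφ
  obtain ⟨D₁, D₂, hD, hL⟩ := h φ hφ
  refine ⟨_, _, hD.smul z, fun K hK hc => ?_⟩
  obtain ⟨a, b, c⟩ := hL K hK hc
  exact ⟨a.const_smul z, fun i => (b i).const_smul z, fun i j => (c i j).const_smul z⟩

end

variable [ChartedSpace (EuclideanHalfSpace n) M] [IsManifold (𝓡∂ n) ∞ M]
variable {g : Bundle.ContMDiffRiemannianMetric (𝓡∂ n) ∞ (EuclideanSpace ℝ (Fin n))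
    (fun q : M => TangentSpace (𝓡∂ n) q)} {f f' h h' : M → ℂ}

lemma hasLaplacian_zero : HasLaplacian g 0 0 := fun _ _ =>
  ⟨0, 0, hasWeakDerivs_zero, Filter.Eventually.of_forall fun x => by simp [laplaceExpr]⟩

lemma HasLaplacian.add (hf : HasLaplacian g f h) (hf' : HasLaplacian g f' h') :
    HasLaplacian g (f + f') (h + h') := by
  intro φ hφ
  obtain ⟨D₁, D₂, hD, hL⟩ := hf φ hφ
  obtain ⟨D₁', D₂', hD', hL'⟩ := hf' φ hφ
  refine ⟨_, _, hD.add hD', ?_⟩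
  filter_upwards [hL, hL'] with x hx hx'
  simp only [Pi.add_apply, hx, hx', laplaceExpr, mul_add, Finset.sum_add_distrib]
  ring

lemma HasLaplacian.smul (z : ℂ) (hf : HasLaplacian g f h) : HasLaplacian g (z • f) (z • h) := by
  intro φ hφ
  obtain ⟨D₁, D₂, hD, hL⟩ := hf φ hφ
  refine ⟨_, _, hD.smul z, ?_⟩
  filter_upwards [hL] with x hx
  simp only [Pi.smul_apply, hx, laplaceExpr, smul_eq_mul, mul_sub, Finset.mul_sum]
  congr 1
  · exact Finset.sum_congr rfl fun i _ => Finset.sum_congr rfl fun j _ => by ring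
  · exact Finset.sum_congr rfl fun i _ => Finset.sum_congr rfl fun j _ =>
      Finset.sum_congr rfl fun k _ => by ring

lemma HasLaplacian.eq_zero {k : C(M, ℂ)} (hk : HasLaplacian g 0 k) : k = 0 := by
  ext q
  set φ := chartAt (EuclideanHalfSpace n) q with hφdef
  obtain ⟨D₁, D₂, hD, hL⟩ := hk φ (IsManifold.chart_mem_maximalAtlas q)
  have hΩ : IsOpen (chartDomain φ) := isOpen_interior
  have h1 : ∀ i, ∀ᵐ x ∂volume.restrict (chartDomain φ), D₁ i x = 0 := fun i =>
    (hD.1 i).ae_zero hΩ (Filter.Eventually.of_forall fun x => rfl)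
  have h2 : ∀ i j, ∀ᵐ x ∂volume.restrict (chartDomain φ), D₂ i j x = 0 := fun i j =>
    (hD.2 i j).ae_zero hΩ (h1 i)
  have h3 : ∀ᵐ x ∂volume.restrict (chartDomain φ), k (chartInv φ x) = 0 := by
    filter_upwards [hL, ae_all_iff.2 h1, ae_all_iff.2 fun i => ae_all_iff.2 (h2 i)] with x a b c
    rw [a]
    simp [laplaceExpr, b, c]
  have hcont : ContinuousOn (fun x => k (chartInv φ x)) (chartImage φ) :=
    k.continuous.comp_continuousOn φ.continuousOn_extend_symm
  have h4 : Set.EqOn (fun x => k (chartInv φ x)) 0 (chartDomain φ) :=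
    Measure.eqOn_open_of_ae_eq h3 hΩ (hcont.mono interior_subset) continuousOn_const
  have h5 : Set.EqOn (fun x => k (chartInv φ x)) 0 (chartImage φ) :=
    h4.of_subset_closure hcont continuousOn_const interior_subset
      (extChartAt_target_subset_closure_interior (I := 𝓡∂ n) (x := q))
  have h6 : k (chartInv φ (extChartAt (𝓡∂ n) q q)) = 0 :=
    h5 (mem_extChartAt_target (I := 𝓡∂ n) q)
  have h7 : chartInv φ (extChartAt (𝓡∂ n) q q) = q := extChartAt_to_inv (I := 𝓡∂ n) q
  rw [h7] at h6
  exact h6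

lemma HasLaplacian.unique {k k' : C(M, ℂ)} (hk : HasLaplacian g f k) (hk' : HasLaplacian g f k') :
    k = k' := by
  have h0 := hk.add (hk'.smul (-1))
  have e1 : f + (-1 : ℂ) • f = 0 := by simp
  have e2 : (k : M → ℂ) + (-1 : ℂ) • (k' : M → ℂ) = ((k - k' : C(M, ℂ)) : M → ℂ) := by
    ext; simp [sub_eq_add_neg]
  rw [e1, e2] at h0
  exact sub_eq_zero.1 h0.eq_zero

variable (g)

/-- The domain
`{f ∈ ⋂_{1 ≤ p < ∞} W^{2,p}(M) ∩ C_0 : Δ^g f ∈ C}`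
of the Dirichlet Laplacian, where `C` is the space of continuous functions on the compact manifold
and `C_0` the subspace of the functions that vanish on its boundary. -/
def dirichletDomain : Submodule ℂ C(M, ℂ) where
  carrier := {f | (∀ p : ENNReal, 1 ≤ p → p ≠ ⊤ → MemSobolevTwo (n := n) p f) ∧
    (∀ q ∈ (𝓡∂ n).boundary M, f q = 0) ∧ ∃ h : C(M, ℂ), HasLaplacian g f h}
  add_mem' := by
    rintro f f' ⟨a, b, h, c⟩ ⟨a', b', h', c'⟩
    exact ⟨fun p hp hp' => (a p hp hp').add (a' p hp hp'),
      fun q hq => by simp [b q hq, b' q hq], h + h', c.add c'⟩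
  zero_mem' := ⟨fun p _ _ => memSobolevTwo_zero p, fun _ _ => rfl, 0, hasLaplacian_zero⟩
  smul_mem' := by
    rintro z f ⟨a, b, h, c⟩
    exact ⟨fun p hp hp' => (a p hp hp').smul z, fun q hq => by simp [b q hq], z • h, c.smul z⟩

/-- The Laplace-Beltrami operator with Dirichlet boundary conditions, as an unbounded operator on
the space of continuous functions: it sends `f` in its domain to the continuous function `Δ^g f`. -/
def dirichletLaplacian : C(M, ℂ) →ₗ.[ℂ] C(M, ℂ) where
  domain := dirichletDomain g
  toFun :=
    { toFun := fun f => f.2.2.2.choose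
      map_add' := fun f f' => HasLaplacian.unique (f + f').2.2.2.choose_spec
        (f.2.2.2.choose_spec.add f'.2.2.2.choose_spec)
      map_smul' := fun z f => HasLaplacian.unique (z • f).2.2.2.choose_spec
        (f.2.2.2.choose_spec.smul z) }

/-- The value of the operator at `f` is a continuous function representing `Δ^g f`. -/
lemma dirichletLaplacian_spec (f : (dirichletLaplacian g).domain) :
    HasLaplacian g (f : C(M, ℂ)) (dirichletLaplacian g f) :=
  f.2.2.2.choose_spec

end Operator

end LaplaceBeltrami

end

/-! If Δf = zf, pairing with the conjugate of f and integrating by parts gives z∫|f|² = -∫|∇f|². If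
f were not zero, z would be the quotient of a nonpositive number by a positive one and so lie in
(-∞,0] (`eq_zero_of_mul_eq_neg`). Since the operator is linear, the absence of eigenfunctions is
injectivity.

The integration by parts uses no trace theory. Conjugation is replaced by smooth maps Θ_m that
vanish near 0, satisfy |Θ_m(ζ)| ≤ |ζ| and have uniformly bounded derivatives (`exists_conj_approx`).
As f is continuous and zero on the boundary, Θ_m(f) vanishes near the boundary, so in each chart,
after a cutoff, only compact subsets of the open half-space matter. When m grows, Θ_m(ζ) tends to
the conjugate of ζ, while the derivative DΘ_m(ζ) tends to conjugation for ζ ≠ 0 and to 0 for ζ = 0.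
Dominated convergence therefore yields the energy identity with |∇f|² integrated over {f ≠ 0} only.
That integral is still nonnegative, so nothing has to be known about ∇f on {f = 0}.

In a chart, weak derivatives are defined through smooth test functions, but Θ_m(f) is not smooth.
Mollification (`exists_smooth_approx`) provides the missing density argument and leads to
`HasWeakPartial.integral_comp_smooth`. Jacobi's formula puts the Laplacian in divergence form
(`volumeDensity_mul_laplaceExpr`), which gives Green's formula in a chart
(`integral_mul_laplacian`).

A partition of unity χ_k makes the formula global. The error terms contain dχ_k and must cancel
because the χ_k sum to 1, but they are written in different charts. The chain rule for weak
derivatives and the transformation laws of the metric show that the density ⟨∇χ, ∇f⟩ does not depend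
on the chart (`integral_gradPairing_eq`), and the cancellation follows (`sum_integral_gradPairing`).
-/

noncomputable section

namespace LaplaceBeltrami

/-! ### Convergence of mollifications in L². -/

section Mollification

open Filter Metric ContinuousLinearMap
open scoped Convolution

variable {E : Type*} [NormedAddCommGroup E] [InnerProductSpace ℝ E] [FiniteDimensional ℝ E]
  [MeasurableSpace E] [BorelSpace E]

lemma eLpNorm_two_sq {α F : Type*} [MeasurableSpace α] [NormedAddCommGroup F] (μ : Measure α)
    (f : α → F) : eLpNorm f 2 μ ^ 2 = ∫⁻ x, ‖f x‖ₑ ^ 2 ∂μ := by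
  have h := eLpNorm_nnreal_pow_eq_lintegral (μ := μ) (f := f) (p := 2) (by norm_num)
  simp only [NNReal.coe_ofNat, ENNReal.rpow_ofNat, ENNReal.coe_ofNat] at h
  exact h

/-- Translations act continuously on L^p for finite p, so the orbit map of the class of `h` is
continuous at 0. -/
lemma tendsto_eLpNorm_translate_sub {h : E → ℂ} (hh : MemLp h 2 volume) :
    Tendsto (fun t => eLpNorm (fun x => h (x - t) - h x) 2 volume) (𝓝 0) (𝓝 0) := by
  have : Fact ((2 : ENNReal) ≠ ⊤) := ⟨by simp⟩
  have : Fact (1 ≤ (2 : ENNReal)) := ⟨by norm_num⟩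
  have hc : Continuous fun t : E => (DomAddAct.mk (-t)) +ᵥ hh.toLp h := by
    have h1 : Continuous fun t : E => DomAddAct.mk (-t) :=
      DomAddAct.continuous_mk.comp continuous_neg
    exact h1.vadd continuous_const
  have h2 := (hc.tendsto 0).edist (tendsto_const_nhds (x := hh.toLp h))
  have h0 : (DomAddAct.mk (-(0 : E))) +ᵥ hh.toLp h = hh.toLp h := by simp
  rw [h0, edist_self] at h2
  refine h2.congr fun t => ?_
  rw [DomAddAct.mk_vadd_toLp, Lp.edist_toLp_toLp]
  congr 1
  ext x
  simp [sub_eq_neg_add]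

/-- Jensen's inequality: the normed bump is a probability density, the left side is the square of an
average of `h (x - t) - h x`, and on a probability space the L¹ norm is at most the L² norm. -/
lemma enorm_normed_convolution_sub_sq_le (φ : ContDiffBump (0 : E)) {h : E → ℂ}
    (hh : MemLp h 2 volume) (x : E) :
    ‖(φ.normed volume ⋆[lsmul ℝ ℝ, volume] h) x - h x‖ₑ ^ 2 ≤
      ∫⁻ t, ‖h (x - t) - h x‖ₑ ^ 2 ∂volume.withDensity
        (fun t => ENNReal.ofReal (φ.normed volume t)) := by
  set ρ := fun t => ENNReal.ofReal (φ.normed volume t) with hρ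
  have hρm : Measurable ρ := φ.continuous_normed.measurable.ennreal_ofReal
  have hprob : IsProbabilityMeasure (volume.withDensity ρ) := by
    refine ⟨?_⟩
    rw [withDensity_apply _ MeasurableSet.univ, Measure.restrict_univ,
      ← ofReal_integral_eq_lintegral_ofReal φ.integrable_normed
        (Eventually.of_forall φ.nonneg_normed), φ.integral_normed, ENNReal.ofReal_one]
  have hloc : LocallyIntegrable h volume := hh.locallyIntegrable (by norm_num)
  have hex : ConvolutionExistsAt (φ.normed volume) h x (lsmul ℝ ℝ) volume :=
    φ.hasCompactSupport_normed.convolutionExists_left (lsmul ℝ ℝ) φ.continuous_normed hloc x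
  have hm : AEStronglyMeasurable (fun t => h (x - t) - h x) volume :=
    (hh.1.comp_quasiMeasurePreserving
      (quasiMeasurePreserving_sub_left_of_right_invariant volume x)).sub aestronglyMeasurable_const
  have e1 : (φ.normed volume ⋆[lsmul ℝ ℝ, volume] h) x - h x =
      ∫ t, φ.normed volume t • (h (x - t) - h x) := by
    simp_rw [smul_sub]
    rw [integral_sub (show Integrable (fun t => φ.normed volume t • h (x - t)) volume from hex)
      (φ.integrable_normed.smul_const _), φ.integral_normed_smul]
    rfl
  have e2 : ‖(φ.normed volume ⋆[lsmul ℝ ℝ, volume] h) x - h x‖ₑ ≤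
      ∫⁻ t, ‖h (x - t) - h x‖ₑ ∂volume.withDensity ρ := by
    rw [e1]
    refine (enorm_integral_le_lintegral_enorm _).trans (le_of_eq ?_)
    rw [lintegral_withDensity_eq_lintegral_mul₀ hρm.aemeasurable hm.enorm]
    refine lintegral_congr fun t => ?_
    rw [enorm_smul, Pi.mul_apply, hρ, Real.enorm_of_nonneg (φ.nonneg_normed t)]
  have hm' : AEStronglyMeasurable (fun t => h (x - t) - h x) (volume.withDensity ρ) :=
    hm.mono_ac (withDensity_absolutelyContinuous _ _)
  calc _ ≤ (∫⁻ t, ‖h (x - t) - h x‖ₑ ∂volume.withDensity ρ) ^ 2 := by gcongr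
    _ = eLpNorm (fun t => h (x - t) - h x) 1 (volume.withDensity ρ) ^ 2 := by
        rw [eLpNorm_one_eq_lintegral_enorm]
    _ ≤ eLpNorm (fun t => h (x - t) - h x) 2 (volume.withDensity ρ) ^ 2 := by
        gcongr
        exact eLpNorm_le_eLpNorm_of_exponent_le (by norm_num) hm'
    _ = _ := eLpNorm_two_sq _ _

/-- Integrating the Jensen bound in `x` and applying Tonelli leaves an average over `t` of squared
L² norms of translation differences. Only `t` in the support of the bump contributes. -/
lemma eLpNorm_normed_convolution_sub_le (φ : ContDiffBump (0 : E)) {h : E → ℂ}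
    (hh : MemLp h 2 volume) {ε : ENNReal}
    (hε : ∀ t ∈ ball (0 : E) φ.rOut, eLpNorm (fun x => h (x - t) - h x) 2 volume ≤ ε) :
    eLpNorm ((φ.normed volume ⋆[lsmul ℝ ℝ, volume] h) - h) 2 volume ≤ ε := by
  set ρ := fun t => ENNReal.ofReal (φ.normed volume t) with hρ
  have hρm : Measurable ρ := φ.continuous_normed.measurable.ennreal_ofReal
  rw [← ENNReal.pow_le_pow_left_iff (n := 2) (by norm_num), eLpNorm_two_sq]
  calc ∫⁻ x, ‖((φ.normed volume ⋆[lsmul ℝ ℝ, volume] h) - h) x‖ₑ ^ 2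
      ≤ ∫⁻ x, ∫⁻ t, ‖h (x - t) - h x‖ₑ ^ 2 ∂volume.withDensity ρ :=
        lintegral_mono fun x => enorm_normed_convolution_sub_sq_le φ hh x
    _ = ∫⁻ t, (∫⁻ x, ‖h (x - t) - h x‖ₑ ^ 2) ∂volume.withDensity ρ := by
        refine lintegral_lintegral_swap ?_
        refine AEMeasurable.pow_const (AEStronglyMeasurable.enorm ?_) _
        refine AEStronglyMeasurable.sub ?_ ?_
        -- `h` is only a.e. strongly measurable, so joint measurability of `h (x - t)` rests on
        -- subtraction pulling null sets back to null sets.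
        · exact hh.1.comp_quasiMeasurePreserving
            (((quasiMeasurePreserving_sub_of_right_invariant volume volume).mono_left
              (Measure.AbsolutelyContinuous.rfl.prod (withDensity_absolutelyContinuous _ _))))
        · exact hh.1.comp_fst
    _ = ∫⁻ t, ρ t * ∫⁻ x, ‖h (x - t) - h x‖ₑ ^ 2 := by
        rw [lintegral_withDensity_eq_lintegral_mul_non_measurable _ hρm
          (Eventually.of_forall fun t => ENNReal.ofReal_lt_top)]
        rfl
    _ ≤ ∫⁻ t, ρ t * ε ^ 2 := by
        refine lintegral_mono fun t => ?_
        by_cases ht : t ∈ ball (0 : E) φ.rOut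
        · rw [← eLpNorm_two_sq]
          gcongr
          exact hε t ht
        · have : φ.normed volume t = 0 := by
            rw [← φ.support_normed_eq (μ := volume)] at ht
            simpa using ht
          simp [hρ, this]
    _ = ε ^ 2 := by
        rw [lintegral_mul_const _ hρm, ← ofReal_integral_eq_lintegral_ofReal φ.integrable_normed
          (Eventually.of_forall φ.nonneg_normed), φ.integral_normed, ENNReal.ofReal_one, one_mul]

/-- Mollifications of a square-integrable function converge to it in `L²`. -/
lemma tendsto_eLpNorm_normed_convolution_sub {φ : ℕ → ContDiffBump (0 : E)}
    (hφ : Tendsto (fun m => (φ m).rOut) atTop (𝓝 0)) {h : E → ℂ} (hh : MemLp h 2 volume) :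
    Tendsto (fun m => eLpNorm (((φ m).normed volume ⋆[lsmul ℝ ℝ, volume] h) - h) 2 volume)
      atTop (𝓝 0) := by
  rw [ENNReal.tendsto_nhds_zero]
  intro ε hε
  obtain ⟨δ, hδ, hb⟩ := Metric.eventually_nhds_iff_ball.1
    ((ENNReal.tendsto_nhds_zero.1 (tendsto_eLpNorm_translate_sub hh)) ε hε)
  filter_upwards [hφ.eventually (gt_mem_nhds hδ)] with m hm
  exact eLpNorm_normed_convolution_sub_le (φ m) hh fun t ht => hb t (ball_subset_ball hm.le ht)

end Mollification

/-! ### Smooth approximation of functions with weak derivatives. -/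

section WeakApproximation

open Filter Metric ContinuousLinearMap
open scoped Convolution

variable {n : ℕ} {Ω : Set (EuclideanSpace ℝ (Fin n))} {i : Fin n}
  {u v : EuclideanSpace ℝ (Fin n) → ℂ}

/-- The derivative falls on the mollifier, and `y ↦ ρ (x - y)` is an admissible test function
because its support lies in the ball around `x`. The sign from the reflection cancels the sign in
the definition of the weak derivative. Truncation to `S` makes the convolutions meaningful globally
and is invisible on that ball. -/
lemma HasWeakPartial.fderiv_normed_convolution (hΩ : IsOpen Ω) (h : HasWeakPartial Ω i u v)
    (φ : ContDiffBump (0 : EuclideanSpace ℝ (Fin n))) {S : Set (EuclideanSpace ℝ (Fin n))}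
    (hS : IsCompact S) (hSΩ : S ⊆ Ω) {x : EuclideanSpace ℝ (Fin n)}
    (hx : closedBall x φ.rOut ⊆ S) :
    fderiv ℝ (φ.normed volume ⋆[lsmul ℝ ℝ, volume] S.indicator u) x (EuclideanSpace.single i 1) =
      (φ.normed volume ⋆[lsmul ℝ ℝ, volume] S.indicator v) x := by
  set e : EuclideanSpace ℝ (Fin n) := EuclideanSpace.single i 1
  set ρ := φ.normed volume
  have hρ : ContDiff ℝ ∞ ρ := φ.contDiff_normed
  have hρ1 : ContDiff ℝ 1 ρ := φ.contDiff_normed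
  have hρc : HasCompactSupport ρ := φ.hasCompactSupport_normed
  have hloc : LocallyIntegrable (S.indicator u) volume :=
    ((integrable_indicator_iff hS.measurableSet).2
      (h.1.integrableOn_compact_subset hSΩ hS)).locallyIntegrable
  have hex : ConvolutionExistsAt (fderiv ℝ ρ) (S.indicator u) x
      ((lsmul ℝ ℝ).precompL (EuclideanSpace ℝ (Fin n))) volume :=
    (hρc.fderiv ℝ).convolutionExists_left _ (hρ1.continuous_fderiv one_ne_zero) hloc x
  rw [(hρc.hasFDerivAt_convolution_left (lsmul ℝ ℝ) hρ1 hloc x).fderiv, convolution_eq_swap,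
    ContinuousLinearMap.integral_apply hex.integrable_swap, convolution_eq_swap]
  simp only [precompL_apply, lsmul_apply]
  set ψ : EuclideanSpace ℝ (Fin n) → ℝ := fun y => ρ (x - y)
  have hψ : ContDiff ℝ ∞ ψ := hρ.comp (contDiff_const.sub contDiff_id)
  have hψs : tsupport ψ ⊆ closedBall x φ.rOut := by
    refine closure_minimal (fun y hy => ?_) isClosed_closedBall
    have : x - y ∈ Function.support ρ := hy
    rw [φ.support_normed_eq] at this
    rw [mem_closedBall, dist_comm, dist_eq_norm]
    simpa using (mem_ball_zero_iff.1 this).le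
  have hψc : HasCompactSupport ψ := (isCompact_closedBall x φ.rOut).of_isClosed_subset
    (isClosed_tsupport _) hψs
  have hd : ∀ y, fderiv ℝ ψ y e = -fderiv ℝ ρ (x - y) e := fun y => by
    have h1 := ((hρ1.differentiable one_ne_zero (x - y)).hasFDerivAt.comp y
      ((hasFDerivAt_const x y).sub (hasFDerivAt_id y))).fderiv
    have h2 : fderiv ℝ ψ y = _ := h1
    rw [h2]
    simp
  have hw := h.2.2 ψ hψ hψc (hψs.trans (hx.trans hSΩ))
  have hz : ∀ y ∉ S, ψ y = 0 ∧ fderiv ℝ ψ y e = 0 := fun y hy => by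
    have h1 : y ∉ tsupport ψ := fun h' => hy (hx (hψs h'))
    refine ⟨image_eq_zero_of_notMem_tsupport h1, ?_⟩
    rw [image_eq_zero_of_notMem_tsupport fun h' => h1 (tsupport_fderiv_subset ℝ h'),
      zero_apply]
  have key : ∀ (a : EuclideanSpace ℝ (Fin n) → ℝ) (w : EuclideanSpace ℝ (Fin n) → ℂ),
      (∀ y ∉ S, a y = 0) → ∫ y, a y • S.indicator w y = ∫ y in Ω, a y • w y := fun a w ha => by
    rw [← integral_indicator hΩ.measurableSet]
    refine integral_congr_ae (Eventually.of_forall fun y => ?_)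
    by_cases hy : y ∈ S
    · simp [hy, hSΩ hy]
    · by_cases hy' : y ∈ Ω <;> simp [ha y hy, hy, hy']
  have e1 : ∀ y, fderiv ℝ ρ (x - y) e • S.indicator u y =
      -(fderiv ℝ ψ y e • S.indicator u y) := fun y => by rw [hd, neg_smul, neg_neg]
  simp_rw [e1]
  rw [integral_neg, key _ _ fun y hy => (hz y hy).2, hw, neg_neg, ← key _ _ fun y hy => (hz y hy).1]

/-- A continuous function whose weak gradient is locally square-integrable is, on a compact set,
a bounded pointwise limit of smooth functions whose gradients converge in `L²`. -/
theorem exists_smooth_approx (hΩ : IsOpen Ω) (hu : ContinuousOn u Ω)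
    {v : Fin n → EuclideanSpace ℝ (Fin n) → ℂ} (hv : ∀ i, HasWeakPartial Ω i u (v i))
    (hL : ∀ K ⊆ Ω, IsCompact K → ∀ i, MemLp (v i) 2 (volume.restrict K))
    {K : Set (EuclideanSpace ℝ (Fin n))} (hK : IsCompact K) (hKΩ : K ⊆ Ω) :
    ∃ U : ℕ → EuclideanSpace ℝ (Fin n) → ℂ, (∀ m, ContDiff ℝ ∞ (U m)) ∧
      (∀ x ∈ K, Tendsto (fun m => U m x) atTop (𝓝 (u x))) ∧
      (∃ C, ∀ m, ∀ x ∈ K, ‖U m x‖ ≤ C) ∧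
      ∀ i, Tendsto (fun m => eLpNorm
        (fun x => fderiv ℝ (U m) x (EuclideanSpace.single i 1) - v i x) 2 (volume.restrict K))
        atTop (𝓝 0) := by
  -- The thickening leaves room around `K` for every ball of radius at most `r`.
  obtain ⟨r, hr, hrΩ⟩ := hK.exists_cthickening_subset_open hΩ hKΩ
  set S := cthickening r K
  have hS : IsCompact S := hK.cthickening
  have hKS : K ⊆ S := self_subset_cthickening K
  -- The outer radii `r / (m + 1)` tend to 0 and never exceed `r`; the inner radius, one half of the
  -- outer one, plays no role.
  let φ : ℕ → ContDiffBump (0 : EuclideanSpace ℝ (Fin n)) := fun m =>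
    ⟨r / (m + 1) / 2, r / (m + 1), by positivity, half_lt_self (by positivity)⟩
  have hφ : Tendsto (fun m => (φ m).rOut) atTop (𝓝 0) :=
    by simpa [φ, div_eq_mul_inv] using
      (tendsto_one_div_add_atTop_nhds_zero_nat (𝕜 := ℝ)).const_mul r
  have hφr : ∀ m, (φ m).rOut ≤ r := fun m => div_le_self hr.le (by linarith [m.cast_nonneg (α := ℝ)])
  have hball : ∀ m, ∀ x ∈ K, closedBall x (φ m).rOut ⊆ S := fun m x hx =>
    (closedBall_subset_closedBall (hφr m)).trans (closedBall_subset_cthickening hx r)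
  have hint : Integrable (S.indicator u) volume :=
    (integrable_indicator_iff hS.measurableSet).2
      ((hu.mono hrΩ).integrableOn_compact hS)
  obtain ⟨C, hC⟩ := hS.exists_bound_of_continuousOn (hu.mono hrΩ)
  refine ⟨fun m => (φ m).normed volume ⋆[lsmul ℝ ℝ, volume] S.indicator u, fun m => ?_,
    fun x hx => ?_, ⟨max C 0, fun m x _ => ?_⟩, fun i => ?_⟩
  · exact (φ m).hasCompactSupport_normed.contDiff_convolution_left (lsmul ℝ ℝ)
      (φ m).contDiff_normed hint.locallyIntegrable
  · have hxS : S ∈ 𝓝 x := mem_of_superset (closedBall_mem_nhds x hr)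
      (closedBall_subset_cthickening hx r)
    have hev : S.indicator u =ᶠ[𝓝 x] u := by
      filter_upwards [hxS] with y hy
      simp [hy]
    have hc : ContinuousAt (S.indicator u) x :=
      (hu.continuousAt (mem_of_superset hxS hrΩ)).congr hev.symm
    have h1 := ContDiffBump.convolution_tendsto_right (μ := volume) (g := fun _ => S.indicator u)
      (k := fun _ => x) hφ (Eventually.of_forall fun _ => hint.1) (hc.tendsto.comp tendsto_snd)
      tendsto_const_nhds
    rwa [hev.eq_of_nhds] at h1
  · change ‖∫ t, lsmul ℝ ℝ ((φ m).normed volume t) (S.indicator u (x - t))‖ ≤ max C 0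
    have hb : ∀ y, ‖S.indicator u y‖ ≤ max C 0 := fun y => by
      by_cases hy : y ∈ S
      · simpa [hy] using Or.inl (hC y hy)
      · simp [hy]
    calc _ ≤ ∫ t, (φ m).normed volume t * max C 0 := by
          refine norm_integral_le_of_norm_le ((φ m).integrable_normed.mul_const _)
            (Eventually.of_forall fun t => ?_)
          rw [lsmul_apply, norm_smul, Real.norm_of_nonneg ((φ m).nonneg_normed t)]
          exact mul_le_mul_of_nonneg_left (hb _) ((φ m).nonneg_normed t)
      _ = max C 0 := by rw [integral_mul_const, (φ m).integral_normed, one_mul]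
  · have hm : MemLp (S.indicator (v i)) 2 volume :=
      (memLp_indicator_iff_restrict hS.measurableSet).2 (hL S hrΩ hS i)
    -- On `K` the gradient of the mollification is the mollification of the truncated `v i`, so the
    -- error on `K` is at most the global L² error.
    refine tendsto_of_tendsto_of_tendsto_of_le_of_le tendsto_const_nhds
      (tendsto_eLpNorm_normed_convolution_sub hφ hm) (fun m => zero_le) fun m => ?_
    refine le_trans (le_of_eq ?_) (eLpNorm_mono_measure _ (Measure.restrict_le_self (s := K)))
    refine eLpNorm_congr_ae ((ae_restrict_iff' hK.measurableSet).2 (Eventually.of_forall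
      fun x hx => ?_))
    simp only [Pi.sub_apply]
    rw [HasWeakPartial.fderiv_normed_convolution hΩ (hv i) (φ m) hS hrΩ (hball m x hx),
      Set.indicator_of_mem (hKS hx)]

end WeakApproximation

/-! ### Passage to the limit in integrals of products. -/

section Limits

open Filter

variable {α : Type*} [MeasurableSpace α] {μ : Measure α}

lemma tendsto_integral_mul_of_bounded {F : ℕ → α → ℂ} {F₀ w : α → ℂ} {C : ℝ}
    (hF : ∀ m, AEStronglyMeasurable (F m) μ) (hC : ∀ m, ∀ᵐ x ∂μ, ‖F m x‖ ≤ C)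
    (hlim : ∀ᵐ x ∂μ, Tendsto (fun m => F m x) atTop (𝓝 (F₀ x))) (hw : Integrable w μ) :
    Tendsto (fun m => ∫ x, F m x * w x ∂μ) atTop (𝓝 (∫ x, F₀ x * w x ∂μ)) := by
  refine tendsto_integral_of_dominated_convergence (fun x => C * ‖w x‖)
    (fun m => (hF m).mul hw.1) (hw.norm.const_mul C) (fun m => ?_) ?_
  · filter_upwards [hC m] with x hx
    rw [norm_mul]
    gcongr
  · filter_upwards [hlim] with x hx
    exact hx.mul_const _

/-- Split `T m (g m)` into `T m (g m - g₀)` and `T m g₀`. The first part is controlled by the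
uniform bound on `T m` and the Cauchy–Schwarz inequality, the second by dominated convergence. -/
lemma tendsto_integral_clm_mul {T : ℕ → α → ℂ →L[ℝ] ℂ} {T₀ : α → ℂ →L[ℝ] ℂ} {g : ℕ → α → ℂ}
    {g₀ c : α → ℂ} {C : ℝ} (hT : ∀ m, AEStronglyMeasurable (T m) μ)
    (hC : ∀ m, ∀ᵐ x ∂μ, ‖T m x‖ ≤ C)
    (hlim : ∀ᵐ x ∂μ, Tendsto (fun m => T m x) atTop (𝓝 (T₀ x)))
    (hg : ∀ m, MemLp (g m) 2 μ) (hg₀ : MemLp g₀ 2 μ) (hc : MemLp c 2 μ)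
    (hgg : Tendsto (fun m => eLpNorm (fun x => g m x - g₀ x) 2 μ) atTop (𝓝 0)) :
    Tendsto (fun m => ∫ x, T m x (g m x) * c x ∂μ) atTop (𝓝 (∫ x, T₀ x (g₀ x) * c x ∂μ)) := by
  have happ : ∀ m (w : α → ℂ), MemLp w 2 μ → MemLp (fun x => T m x (w x)) 2 μ := fun m w hw => by
    refine hw.of_le_mul (c := C) ?_ ?_
    · exact (ContinuousLinearMap.apply ℝ ℂ).aestronglyMeasurable_comp₂ hw.1 (hT m)
    · filter_upwards [hC m] with x hx
      exact ((T m x).le_opNorm _).trans (by gcongr)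
  have hint : ∀ m (w : α → ℂ), MemLp w 2 μ → Integrable (fun x => T m x (w x) * c x) μ :=
    fun m w hw => (happ m w hw).integrable_mul hc
  have h1 : Tendsto (fun m => ∫ x, T m x (g₀ x) * c x ∂μ) atTop
      (𝓝 (∫ x, T₀ x (g₀ x) * c x ∂μ)) := by
    have hgc : Integrable (fun x => C * ‖g₀ x * c x‖) μ := (hg₀.integrable_mul hc).norm.const_mul C
    refine tendsto_integral_of_dominated_convergence _ (fun m => (hint m g₀ hg₀).1) hgc
      (fun m => ?_) ?_
    · filter_upwards [hC m] with x hx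
      rw [norm_mul, norm_mul, ← mul_assoc]
      gcongr
      exact ((T m x).le_opNorm _).trans (by gcongr)
    · filter_upwards [hlim] with x hx
      exact (((ContinuousLinearMap.apply ℝ ℂ (g₀ x)).continuous.tendsto _).comp hx).mul_const _
  have h2 : Tendsto (fun m => ∫ x, T m x (g m x - g₀ x) * c x ∂μ) atTop (𝓝 0) := by
    rw [tendsto_zero_iff_enorm_tendsto_zero]
    have hb : Tendsto (fun m => ENNReal.ofReal C * (eLpNorm (fun x => g m x - g₀ x) 2 μ *
        eLpNorm c 2 μ)) atTop (𝓝 0) := by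
      have := ENNReal.Tendsto.const_mul (a := ENNReal.ofReal C)
        (ENNReal.Tendsto.mul_const (b := eLpNorm c 2 μ) hgg (Or.inr hc.2.ne))
        (Or.inr ENNReal.ofReal_ne_top)
      simpa using this
    refine tendsto_of_tendsto_of_tendsto_of_le_of_le tendsto_const_nhds hb (fun m => zero_le)
      fun m => ?_
    calc ‖∫ x, T m x (g m x - g₀ x) * c x ∂μ‖ₑ
        ≤ ∫⁻ x, ‖T m x (g m x - g₀ x) * c x‖ₑ ∂μ := enorm_integral_le_lintegral_enorm _
      _ ≤ ∫⁻ x, ENNReal.ofReal C * ‖(g m x - g₀ x) * c x‖ₑ ∂μ := by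
          refine lintegral_mono_ae ?_
          filter_upwards [hC m] with x hx
          rw [enorm_mul, enorm_mul, ← mul_assoc]
          gcongr
          refine ((T m x).le_opENorm _).trans ?_
          gcongr
          rw [← ofReal_norm]
          exact ENNReal.ofReal_le_ofReal hx
      _ = ENNReal.ofReal C * eLpNorm (fun x => (g m x - g₀ x) * c x) 1 μ := by
          rw [lintegral_const_mul' _ _ ENNReal.ofReal_ne_top, eLpNorm_one_eq_lintegral_enorm]
      _ ≤ _ := by
          gcongr
          have hs : AEStronglyMeasurable (fun x => g m x - g₀ x) μ := ((hg m).sub hg₀).1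
          have := eLpNorm_smul_le_mul_eLpNorm (p := 2) (q := 2) (r := 1) hc.1 hs
          exact this
  have h3 := h2.add h1
  rw [zero_add] at h3
  refine h3.congr fun m => ?_
  rw [← integral_add (hint m (fun x => g m x - g₀ x) ((hg m).sub hg₀)) (hint m _ hg₀)]
  refine integral_congr_ae (Eventually.of_forall fun x => ?_)
  simp only [map_sub]
  ring

end Limits

/-! ### Integration by parts against smooth functions of a Sobolev function. -/

section WeakCalculus

open Filter Metric ContinuousLinearMap

variable {n : ℕ} {Ω : Set (EuclideanSpace ℝ (Fin n))} {i : Fin n}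
  {u v : EuclideanSpace ℝ (Fin n) → ℂ}

/-- The definition of weak derivatives, tested against complex-valued functions. -/
lemma HasWeakPartial.integral_complex (h : HasWeakPartial Ω i u v)
    {ψ : EuclideanSpace ℝ (Fin n) → ℂ} (hψ : ContDiff ℝ ∞ ψ) (hc : HasCompactSupport ψ)
    (hs : tsupport ψ ⊆ Ω) :
    ∫ x in Ω, fderiv ℝ ψ x (EuclideanSpace.single i 1) * u x = -∫ x in Ω, ψ x * v x := by
  set e : EuclideanSpace ℝ (Fin n) := EuclideanSpace.single i 1
  -- Real-linear functionals of `ψ` are again real test functions; this is applied to the real and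
  -- imaginary parts.
  have key : ∀ L : ℂ →L[ℝ] ℝ, ContDiff ℝ ∞ (fun x => L (ψ x)) ∧
      HasCompactSupport (fun x => L (ψ x)) ∧ tsupport (fun x => L (ψ x)) ⊆ Ω ∧
      ∀ x, fderiv ℝ (fun x => L (ψ x)) x e = L (fderiv ℝ ψ x e) := fun L => by
    refine ⟨L.contDiff.comp hψ, hc.comp_left (map_zero L),
      (closure_mono (Function.support_subset_iff'.2 fun x hx => by
        rw [Function.notMem_support.1 hx, map_zero])).trans hs, fun x => ?_⟩
    have h1 := (L.hasFDerivAt.comp x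
      ((hψ.differentiable (by simp)) x).hasFDerivAt).fderiv
    have h2 : fderiv ℝ (fun x => L (ψ x)) x = _ := h1
    rw [h2]
    rfl
  obtain ⟨r1, r2, r3, r4⟩ := key Complex.reCLM
  obtain ⟨i1, i2, i3, i4⟩ := key Complex.imCLM
  obtain ⟨ra, rb, rc⟩ := fderiv_props r1 r2 r3 e
  obtain ⟨ia, ib, ic⟩ := fderiv_props i1 i2 i3 e
  have hr := h.2.2 _ r1 r2 r3
  have hi := h.2.2 _ i1 i2 i3
  have split : ∀ z w : ℂ, z * w = z.re • w + Complex.I * (z.im • w) := fun z w => by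
    conv_lhs => rw [← Complex.re_add_im z]
    simp only [Complex.real_smul]
    ring
  have e1 : ∀ x, fderiv ℝ ψ x e * u x = fderiv ℝ (fun x => Complex.reCLM (ψ x)) x e • u x +
      Complex.I * (fderiv ℝ (fun x => Complex.imCLM (ψ x)) x e • u x) := fun x => by
    rw [split, r4, i4]
    rfl
  have e2 : ∀ x, ψ x * v x = Complex.reCLM (ψ x) • v x +
      Complex.I * (Complex.imCLM (ψ x) • v x) := fun x => split _ _
  simp_rw [e1, e2]
  rw [integral_add (integrableOn_mul ra rb rc h.1) ((integrableOn_mul ia ib ic h.1).const_mul _),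
    integral_add (integrableOn_mul r1.continuous r2 r3 h.2.1)
      ((integrableOn_mul i1.continuous i2 i3 h.2.1).const_mul _),
    integral_const_mul, integral_const_mul, hr, hi]
  ring

/-- Integration by parts against `Y Θ(u)`, where `Θ` is smooth and `u` has locally
square-integrable weak derivatives. -/
theorem HasWeakPartial.integral_comp_smooth (hΩ : IsOpen Ω) (hu : ContinuousOn u Ω)
    {D : Fin n → EuclideanSpace ℝ (Fin n) → ℂ} (hD : ∀ i, HasWeakPartial Ω i u (D i))
    (hL : ∀ K ⊆ Ω, IsCompact K → ∀ i, MemLp (D i) 2 (volume.restrict K))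
    {v' : EuclideanSpace ℝ (Fin n) → ℂ} (hv : HasWeakPartial Ω i v v')
    (hvL : ∀ K ⊆ Ω, IsCompact K → MemLp v 2 (volume.restrict K))
    {Θ : ℂ → ℂ} (hΘ : ContDiff ℝ ∞ Θ) {Y : EuclideanSpace ℝ (Fin n) → ℝ} (hY : ContDiff ℝ ∞ Y)
    (hYc : HasCompactSupport Y) (hYs : tsupport Y ⊆ Ω) :
    ∫ x in Ω, (Y x : ℂ) * Θ (u x) * v' x =
      -∫ x in Ω, ((fderiv ℝ Y x (EuclideanSpace.single i 1) : ℂ) * Θ (u x) +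
        (Y x : ℂ) * fderiv ℝ Θ (u x) (D i x)) * v x := by
  set e : EuclideanSpace ℝ (Fin n) := EuclideanSpace.single i 1
  set K := tsupport Y
  have hK : IsCompact K := hYc
  -- With `U m` in place of `u`, the product `Y Θ(U m)` is a genuine test function. The identity for
  -- `u` is the limit of the identities for `U m`.
  obtain ⟨U, hU, hUlim, ⟨C, hC⟩, hUd⟩ := exists_smooth_approx hΩ hu hD hL hK hYs
  have hΘd : Continuous (fderiv ℝ Θ) := hΘ.continuous_fderiv (by simp)
  have hYd : Continuous fun x => fderiv ℝ Y x e :=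
    (hY.continuous_fderiv (by simp)).clm_apply continuous_const
  have hUe : ∀ m, Continuous fun x => fderiv ℝ (U m) x e := fun m =>
    ((hU m).continuous_fderiv (by simp)).clm_apply continuous_const
  -- All values of `U m` on `K` lie in one compact disc, so `Θ` and its derivative are bounded there
  -- uniformly in `m`.
  obtain ⟨A, hA⟩ := (isCompact_closedBall (0 : ℂ) C).exists_bound_of_continuousOn
    hΘ.continuous.continuousOn
  obtain ⟨A', hA'⟩ := (isCompact_closedBall (0 : ℂ) C).exists_bound_of_continuousOn
    hΘd.continuousOn
  obtain ⟨B, hB⟩ := hK.exists_bound_of_continuousOn hY.continuous.continuousOn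
  obtain ⟨B', hB'⟩ := hK.exists_bound_of_continuousOn hYd.continuousOn
  have hmem : ∀ m, ∀ x ∈ K, U m x ∈ closedBall (0 : ℂ) C := fun m x hx => by
    simpa using hC m x hx
  have hYz : ∀ x ∉ K, Y x = 0 := fun x hx => image_eq_zero_of_notMem_tsupport hx
  have hYz' : ∀ x ∉ K, fderiv ℝ Y x e = 0 := fun x hx => by
    rw [image_eq_zero_of_notMem_tsupport fun h' => hx (tsupport_fderiv_subset ℝ h'), zero_apply]
  have toK : ∀ F : EuclideanSpace ℝ (Fin n) → ℂ, (∀ x ∉ K, F x = 0) →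
      ∫ x in Ω, F x = ∫ x in K, F x := fun F hF =>
    setIntegral_eq_of_subset_of_forall_sdiff_eq_zero hΩ.measurableSet hYs fun x hx => hF x hx.2
  have hae : ∀ {p : EuclideanSpace ℝ (Fin n) → Prop}, (∀ x ∈ K, p x) →
      ∀ᵐ x ∂volume.restrict K, p x := fun h =>
    (ae_restrict_iff' hK.measurableSet).2 (Eventually.of_forall h)
  have hvK : MemLp v 2 (volume.restrict K) := hvL K hYs hK
  have hvi : IntegrableOn v K volume := hv.1.integrableOn_compact_subset hYs hK
  have hvi' : IntegrableOn v' K volume := hv.2.1.integrableOn_compact_subset hYs hK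
  have hfd : ∀ m x, fderiv ℝ (fun x => (Y x : ℂ) * Θ (U m x)) x e =
      (fderiv ℝ Y x e : ℂ) * Θ (U m x) +
        (Y x : ℂ) * fderiv ℝ Θ (U m x) (fderiv ℝ (U m) x e) := fun m x => by
    have h1 : HasFDerivAt (fun x => (Y x : ℂ)) (Complex.ofRealCLM.comp (fderiv ℝ Y x)) x :=
      Complex.ofRealCLM.hasFDerivAt.comp x ((hY.differentiable (by simp)) x).hasFDerivAt
    have h2 : HasFDerivAt (fun x => Θ (U m x)) ((fderiv ℝ Θ (U m x)).comp (fderiv ℝ (U m) x)) x :=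
      ((hΘ.differentiable (by simp)) _).hasFDerivAt.comp x
        (((hU m).differentiable (by simp)) x).hasFDerivAt
    have h3 : fderiv ℝ (fun x => (Y x : ℂ) * Θ (U m x)) x = _ := (h1.mul h2).fderiv
    rw [h3]
    simp only [add_apply, smul_apply, comp_apply, Complex.ofRealCLM_apply, smul_eq_mul]
    ring
  have hsm : ∀ m, ContDiff ℝ ∞ fun x => (Y x : ℂ) * Θ (U m x) := fun m =>
    (Complex.ofRealCLM.contDiff.comp hY).mul (hΘ.comp (hU m))
  have hts : ∀ m, tsupport (fun x => (Y x : ℂ) * Θ (U m x)) ⊆ K := fun m =>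
    closure_mono fun x hx h0 => hx (by simp [h0])
  have hid : ∀ m, ∫ x in K, ((fderiv ℝ Y x e : ℂ) * Θ (U m x) +
        (Y x : ℂ) * fderiv ℝ Θ (U m x) (fderiv ℝ (U m) x e)) * v x =
      -∫ x in K, ((Y x : ℂ) * Θ (U m x)) * v' x := fun m => by
    have h0 := hv.integral_complex (hsm m)
      (hK.of_isClosed_subset (isClosed_tsupport _) (hts m)) ((hts m).trans hYs)
    rw [toK (fun x => (Y x : ℂ) * Θ (U m x) * v' x) fun x hx => by simp [hYz x hx]] at h0
    rw [← h0, toK]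
    · exact integral_congr_ae (Eventually.of_forall fun x => congrArg (· * v x) (hfd m x).symm)
    · intro x hx
      rw [hfd, hYz x hx, hYz' x hx]
      simp
  have l1 : Tendsto (fun m => ∫ x in K, ((Y x : ℂ) * Θ (U m x)) * v' x) atTop
      (𝓝 (∫ x in K, ((Y x : ℂ) * Θ (u x)) * v' x)) := by
    refine tendsto_integral_mul_of_bounded (C := B * A)
      (fun m => (hsm m).continuous.aestronglyMeasurable) (fun m => hae fun x hx => ?_)
      (hae fun x hx => ?_) hvi'
    · rw [norm_mul, Complex.norm_real]
      exact mul_le_mul (hB x hx) (hA _ (hmem m x hx)) (norm_nonneg _)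
        ((norm_nonneg _).trans (hB x hx))
    · exact ((hΘ.continuous.tendsto _).comp (hUlim x hx)).const_mul _
  have l2 : Tendsto (fun m => ∫ x in K, ((fderiv ℝ Y x e : ℂ) * Θ (U m x)) * v x) atTop
      (𝓝 (∫ x in K, ((fderiv ℝ Y x e : ℂ) * Θ (u x)) * v x)) := by
    refine tendsto_integral_mul_of_bounded (C := B' * A)
      (fun m => ((Complex.continuous_ofReal.comp hYd).mul
        (hΘ.continuous.comp (hU m).continuous)).aestronglyMeasurable) (fun m => hae fun x hx => ?_)
      (hae fun x hx => ?_) hvi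
    · rw [norm_mul, Complex.norm_real]
      exact mul_le_mul (hB' x hx) (hA _ (hmem m x hx)) (norm_nonneg _)
        ((norm_nonneg _).trans (hB' x hx))
    · exact ((hΘ.continuous.tendsto _).comp (hUlim x hx)).const_mul _
  have hUL : ∀ m, MemLp (fun x => fderiv ℝ (U m) x e) 2 (volume.restrict K) := fun m => by
    have : IsFiniteMeasure (volume.restrict K) := ⟨by simpa using hK.measure_lt_top⟩
    obtain ⟨c, hc⟩ := hK.exists_bound_of_continuousOn (hUe m).continuousOn
    exact MemLp.of_bound (hUe m).aestronglyMeasurable c (hae hc)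
  -- Here the coefficients converge only pointwise with a bound, and the gradients only in L²; hence
  -- the assumption that `v` is square-integrable on `K`.
  have l3 : Tendsto (fun m => ∫ x in K, (Y x • fderiv ℝ Θ (U m x)) (fderiv ℝ (U m) x e) * v x) atTop
      (𝓝 (∫ x in K, (Y x • fderiv ℝ Θ (u x)) (D i x) * v x)) := by
    refine tendsto_integral_clm_mul (C := B * A')
      (fun m => (hY.continuous.smul (hΘd.comp (hU m).continuous)).aestronglyMeasurable)
      (fun m => hae fun x hx => ?_) (hae fun x hx => ?_) hUL (hL K hYs hK i) hvK (hUd i)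
    · rw [norm_smul]
      exact mul_le_mul (hB x hx) (hA' _ (hmem m x hx)) (norm_nonneg _)
        ((norm_nonneg _).trans (hB x hx))
    · exact ((hΘd.tendsto _).comp (hUlim x hx)).const_smul _
  have hi2 : ∀ m, Integrable (fun x => ((fderiv ℝ Y x e : ℂ) * Θ (U m x)) * v x)
      (volume.restrict K) := fun m =>
    hvi.continuousOn_mul ((Complex.continuous_ofReal.comp hYd).mul
      (hΘ.continuous.comp (hU m).continuous)).continuousOn hK
  have hi3 : ∀ m, Integrable (fun x => (Y x • fderiv ℝ Θ (U m x)) (fderiv ℝ (U m) x e) * v x)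
      (volume.restrict K) := fun m =>
    hvi.continuousOn_mul (((hY.continuous.smul (hΘd.comp (hU m).continuous)).clm_apply
      (hUe m))).continuousOn hK
  have hi2' : Integrable (fun x => ((fderiv ℝ Y x e : ℂ) * Θ (u x)) * v x)
      (volume.restrict K) :=
    hvi.continuousOn_mul ((Complex.continuous_ofReal.comp hYd).continuousOn.mul
      (hΘ.continuous.comp_continuousOn (hu.mono hYs))) hK
  have hi3' : Integrable (fun x => (Y x • fderiv ℝ Θ (u x)) (D i x) * v x)
      (volume.restrict K) := by
    have hT : ContinuousOn (fun x => Y x • fderiv ℝ Θ (u x)) K :=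
      hY.continuous.continuousOn.smul (hΘd.comp_continuousOn (hu.mono hYs))
    obtain ⟨c, hc⟩ := hK.exists_bound_of_continuousOn hT
    refine MemLp.integrable_mul (p := 2) (q := 2) ?_ hvK
    refine (hL K hYs hK i).of_le_mul (c := c) ?_ (hae fun x hx => ?_)
    · exact (ContinuousLinearMap.apply ℝ ℂ).aestronglyMeasurable_comp₂ (hL K hYs hK i).1
        (hT.aestronglyMeasurable hK.measurableSet)
    · exact (ContinuousLinearMap.le_opNorm _ _).trans (by gcongr; exact hc x hx)
  have hlim := tendsto_nhds_unique (l2.add l3) (l1.neg.congr fun m => by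
    rw [← hid m, ← integral_add (hi2 m) (hi3 m)]
    refine integral_congr_ae (Eventually.of_forall fun x => ?_)
    simp only [smul_apply, Complex.real_smul]
    ring)
  rw [toK _ fun x hx => by simp [hYz x hx], toK _ fun x hx => by simp [hYz x hx, hYz' x hx],
    ← neg_eq_iff_eq_neg, ← hlim, ← integral_add hi2' hi3']
  refine integral_congr_ae (Eventually.of_forall fun x => ?_)
  simp only [smul_apply, Complex.real_smul]
  ring

end WeakCalculus

/-! ### Weak derivatives under a change of coordinates. -/

section ChainRule

open Filter Metric ContinuousLinearMap

variable {n : ℕ} {Ω₁ Ω₂ : Set (EuclideanSpace ℝ (Fin n))}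
  {τ : EuclideanSpace ℝ (Fin n) → EuclideanSpace ℝ (Fin n)}

lemma euclidean_sum_single (w : EuclideanSpace ℝ (Fin n)) :
    w = ∑ j, w j • EuclideanSpace.single j (1 : ℝ) := by
  conv_lhs => rw [← (EuclideanSpace.basisFun (Fin n) ℝ).sum_repr w]
  simp

/-- Change of variables gives integrability with the Jacobian factor, which is then divided out, its
inverse being continuous on the compact set `K`. -/
lemma integrableOn_comp_of_image {K : Set (EuclideanSpace ℝ (Fin n))} (hK : IsCompact K)
    (hd : ∀ x ∈ K, DifferentiableAt ℝ τ x) (hdc : ContinuousOn (fderiv ℝ τ) K)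
    (hinj : Set.InjOn τ K) (hdet : ∀ x ∈ K, (fderiv ℝ τ x).det ≠ 0)
    {F : EuclideanSpace ℝ (Fin n) → ℂ} (hF : IntegrableOn F (τ '' K) volume) :
    IntegrableOn (fun x => F (τ x)) K volume := by
  have h1 := (integrableOn_image_iff_integrableOn_abs_det_fderiv_smul volume hK.measurableSet
    (fun x hx => (hd x hx).hasFDerivAt.hasFDerivWithinAt) hinj F).1 hF
  have hc : ContinuousOn (fun x => |(fderiv ℝ τ x).det|⁻¹) K :=
    ((ContinuousLinearMap.continuous_det.comp_continuousOn hdc).abs).inv₀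
      fun x hx => abs_ne_zero.2 (hdet x hx)
  refine (h1.continuousOn_smul hc hK).congr_fun (fun x hx => ?_) hK.measurableSet
  simp only [smul_smul]
  rw [inv_mul_cancel₀ (abs_ne_zero.2 (hdet x hx)), one_smul]

/-- On `K` the factor `c` is dominated by a constant times the Jacobian, so a change of variables
bounds the error by the L¹ norm on `τ '' K`. That set has finite measure, so the L² norm controls
it. -/
lemma tendsto_integral_mul_comp {K : Set (EuclideanSpace ℝ (Fin n))} (hK : IsCompact K)
    (hd : ∀ x ∈ K, DifferentiableAt ℝ τ x) (hdc : ContinuousOn (fderiv ℝ τ) K)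
    (hinj : Set.InjOn τ K) (hdet : ∀ x ∈ K, (fderiv ℝ τ x).det ≠ 0)
    {c F₀ : EuclideanSpace ℝ (Fin n) → ℂ} {F : ℕ → EuclideanSpace ℝ (Fin n) → ℂ}
    (hc : ContinuousOn c K) (hF : ∀ m, Continuous (F m))
    (hF₀ : MemLp F₀ 2 (volume.restrict (τ '' K)))
    (hlim : Tendsto (fun m => eLpNorm (fun y => F m y - F₀ y) 2 (volume.restrict (τ '' K)))
      atTop (𝓝 0)) :
    Tendsto (fun m => ∫ x in K, c x * F m (τ x)) atTop (𝓝 (∫ x in K, c x * F₀ (τ x))) := by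
  have hτK : ContinuousOn τ K := fun x hx => (hd x hx).continuousAt.continuousWithinAt
  have hK₂ : IsCompact (τ '' K) := hK.image_of_continuousOn hτK
  have hfin : IsFiniteMeasure (volume.restrict (τ '' K)) := ⟨by simpa using hK₂.measure_lt_top⟩
  obtain ⟨B, hB⟩ := hK.exists_bound_of_continuousOn (f := fun x => c x / (fderiv ℝ τ x).det)
    (hc.div (Complex.continuous_ofReal.comp_continuousOn
      (ContinuousLinearMap.continuous_det.comp_continuousOn hdc))
      fun x hx => Complex.ofReal_ne_zero.2 (hdet x hx))
  have hcB : ∀ x ∈ K, ‖c x‖ₑ ≤ ENNReal.ofReal B * ENNReal.ofReal |(fderiv ℝ τ x).det| :=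
    fun x hx => by
      have h1 := hB x hx
      rw [norm_div, Complex.norm_real, Real.norm_eq_abs,
        div_le_iff₀ (abs_pos.2 (hdet x hx))] at h1
      rw [← ofReal_norm, ← ENNReal.ofReal_mul' (abs_nonneg _)]
      exact ENNReal.ofReal_le_ofReal h1
  have hi₀ : IntegrableOn (fun x => c x * F₀ (τ x)) K volume :=
    (integrableOn_comp_of_image hK hd hdc hinj hdet
      (hF₀.integrable (by norm_num))).continuousOn_mul hc hK
  have hi : ∀ m, IntegrableOn (fun x => c x * F m (τ x)) K volume := fun m =>
    (hc.mul ((hF m).comp_continuousOn hτK)).integrableOn_compact hK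
  rw [tendsto_iff_edist_tendsto_0]
  have hb : Tendsto (fun m => ENNReal.ofReal B *
      (eLpNorm (fun y => F m y - F₀ y) 2 (volume.restrict (τ '' K)) *
        (volume.restrict (τ '' K)) Set.univ ^ (1 / (1 : ENNReal).toReal - 1 / (2 : ENNReal).toReal)))
      atTop (𝓝 0) := by
    have := ENNReal.Tendsto.const_mul (a := ENNReal.ofReal B) (ENNReal.Tendsto.mul_const
      (b := (volume.restrict (τ '' K)) Set.univ ^
        (1 / (1 : ENNReal).toReal - 1 / (2 : ENNReal).toReal)) hlim
      (Or.inr (ENNReal.rpow_ne_top_of_nonneg (by norm_num) (measure_ne_top _ _))))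
      (Or.inr ENNReal.ofReal_ne_top)
    simpa only [zero_mul, mul_zero] using this
  refine tendsto_of_tendsto_of_tendsto_of_le_of_le tendsto_const_nhds hb (fun m => zero_le)
    fun m => ?_
  rw [edist_eq_enorm_sub, ← integral_sub (hi m) hi₀]
  calc ‖∫ x in K, (c x * F m (τ x) - c x * F₀ (τ x))‖ₑ
      ≤ ∫⁻ x in K, ‖c x * F m (τ x) - c x * F₀ (τ x)‖ₑ := enorm_integral_le_lintegral_enorm _
    _ ≤ ∫⁻ x in K, ENNReal.ofReal B *
          (ENNReal.ofReal |(fderiv ℝ τ x).det| * ‖F m (τ x) - F₀ (τ x)‖ₑ) := by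
        refine setLIntegral_mono_ae' hK.measurableSet (Eventually.of_forall fun x hx => ?_)
        rw [← mul_sub, enorm_mul, ← mul_assoc]
        gcongr
        exact hcB x hx
    _ = ENNReal.ofReal B * eLpNorm (fun y => F m y - F₀ y) 1 (volume.restrict (τ '' K)) := by
        rw [lintegral_const_mul' _ _ ENNReal.ofReal_ne_top, eLpNorm_one_eq_lintegral_enorm,
          lintegral_image_eq_lintegral_abs_det_fderiv_mul volume hK.measurableSet
            (fun x hx => (hd x hx).hasFDerivAt.hasFDerivWithinAt) hinj]
    _ ≤ _ := by
        gcongr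
        exact eLpNorm_le_eLpNorm_mul_rpow_measure_univ (by norm_num)
          ((hF m).aestronglyMeasurable.sub hF₀.1)

/-- The chain rule for weak derivatives under a smooth change of coordinates. -/
theorem HasWeakPartial.chain_rule (hΩ₁ : IsOpen Ω₁) (hΩ₂ : IsOpen Ω₂) (hτ : ContDiffOn ℝ ∞ τ Ω₁)
    (hmaps : Set.MapsTo τ Ω₁ Ω₂) (hinj : Set.InjOn τ Ω₁)
    (hdet : ∀ x ∈ Ω₁, (fderiv ℝ τ x).det ≠ 0) {u₁ u₂ : EuclideanSpace ℝ (Fin n) → ℂ}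
    (hu : ∀ x ∈ Ω₁, u₁ x = u₂ (τ x)) (hu₂ : ContinuousOn u₂ Ω₂)
    {D₂ : Fin n → EuclideanSpace ℝ (Fin n) → ℂ} (hD₂ : ∀ i, HasWeakPartial Ω₂ i u₂ (D₂ i))
    (hL : ∀ K ⊆ Ω₂, IsCompact K → ∀ i, MemLp (D₂ i) 2 (volume.restrict K))
    {i : Fin n} {w : EuclideanSpace ℝ (Fin n) → ℂ} (hw : HasWeakPartial Ω₁ i u₁ w) :
    ∀ᵐ x ∂volume.restrict Ω₁, w x =
      ∑ j, (fderiv ℝ τ x (EuclideanSpace.single i 1) j : ℂ) * D₂ j (τ x) := by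
  set e : EuclideanSpace ℝ (Fin n) := EuclideanSpace.single i 1
  have hd : ∀ x ∈ Ω₁, DifferentiableAt ℝ τ x := fun x hx =>
    (hτ.differentiableOn (by simp)).differentiableAt (hΩ₁.mem_nhds hx)
  have hdc : ContinuousOn (fderiv ℝ τ) Ω₁ := hτ.continuousOn_fderiv_of_isOpen hΩ₁ (by simp)
  have hcj : ∀ j, ContinuousOn (fun x => (fderiv ℝ τ x e j : ℂ)) Ω₁ := fun j =>
    Complex.continuous_ofReal.comp_continuousOn
      ((EuclideanSpace.proj (𝕜 := ℝ) j).continuous.comp_continuousOn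
        (hdc.clm_apply continuousOn_const))
  have himg : ∀ K ⊆ Ω₁, τ '' K ⊆ Ω₂ := fun K hK => by
    rintro _ ⟨x, hx, rfl⟩
    exact hmaps (hK hx)
  have hcomp : ∀ K ⊆ Ω₁, IsCompact K → ∀ j, IntegrableOn (fun x => D₂ j (τ x)) K volume :=
    fun K hK hKc j => integrableOn_comp_of_image hKc (fun x hx => hd x (hK hx)) (hdc.mono hK)
      (hinj.mono hK) (fun x hx => hdet x (hK hx))
      ((hD₂ j).2.1.integrableOn_compact_subset (himg K hK)
        (hKc.image_of_continuousOn (hτ.continuousOn.mono hK)))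
  set G : EuclideanSpace ℝ (Fin n) → ℂ := fun x => ∑ j, (fderiv ℝ τ x e j : ℂ) * D₂ j (τ x)
  have hGK : ∀ K ⊆ Ω₁, IsCompact K → IntegrableOn G K volume := fun K hK hKc =>
    integrable_finsetSum _ fun j _ => (hcomp K hK hKc j).continuousOn_mul ((hcj j).mono hK) hKc
  have hGloc : LocallyIntegrableOn G Ω₁ volume :=
    (locallyIntegrableOn_iff hΩ₁.isLocallyClosed).2 fun K hK hKc => hGK K hK hKc
  suffices h : ∀ᵐ x ∂volume.restrict Ω₁, (w - G) x = 0 by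
    filter_upwards [h] with x hx
    exact sub_eq_zero.1 hx
  rw [ae_restrict_iff' hΩ₁.measurableSet]
  -- Both candidates for the weak derivative are locally integrable on `Ω₁`, so it is enough to test
  -- their difference.
  refine hΩ₁.ae_eq_zero_of_integral_contDiff_smul_eq_zero (hw.2.1.sub hGloc) fun ψ hψ hψc hψs => ?_
  set K := tsupport ψ
  have hK : IsCompact K := hψc
  have hψz : ∀ x ∉ K, ψ x = 0 := fun x hx => image_eq_zero_of_notMem_tsupport hx
  have hψz' : ∀ x ∉ K, fderiv ℝ ψ x e = 0 := fun x hx => by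
    rw [image_eq_zero_of_notMem_tsupport fun h' => hx (tsupport_fderiv_subset ℝ h'), zero_apply]
  have hψd : Continuous fun x => fderiv ℝ ψ x e :=
    (hψ.continuous_fderiv (by simp)).clm_apply continuous_const
  have hτK : ContinuousOn τ K := hτ.continuousOn.mono hψs
  set K₂ := τ '' K
  have hK₂ : IsCompact K₂ := hK.image_of_continuousOn hτK
  obtain ⟨U, hU, hUlim, ⟨C, hC⟩, hUd⟩ := exists_smooth_approx hΩ₂ hu₂ hD₂ hL hK₂ (himg K hψs)
  have hae : ∀ {p : EuclideanSpace ℝ (Fin n) → Prop}, (∀ x ∈ K, p x) →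
      ∀ᵐ x ∂volume.restrict K, p x := fun h =>
    (ae_restrict_iff' hK.measurableSet).2 (Eventually.of_forall h)
  have hUj : ∀ m j, Continuous fun y => fderiv ℝ (U m) y (EuclideanSpace.single j 1) := fun m j =>
    ((hU m).continuous_fderiv (by simp)).clm_apply continuous_const
  -- integration by parts for the smooth approximations
  have hWd : ∀ m, ∀ x ∈ Ω₁, HasFDerivAt (fun x => U m (τ x))
      ((fderiv ℝ (U m) (τ x)).comp (fderiv ℝ τ x)) x := fun m x hx =>
    (((hU m).differentiable (by simp)) _).hasFDerivAt.comp x (hd x hx).hasFDerivAt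
  have hWe : ∀ m, ∀ x ∈ Ω₁, fderiv ℝ (fun x => U m (τ x)) x e =
      ∑ j, (fderiv ℝ τ x e j : ℂ) * fderiv ℝ (U m) (τ x) (EuclideanSpace.single j 1) :=
    fun m x hx => by
      rw [(hWd m x hx).fderiv, comp_apply]
      conv_lhs => rw [euclidean_sum_single (fderiv ℝ τ x e)]
      rw [map_sum]
      refine Finset.sum_congr rfl fun j _ => ?_
      rw [map_smul, Complex.real_smul]
  have hsumc : ∀ m, ContinuousOn (fun x => ∑ j, (fderiv ℝ τ x e j : ℂ) *
      fderiv ℝ (U m) (τ x) (EuclideanSpace.single j 1)) K := fun m =>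
    continuousOn_finsetSum _ fun j _ => ((hcj j).mono hψs).mul
      ((hUj m j).comp_continuousOn hτK)
  have hUτ : ∀ m, ContinuousOn (fun x => U m (τ x)) K := fun m =>
    (hU m).continuous.comp_continuousOn hτK
  have full : ∀ F : EuclideanSpace ℝ (Fin n) → ℂ, (∀ x ∉ K, F x = 0) →
      ∫ x in K, F x = ∫ x, F x := fun F hF => setIntegral_eq_integral_of_forall_compl_eq_zero hF
  have hibp : ∀ m, ∫ x in K, (fderiv ℝ ψ x e : ℂ) * U m (τ x) =
      -∫ x in K, (ψ x : ℂ) * ∑ j, (fderiv ℝ τ x e j : ℂ) *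
        fderiv ℝ (U m) (τ x) (EuclideanSpace.single j 1) := fun m => by
    have int : ∀ F : EuclideanSpace ℝ (Fin n) → ℂ, (∀ x ∉ K, F x = 0) →
        IntegrableOn F K volume → Integrable F volume := fun F hF h =>
      (integrableOn_iff_integrable_of_support_subset fun x hx => by
        by_contra h'; exact hx (hF x h')).1 h
    have hWc : ContinuousOn (fun x => ψ x • fderiv ℝ (fun x => U m (τ x)) x e) K :=
      (hψ.continuous.continuousOn.smul (hsumc m)).congr fun x hx => by
        simp only [hWe m x (hψs hx)]; rfl
    -- Nothing is known about `U m ∘ τ` outside `Ω₁`, and its differentiability is supplied only on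
    -- the support of `ψ`.
    have h0 := integral_smul_fderiv_eq_neg_fderiv_smul_of_integrable (μ := volume) (𝕜 := ℝ)
      (f := ψ) (g := fun x => U m (τ x)) (v := e) (int _ (fun x hx => by simp [hψz' x hx])
        ((hψd.continuousOn.smul (hUτ m)).integrableOn_compact hK))
      (int _ (fun x hx => by simp [hψz x hx]) (hWc.integrableOn_compact hK))
      (int _ (fun x hx => by simp [hψz x hx])
        ((hψ.continuous.continuousOn.smul (hUτ m)).integrableOn_compact hK))
      (fun x _ => (hψ.differentiable (by simp)) x)
      (fun x hx => (hWd m x (hψs hx)).differentiableAt)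
    rw [← full _ fun x hx => by simp [hψz x hx], ← full _ fun x hx => by simp [hψz' x hx]] at h0
    rw [← neg_eq_iff_eq_neg]
    simp only [Complex.real_smul] at h0
    rw [← h0]
    refine setIntegral_congr_fun hK.measurableSet fun x hx => ?_
    simp only [hWe m x (hψs hx)]
  have l1 : Tendsto (fun m => ∫ x in K, (fderiv ℝ ψ x e : ℂ) * U m (τ x)) atTop
      (𝓝 (∫ x in K, (fderiv ℝ ψ x e : ℂ) * u₂ (τ x))) := by
    have := tendsto_integral_mul_of_bounded (μ := volume.restrict K) (F := fun m x => U m (τ x))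
      (F₀ := fun x => u₂ (τ x)) (w := fun x => (fderiv ℝ ψ x e : ℂ)) (C := C)
      (fun m => (hUτ m).aestronglyMeasurable hK.measurableSet)
      (fun m => hae fun x hx => hC m _ ⟨x, hx, rfl⟩) (hae fun x hx => hUlim _ ⟨x, hx, rfl⟩)
      ((Complex.continuous_ofReal.comp hψd).continuousOn.integrableOn_compact hK)
    simpa only [mul_comm] using this
  have l2 : ∀ j, Tendsto (fun m => ∫ x in K, ((ψ x : ℂ) * (fderiv ℝ τ x e j : ℂ)) *
        fderiv ℝ (U m) (τ x) (EuclideanSpace.single j 1)) atTop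
      (𝓝 (∫ x in K, ((ψ x : ℂ) * (fderiv ℝ τ x e j : ℂ)) * D₂ j (τ x))) := fun j => by
    exact tendsto_integral_mul_comp hK (fun x hx => hd x (hψs hx)) (hdc.mono hψs)
      (hinj.mono hψs) (fun x hx => hdet x (hψs hx))
      ((Complex.continuous_ofReal.comp hψ.continuous).continuousOn.mul ((hcj j).mono hψs))
      (fun m => hUj m j) (hL K₂ (himg K hψs) hK₂ j) (hUd j)
  have hψτ : ∀ j, ContinuousOn (fun x => (ψ x : ℂ) * (fderiv ℝ τ x e j : ℂ)) K := fun j =>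
    (Complex.continuous_ofReal.comp hψ.continuous).continuousOn.mul ((hcj j).mono hψs)
  have hterm : ∀ j, Integrable (fun x => ((ψ x : ℂ) * (fderiv ℝ τ x e j : ℂ)) * D₂ j (τ x))
      (volume.restrict K) := fun j => (hcomp K hψs hK j).continuousOn_mul (hψτ j) hK
  have hterm' : ∀ m j, Integrable (fun x => ((ψ x : ℂ) * (fderiv ℝ τ x e j : ℂ)) *
      fderiv ℝ (U m) (τ x) (EuclideanSpace.single j 1)) (volume.restrict K) := fun m j =>
    ((hψτ j).mul ((hUj m j).comp_continuousOn hτK)).integrableOn_compact hK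
  have hlim : ∫ x in K, (fderiv ℝ ψ x e : ℂ) * u₂ (τ x) = -∫ x in K, (ψ x : ℂ) * G x := by
    have e1 : ∫ x in K, (ψ x : ℂ) * G x =
        ∑ j, ∫ x in K, ((ψ x : ℂ) * (fderiv ℝ τ x e j : ℂ)) * D₂ j (τ x) := by
      rw [← integral_finsetSum _ fun j _ => hterm j]
      refine integral_congr_ae (Eventually.of_forall fun x => ?_)
      simp only [G, Finset.mul_sum, mul_assoc]
    rw [e1]
    -- Both sides of the classical integration by parts `hibp` converge, the left by boundedness and
    -- the right term by term in `j`.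
    refine tendsto_nhds_unique l1 ((tendsto_finsetSum _ fun j _ => l2 j).neg.congr fun m => ?_)
    rw [hibp m, ← integral_finsetSum _ fun j _ => hterm' m j]
    congr 1
    refine integral_congr_ae (Eventually.of_forall fun x => ?_)
    simp only [Finset.mul_sum, mul_assoc]
  have hwψ := hw.2.2 ψ hψ hψc hψs
  have toK : ∀ F : EuclideanSpace ℝ (Fin n) → ℂ, (∀ x ∉ K, F x = 0) →
      ∫ x in Ω₁, F x = ∫ x in K, F x := fun F hF =>
    setIntegral_eq_of_subset_of_forall_sdiff_eq_zero hΩ₁.measurableSet hψs fun x hx => hF x hx.2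
  rw [toK _ fun x hx => smul_eq_zero_of_left (hψz' x hx) _,
    toK _ fun x hx => smul_eq_zero_of_left (hψz x hx) _] at hwψ
  rw [← full _ fun x hx => by simp [hψz x hx]]
  simp only [Pi.sub_apply, smul_sub]
  rw [integral_sub ((hw.2.1.integrableOn_compact_subset hψs hK).continuousOn_smul
    hψ.continuous.continuousOn hK) ((hGK K hψs hK).continuousOn_smul
    hψ.continuous.continuousOn hK), sub_eq_zero, ← neg_inj, ← hwψ]
  simp only [Complex.real_smul]
  rw [← hlim]
  refine setIntegral_congr_fun hK.measurableSet fun x hx => ?_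
  simp only [hu x (hψs hx)]

end ChainRule

/-! ### Derivatives of determinants and inverse matrices. -/

section MatrixCalculus

variable {n : ℕ} {E : Type*} [NormedAddCommGroup E] [NormedSpace ℝ E]
  {G : E → Matrix (Fin n) (Fin n) ℝ} {x : E} {s : Set E}

lemma contDiff_det_of {k : ℕ∞ω} :
    ContDiff ℝ k fun B : Fin n → Fin n → ℝ => (Matrix.of B).det := by
  simp only [Matrix.det_apply', Matrix.of_apply]
  refine ContDiff.sum fun σ _ => contDiff_const.mul (contDiff_prod fun i _ => ?_)
  exact contDiff_apply_apply ℝ ℝ (σ i) i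

lemma contDiffOn_det {k : ℕ∞ω} (hG : ∀ i j, ContDiffOn ℝ k (fun y => G y i j) s) :
    ContDiffOn ℝ k (fun y => (G y).det) s :=
  contDiff_det_of.comp_contDiffOn (contDiffOn_pi.2 fun i => contDiffOn_pi.2 fun j => hG i j)

/-- Cramer's rule writes each entry of the inverse as a quotient of determinants. -/
lemma contDiffOn_inv {k : ℕ∞ω} (hG : ∀ i j, ContDiffOn ℝ k (fun y => G y i j) s)
    (hdet : ∀ y ∈ s, (G y).det ≠ 0) (i j : Fin n) : ContDiffOn ℝ k (fun y => (G y)⁻¹ i j) s := by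
  have h : ∀ y, (G y)⁻¹ i j = ((G y).det)⁻¹ * ((G y).updateRow j (Pi.single i 1)).det := fun y => by
    rw [Matrix.inv_def, Matrix.smul_apply, Matrix.adjugate_apply, Ring.inverse_eq_inv', smul_eq_mul]
  simp_rw [h]
  refine ((contDiffOn_det hG).inv hdet).mul (contDiffOn_det fun a b => ?_)
  simp only [Matrix.updateRow_apply]
  split_ifs
  · exact contDiffOn_const
  · exact hG a b

/-- Factor out `A`: det(A + tB) = det A · det(1 + tA⁻¹B), and the second factor is a polynomial in
`t` with linear coefficient the trace of A⁻¹B. -/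
lemma hasDerivAt_det_add_smul (A B : Matrix (Fin n) (Fin n) ℝ) (hA : A.det ≠ 0) :
    HasDerivAt (fun t : ℝ => (A + t • B).det) (A.det * (A⁻¹ * B).trace) 0 := by
  have h : ∀ t : ℝ, (A + t • B).det = A.det * (1 + (A⁻¹ * B).trace * t +
      (Matrix.det (1 + (Polynomial.X : Polynomial ℝ) • (A⁻¹ * B).map Polynomial.C)).divX.divX.eval t
        * t ^ 2) := fun t => by
    rw [← Matrix.det_one_add_smul, ← Matrix.det_mul, mul_add, mul_one, Matrix.mul_smul,
      ← mul_assoc, Matrix.mul_nonsing_inv _ (isUnit_iff_ne_zero.2 hA), one_mul]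
  simp_rw [h]
  refine HasDerivAt.const_mul _ ?_
  set p := (Matrix.det (1 + (Polynomial.X : Polynomial ℝ) • (A⁻¹ * B).map Polynomial.C)).divX.divX
  have h1 := (((hasDerivAt_id (0 : ℝ)).const_mul (A⁻¹ * B).trace).const_add 1).add
    ((p.hasDerivAt 0).mul (hasDerivAt_pow 2 (0 : ℝ)))
  have h2 : HasDerivAt (fun t : ℝ => 1 + (A⁻¹ * B).trace * t + p.eval t * t ^ 2) _ 0 := h1
  convert! h2 using 1
  simp

/-- Jacobi's formula. -/
lemma fderiv_det (hG : ∀ i j, DifferentiableAt ℝ (fun y => G y i j) x) (hdet : (G x).det ≠ 0)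
    (e : E) : fderiv ℝ (fun y => (G y).det) x e = (G x).det *
      ((G x)⁻¹ * Matrix.of fun i j => fderiv ℝ (fun y => G y i j) x e).trace := by
  set B : Fin n → Fin n → ℝ := fun i j => fderiv ℝ (fun y => G y i j) x e
  have hd := ((contDiff_det_of (n := n) (k := 1)).differentiable (by simp)
    (fun i j => G x i j)).hasFDerivAt
  have hGd : HasFDerivAt (fun y i j => G y i j)
      (ContinuousLinearMap.pi fun i => ContinuousLinearMap.pi fun j =>
        fderiv ℝ (fun y => G y i j) x) x :=
    hasFDerivAt_pi.2 fun i => hasFDerivAt_pi.2 fun j => (hG i j).hasFDerivAt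
  have h1 : fderiv ℝ (fun y => (G y).det) x = _ := (hd.comp x hGd).fderiv
  rw [h1]
  -- The differential of the determinant applied to `B` is a derivative along a line, which was
  -- computed by the one-variable lemma.
  have h2 := hd.hasLineDerivAt B
  exact h2.unique (hasDerivAt_det_add_smul (G x) (Matrix.of B) hdet)

/-- Differentiate G G⁻¹ = 1, which holds on a neighbourhood of the point, and solve for the
derivative of the inverse. -/
lemma fderiv_matrix_inv (hG : ∀ i j, DifferentiableAt ℝ (fun y => G y i j) x)
    (hGi : ∀ i j, DifferentiableAt ℝ (fun y => (G y)⁻¹ i j) x)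
    (hdet : ∀ᶠ y in 𝓝 x, (G y).det ≠ 0) (e : E) (i j : Fin n) :
    fderiv ℝ (fun y => (G y)⁻¹ i j) x e =
      -((G x)⁻¹ * (Matrix.of fun a b => fderiv ℝ (fun y => G y a b) x e) * (G x)⁻¹) i j := by
  set B : Matrix (Fin n) (Fin n) ℝ := Matrix.of fun a b => fderiv ℝ (fun y => G y a b) x e
  set B' : Matrix (Fin n) (Fin n) ℝ := Matrix.of fun a b => fderiv ℝ (fun y => (G y)⁻¹ a b) x e
  have hx : IsUnit (G x).det := isUnit_iff_ne_zero.2 hdet.self_of_nhds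
  have h0 : B * (G x)⁻¹ + G x * B' = 0 := by
    ext a b
    have h1 : (fun y => ∑ c, G y a c * (G y)⁻¹ c b) =ᶠ[𝓝 x]
        fun _ => (1 : Matrix (Fin n) (Fin n) ℝ) a b := by
      filter_upwards [hdet] with y hy
      rw [← Matrix.mul_apply, Matrix.mul_nonsing_inv _ (isUnit_iff_ne_zero.2 hy)]
    have h2 := h1.fderiv_eq (𝕜 := ℝ)
    have h3 : HasFDerivAt (fun y => ∑ c, G y a c * (G y)⁻¹ c b) _ x :=
      HasFDerivAt.fun_sum fun c _ => (hG a c).hasFDerivAt.mul (hGi c b).hasFDerivAt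
    rw [h3.fderiv] at h2
    have h4 := congrArg (fun L : E →L[ℝ] ℝ => L e) h2
    simp only [fderiv_fun_const, Pi.zero_apply, zero_apply,
      sum_apply, add_apply,
      smul_apply, smul_eq_mul, Finset.sum_add_distrib] at h4
    simp only [Matrix.add_apply, Matrix.mul_apply, Matrix.zero_apply, B, B', Matrix.of_apply]
    rw [← h4, add_comm]
    congr 1
    exact Finset.sum_congr rfl fun c _ => mul_comm _ _
  have h1 : B' = -((G x)⁻¹ * B * (G x)⁻¹) := by
    have := congrArg (fun C => (G x)⁻¹ * C) h0
    simp only [mul_add, mul_zero, ← mul_assoc, Matrix.nonsing_inv_mul _ hx, one_mul] at this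
    exact eq_neg_of_add_eq_zero_right this
  exact congrFun (congrFun h1 i) j

/-- The contracted Christoffel symbols are, up to the factor `-√(det G)`, the divergence of
`√(det G) G⁻¹`. -/
lemma sum_fderiv_sqrt_det_mul_inv {G : EuclideanSpace ℝ (Fin n) → Matrix (Fin n) (Fin n) ℝ}
    {x : EuclideanSpace ℝ (Fin n)}
    (hG : ∀ i j, DifferentiableAt ℝ (fun y => G y i j) x)
    (hGi : ∀ i j, DifferentiableAt ℝ (fun y => (G y)⁻¹ i j) x)
    (hGd : DifferentiableAt ℝ (fun y => (G y).det) x)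
    (hdet : ∀ᶠ y in 𝓝 x, 0 < (G y).det) (hsymm : ∀ y, (G y).transpose = G y)
    (dG : Fin n → Fin n → Fin n → ℝ)
    (hdG : ∀ l i j, dG l i j = fderiv ℝ (fun y => G y i j) x (EuclideanSpace.single l 1))
    (k : Fin n) :
    ∑ i, fderiv ℝ (fun y => √(G y).det * (G y)⁻¹ i k) x (EuclideanSpace.single i 1) =
      -(√(G x).det * ∑ i, ∑ j, (G x)⁻¹ i j *
        ((1 / 2) * ∑ l, (G x)⁻¹ k l * (dG i j l + dG j i l - dG l i j))) := by
  have hpos : 0 < (G x).det := hdet.self_of_nhds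
  have hdG' : ∀ l i j, dG l i j = dG l j i := fun l i j => by
    rw [hdG, hdG]
    congr 2
    ext y
    exact congrFun (congrFun (hsymm y) j) i
  set A := (G x)⁻¹ with hA
  have hAs : ∀ i j, A i j = A j i := fun i j => by
    have : A.transpose = A := by rw [hA, Matrix.transpose_nonsing_inv, hsymm]
    exact congrFun (congrFun this j) i
  have hB : ∀ l, (Matrix.of fun i j => fderiv ℝ (fun y => G y i j) x (EuclideanSpace.single l 1)) =
      Matrix.of (dG l) := fun l => by
    ext i j
    exact (hdG l i j).symm
  have hw : ∀ i, fderiv ℝ (fun y => √(G y).det * (G y)⁻¹ i k) x (EuclideanSpace.single i 1) =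
      √(G x).det * ((1 / 2) * (∑ a, ∑ b, A a b * dG i b a) * A i k -
        ∑ b, (∑ a, A i a * dG i a b) * A b k) := fun i => by
    have h1 : HasFDerivAt (fun y => √(G y).det) _ x := hGd.hasFDerivAt.sqrt hpos.ne'
    have h2 : fderiv ℝ (fun y => √(G y).det * (G y)⁻¹ i k) x = _ :=
      (h1.mul (hGi i k).hasFDerivAt).fderiv
    rw [h2]
    simp only [add_apply, smul_apply, smul_eq_mul]
    rw [fderiv_det hG hpos.ne', fderiv_matrix_inv hG hGi (hdet.mono fun y hy => hy.ne'), hB]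
    simp only [Matrix.trace, Matrix.diag_apply, Matrix.mul_apply, Matrix.of_apply]
    rw [← hA]
    -- Jacobi's formula produces det/(2√det); writing det as the square of its root removes the
    -- quotient.
    have hsq : (G x).det = √(G x).det * √(G x).det := (Real.mul_self_sqrt hpos.le).symm
    have hne : √(G x).det ≠ 0 := (Real.sqrt_pos.2 hpos).ne'
    set w := √(G x).det
    rw [hsq]
    field_simp
    ring
  -- Only two contractions of the derivatives of the metric occur. By symmetry the first two terms
  -- of the Christoffel symbol both contract to `S` and the third to `T`. The right side is then
  -- -√det (S - T/2), and the divergence on the left is √det (T/2 - S).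
  set S := ∑ i, ∑ j, ∑ l, A i j * A k l * dG i j l with hS
  set T := ∑ i, ∑ j, ∑ l, A i j * A k l * dG l i j with hT
  have e1 : ∑ i, ∑ j, A i j * ((1 / 2) * ∑ l, A k l * (dG i j l + dG j i l - dG l i j)) =
      (1 / 2) * (S + S - T) := by
    have hS' : S = ∑ i, ∑ j, ∑ l, A i j * A k l * dG j i l := by
      rw [hS, Finset.sum_comm]
      refine Finset.sum_congr rfl fun i _ => Finset.sum_congr rfl fun j _ =>
        Finset.sum_congr rfl fun l _ => ?_
      rw [hAs j i]
    conv_rhs => rw [show S + S - T = S + (∑ i, ∑ j, ∑ l, A i j * A k l * dG j i l) - T by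
      rw [← hS']]
    rw [hS, hT]
    simp only [← Finset.sum_add_distrib, ← Finset.sum_sub_distrib, Finset.mul_sum]
    refine Finset.sum_congr rfl fun i _ => Finset.sum_congr rfl fun j _ =>
        Finset.sum_congr rfl fun l _ => ?_
    ring
  have e2 : ∑ i, (∑ a, ∑ b, A a b * dG i b a) * A i k = T := by
    rw [hT]
    conv_rhs => rw [Finset.sum_congr rfl fun i _ => Finset.sum_comm, Finset.sum_comm]
    refine Finset.sum_congr rfl fun l _ => ?_
    simp only [Finset.sum_mul]
    refine Finset.sum_congr rfl fun i _ => Finset.sum_congr rfl fun j _ => ?_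
    rw [hAs k l, hdG' l j i]
    ring
  have e3 : ∑ i, ∑ b, (∑ a, A i a * dG i a b) * A b k = S := by
    rw [hS]
    refine Finset.sum_congr rfl fun i _ => ?_
    simp only [Finset.sum_mul]
    rw [Finset.sum_comm]
    refine Finset.sum_congr rfl fun j _ => Finset.sum_congr rfl fun l _ => ?_
    rw [hAs l k]
    ring
  rw [e1, Finset.sum_congr rfl fun i _ => hw i, ← Finset.mul_sum, Finset.sum_sub_distrib, e3]
  simp only [mul_assoc]
  rw [← Finset.mul_sum, e2]
  ring

end MatrixCalculus

/-! ### Smoothness and positivity of the metric coefficients, up to the boundary. -/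

section Metric

variable {n : ℕ} [NeZero n] {M : Type*} [TopologicalSpace M]
  [ChartedSpace (EuclideanHalfSpace n) M]

/-- The derivative of the inverse of a chart, as a linear map between model spaces. -/
def chartFrame (φ : OpenPartialHomeomorph M (EuclideanHalfSpace n))
    (x : EuclideanSpace ℝ (Fin n)) : EuclideanSpace ℝ (Fin n) →L[ℝ] EuclideanSpace ℝ (Fin n) :=
  mfderivWithin 𝓘(ℝ, EuclideanSpace ℝ (Fin n)) (𝓡∂ n) (chartInv φ) (Set.range (𝓡∂ n)) x

lemma uniqueMDiffOn_chartImage (p : M) :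
    UniqueMDiffOn 𝓘(ℝ, EuclideanSpace ℝ (Fin n))
      (chartImage (chartAt (EuclideanHalfSpace n) p)) :=
  (uniqueDiffOn_extChartAt_target (I := 𝓡∂ n) p).uniqueMDiffOn

/-- The chart image is relatively open in the half-space, so the two sets have the same germ at `x`.
-/
lemma mfderivWithin_chartInv_eq (p : M) {x : EuclideanSpace ℝ (Fin n)}
    (hx : x ∈ chartImage (chartAt (EuclideanHalfSpace n) p)) :
    mfderivWithin 𝓘(ℝ, EuclideanSpace ℝ (Fin n)) (𝓡∂ n)
      (chartInv (chartAt (EuclideanHalfSpace n) p)) (Set.range (𝓡∂ n)) x =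
    mfderivWithin 𝓘(ℝ, EuclideanSpace ℝ (Fin n)) (𝓡∂ n)
      (chartInv (chartAt (EuclideanHalfSpace n) p))
      (chartImage (chartAt (EuclideanHalfSpace n) p)) x := by
  refine (mfderivWithin_congr_set ?_).symm
  exact extChartAt_target_eventuallyEq_of_mem (I := 𝓡∂ n) hx

variable [IsManifold (𝓡∂ n) ∞ M]

lemma contMDiffOn_chartInv (p : M) :
    ContMDiffOn 𝓘(ℝ, EuclideanSpace ℝ (Fin n)) (𝓡∂ n) ∞
      (chartInv (chartAt (EuclideanHalfSpace n) p))
      (chartImage (chartAt (EuclideanHalfSpace n) p)) :=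
  contMDiffOn_extChartAt_symm p

variable (g : Bundle.ContMDiffRiemannianMetric (𝓡∂ n) ∞ (EuclideanSpace ℝ (Fin n))
    (fun q : M => TangentSpace (𝓡∂ n) q))

/-- The coordinate field is the image of a constant field under the tangent map of the inverse
chart. -/
lemma contMDiffOn_coordVector (p : M) (i : Fin n) :
    ContMDiffOn 𝓘(ℝ, EuclideanSpace ℝ (Fin n)) (𝓡∂ n).tangent ∞
      (fun x => (⟨chartInv (chartAt (EuclideanHalfSpace n) p) x,
        coordVector (chartAt (EuclideanHalfSpace n) p) i x⟩ : TangentBundle (𝓡∂ n) M))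
      (chartImage (chartAt (EuclideanHalfSpace n) p)) := by
  have h1 := ContMDiffOn.contMDiffOn_tangentMapWithin (I := 𝓘(ℝ, EuclideanSpace ℝ (Fin n)))
    (I' := 𝓡∂ n) (m := ∞) (contMDiffOn_chartInv p) (by simp) (uniqueMDiffOn_chartImage p)
  have h2 : ContMDiff 𝓘(ℝ, EuclideanSpace ℝ (Fin n)) 𝓘(ℝ, EuclideanSpace ℝ (Fin n)).tangent ∞
      (fun x => (⟨x, EuclideanSpace.single i (1 : ℝ)⟩ :
        TangentBundle 𝓘(ℝ, EuclideanSpace ℝ (Fin n)) (EuclideanSpace ℝ (Fin n)))) :=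
    contMDiff_vectorSpace_iff_contDiff.2 contDiff_const
  have h3 := h1.comp h2.contMDiffOn (s := chartImage (chartAt (EuclideanHalfSpace n) p))
    fun x hx => hx
  refine h3.congr fun x hx => ?_
  simp only [Function.comp_apply, tangentMapWithin]
  rw [← mfderivWithin_chartInv_eq p hx]
  rfl

lemma contDiffOn_metricCoeff (p : M) (i j : Fin n) :
    ContDiffOn ℝ ∞ (fun x => metricCoeff g (chartAt (EuclideanHalfSpace n) p) x i j)
      (chartImage (chartAt (EuclideanHalfSpace n) p)) := by
  rw [← contMDiffOn_iff_contDiffOn]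
  intro x hx
  have hb := contMDiffOn_chartInv p x hx
  have hg := (g.contMDiff (chartInv (chartAt (EuclideanHalfSpace n) p) x)).comp_contMDiffWithinAt
    x hb
  have h : ContMDiffWithinAt 𝓘(ℝ, EuclideanSpace ℝ (Fin n)) ((𝓡∂ n).prod 𝓘(ℝ)) ∞
      (fun x => Bundle.TotalSpace.mk' ℝ (E := Bundle.Trivial M ℝ)
        (chartInv (chartAt (EuclideanHalfSpace n) p) x)
        (g.inner (chartInv (chartAt (EuclideanHalfSpace n) p) x)
          (coordVector (chartAt (EuclideanHalfSpace n) p) i x)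
          (coordVector (chartAt (EuclideanHalfSpace n) p) j x)))
      (chartImage (chartAt (EuclideanHalfSpace n) p)) x := by
    apply ContMDiffWithinAt.clm_bundle_apply₂ (F₁ := EuclideanSpace ℝ (Fin n))
      (F₂ := EuclideanSpace ℝ (Fin n))
    · exact hg
    · exact contMDiffOn_coordVector p i x hx
    · exact contMDiffOn_coordVector p j x hx
  rw [Bundle.contMDiffWithinAt_totalSpace] at h
  exact h.2

/-- The metric at a point, as a bilinear form on the model space. -/
def metricAt (q : M) :
    EuclideanSpace ℝ (Fin n) →L[ℝ] EuclideanSpace ℝ (Fin n) →L[ℝ] ℝ := g.inner q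

lemma metricAt_symm (q : M) (v w : EuclideanSpace ℝ (Fin n)) :
    metricAt g q v w = metricAt g q w v := g.symm q v w

lemma metricCoeff_apply (φ : OpenPartialHomeomorph M (EuclideanHalfSpace n))
    (x : EuclideanSpace ℝ (Fin n)) (i j : Fin n) :
    metricCoeff g φ x i j = metricAt g (chartInv φ x)
      (chartFrame φ x (EuclideanSpace.single i 1)) (chartFrame φ x (EuclideanSpace.single j 1)) :=
  rfl

lemma metricCoeff_transpose (φ : OpenPartialHomeomorph M (EuclideanHalfSpace n))
    (x : EuclideanSpace ℝ (Fin n)) : (metricCoeff g φ x).transpose = metricCoeff g φ x := by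
  ext i j
  exact g.symm _ _ _

/-- The matrix represents the metric pulled back by the derivative of the inverse chart, which is
injective, so positivity is inherited. -/
lemma posDef_metricCoeff (p : M) {x : EuclideanSpace ℝ (Fin n)}
    (hx : x ∈ chartImage (chartAt (EuclideanHalfSpace n) p)) :
    (metricCoeff g (chartAt (EuclideanHalfSpace n) p) x).PosDef := by
  set φ := chartAt (EuclideanHalfSpace n) p with hφ
  have hinv : (chartFrame φ x).IsInvertible :=
    isInvertible_mfderivWithin_extChartAt_symm (I := 𝓡∂ n) (x := p) hx
  refine Matrix.PosDef.of_dotProduct_mulVec_pos ?_ fun c hc => ?_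
  · ext i j
    exact g.symm _ _ _
  · set c' : EuclideanSpace ℝ (Fin n) := WithLp.toLp 2 c
    have hc' : c' ≠ 0 := fun h => hc (by simpa [c'] using h)
    have hne : chartFrame φ x c' ≠ 0 := fun h => hc' (hinv.injective (by rw [h, map_zero]))
    have hp : 0 < metricAt g (chartInv φ x) (chartFrame φ x c') (chartFrame φ x c') :=
      g.pos _ _ hne
    refine hp.trans_le (le_of_eq ?_)
    rw [euclidean_sum_single c']
    simp only [map_sum, map_smul, sum_apply, smul_apply, smul_eq_mul, dotProduct, Matrix.mulVec,
      Finset.mul_sum]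
    refine Finset.sum_congr rfl fun i _ => Finset.sum_congr rfl fun j _ => ?_
    rw [metricCoeff_apply g φ]
    simp only [star_trivial, c']
    rw [metricAt_symm]
    ring

end Metric

/-! ### Changes of charts. -/

section Transition

variable {n : ℕ} [NeZero n] {M : Type*} [TopologicalSpace M]

/-- The change of coordinates from the chart `φ` to the chart `ψ`. -/
def transition (φ ψ : OpenPartialHomeomorph M (EuclideanHalfSpace n))
    (x : EuclideanSpace ℝ (Fin n)) : EuclideanSpace ℝ (Fin n) :=
  ψ.extend (𝓡∂ n) (chartInv φ x)

/-- The part of the interior of the chart image of `φ` that is also covered by `ψ`. -/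
def overlap (φ ψ : OpenPartialHomeomorph M (EuclideanHalfSpace n)) :
    Set (EuclideanSpace ℝ (Fin n)) :=
  chartDomain φ ∩ chartInv φ ⁻¹' ψ.source

lemma chartDomain_subset_chartImage (φ : OpenPartialHomeomorph M (EuclideanHalfSpace n)) :
    chartDomain φ ⊆ chartImage φ := interior_subset

lemma isOpen_chartDomain (φ : OpenPartialHomeomorph M (EuclideanHalfSpace n)) :
    IsOpen (chartDomain φ) := isOpen_interior

lemma continuousOn_chartInv (φ : OpenPartialHomeomorph M (EuclideanHalfSpace n)) :
    ContinuousOn (chartInv φ) (chartImage φ) := φ.continuousOn_extend_symm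

lemma chartInv_mem_source {φ : OpenPartialHomeomorph M (EuclideanHalfSpace n)}
    {x : EuclideanSpace ℝ (Fin n)} (hx : x ∈ chartImage φ) : chartInv φ x ∈ φ.source := by
  have := (φ.extend (𝓡∂ n)).map_target hx
  rwa [φ.extend_source] at this

lemma extend_chartInv {φ : OpenPartialHomeomorph M (EuclideanHalfSpace n)}
    {x : EuclideanSpace ℝ (Fin n)} (hx : x ∈ chartImage φ) :
    φ.extend (𝓡∂ n) (chartInv φ x) = x := (φ.extend (𝓡∂ n)).right_inv hx

lemma chartInv_extend {φ : OpenPartialHomeomorph M (EuclideanHalfSpace n)} {q : M}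
    (hq : q ∈ φ.source) : chartInv φ (φ.extend (𝓡∂ n) q) = q := φ.extend_left_inv hq

lemma extend_mem_chartImage {φ : OpenPartialHomeomorph M (EuclideanHalfSpace n)} {q : M}
    (hq : q ∈ φ.source) : φ.extend (𝓡∂ n) q ∈ chartImage φ :=
  (φ.extend (𝓡∂ n)).map_source (by rwa [φ.extend_source])

lemma isOpen_overlap (φ ψ : OpenPartialHomeomorph M (EuclideanHalfSpace n)) :
    IsOpen (overlap φ ψ) :=
  ((continuousOn_chartInv φ).mono (chartDomain_subset_chartImage φ)).isOpen_inter_preimage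
    (isOpen_chartDomain φ) ψ.open_source

lemma chartInv_transition {φ ψ : OpenPartialHomeomorph M (EuclideanHalfSpace n)}
    {x : EuclideanSpace ℝ (Fin n)} (hx : x ∈ overlap φ ψ) :
    chartInv ψ (transition φ ψ x) = chartInv φ x := chartInv_extend hx.2

lemma transition_transition {φ ψ : OpenPartialHomeomorph M (EuclideanHalfSpace n)}
    {x : EuclideanSpace ℝ (Fin n)} (hx : x ∈ overlap φ ψ) :
    transition ψ φ (transition φ ψ x) = x := by
  rw [transition, chartInv_transition hx]
  exact extend_chartInv (chartDomain_subset_chartImage _ hx.1)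

lemma injOn_transition (φ ψ : OpenPartialHomeomorph M (EuclideanHalfSpace n)) :
    Set.InjOn (transition φ ψ) (overlap φ ψ) := fun x hx y hy h => by
  rw [← transition_transition hx, ← transition_transition hy, h]

variable [ChartedSpace (EuclideanHalfSpace n) M] [IsManifold (𝓡∂ n) ∞ M]

/-- Whether a point of the manifold is interior does not depend on the chart. This is why changes of
charts map the open parts of chart images into each other. -/
lemma mem_chartDomain_iff (p : M) {x : EuclideanSpace ℝ (Fin n)}
    (hx : x ∈ chartImage (chartAt (EuclideanHalfSpace n) p)) :
    x ∈ chartDomain (chartAt (EuclideanHalfSpace n) p) ↔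
      chartInv (chartAt (EuclideanHalfSpace n) p) x ∈ (𝓡∂ n).interior M := by
  have h := ModelWithCorners.isInteriorPoint_iff_of_mem_atlas (I := 𝓡∂ n) (n := (∞ : ℕ∞ω))
    (by simp) (chart_mem_atlas (EuclideanHalfSpace n) p) (chartInv_mem_source hx)
  rw [extend_chartInv hx] at h
  exact h.symm

lemma transition_mem_overlap (p q : M) {x : EuclideanSpace ℝ (Fin n)}
    (hx : x ∈ overlap (chartAt (EuclideanHalfSpace n) p) (chartAt (EuclideanHalfSpace n) q)) :
    transition (chartAt (EuclideanHalfSpace n) p) (chartAt (EuclideanHalfSpace n) q) x ∈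
      overlap (chartAt (EuclideanHalfSpace n) q) (chartAt (EuclideanHalfSpace n) p) := by
  have hi := (mem_chartDomain_iff p (chartDomain_subset_chartImage _ hx.1)).1 hx.1
  refine ⟨(mem_chartDomain_iff q (extend_mem_chartImage hx.2)).2 ?_, ?_⟩
  · rw [chartInv_extend hx.2]
    exact hi
  · rw [Set.mem_preimage, chartInv_transition hx]
    exact chartInv_mem_source (chartDomain_subset_chartImage _ hx.1)

lemma image_transition_overlap (p q : M) :
    transition (chartAt (EuclideanHalfSpace n) p) (chartAt (EuclideanHalfSpace n) q) ''
      overlap (chartAt (EuclideanHalfSpace n) p) (chartAt (EuclideanHalfSpace n) q) =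
      overlap (chartAt (EuclideanHalfSpace n) q) (chartAt (EuclideanHalfSpace n) p) := by
  refine Set.Subset.antisymm ?_ fun y hy => ?_
  · rintro _ ⟨x, hx, rfl⟩
    exact transition_mem_overlap p q hx
  · exact ⟨_, transition_mem_overlap q p hy, transition_transition hy⟩

lemma contDiffOn_transition (p q : M) :
    ContDiffOn ℝ ∞
      (transition (chartAt (EuclideanHalfSpace n) p) (chartAt (EuclideanHalfSpace n) q))
      (overlap (chartAt (EuclideanHalfSpace n) p) (chartAt (EuclideanHalfSpace n) q)) := by
  rw [← contMDiffOn_iff_contDiffOn]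
  have h1 : ContMDiffOn (𝓡∂ n) 𝓘(ℝ, EuclideanSpace ℝ (Fin n)) ∞ (extChartAt (𝓡∂ n) q)
    (chartAt (EuclideanHalfSpace n) q).source := contMDiffOn_extChartAt
  exact h1.comp ((contMDiffOn_chartInv p).mono
    (Set.inter_subset_left.trans (chartDomain_subset_chartImage _))) fun x hx => hx.2

/-- Near `x` one inverse chart is the other one composed with the transition map. At interior
coordinates derivatives within the half-space are ordinary derivatives, so the usual chain rule
applies. -/
lemma chartFrame_eq_comp (p q : M) {x : EuclideanSpace ℝ (Fin n)}
    (hx : x ∈ overlap (chartAt (EuclideanHalfSpace n) p) (chartAt (EuclideanHalfSpace n) q)) :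
    chartFrame (chartAt (EuclideanHalfSpace n) p) x =
      (chartFrame (chartAt (EuclideanHalfSpace n) q)
        (transition (chartAt (EuclideanHalfSpace n) p) (chartAt (EuclideanHalfSpace n) q) x)).comp
      (fderiv ℝ (transition (chartAt (EuclideanHalfSpace n) p)
        (chartAt (EuclideanHalfSpace n) q)) x) := by
  set φ := chartAt (EuclideanHalfSpace n) p
  set ψ := chartAt (EuclideanHalfSpace n) q
  have hnhds : ∀ (r : M) (y : EuclideanSpace ℝ (Fin n)),
      y ∈ chartDomain (chartAt (EuclideanHalfSpace n) r) →
      chartImage (chartAt (EuclideanHalfSpace n) r) ∈ 𝓝 y ∧ Set.range (𝓡∂ n) ∈ 𝓝 y :=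
    fun r y hy => by
      have h1 := mem_interior_iff_mem_nhds.1 hy
      exact ⟨h1, Filter.mem_of_superset h1 (extChartAt_target_subset_range (I := 𝓡∂ n) r)⟩
  have hm : ∀ (r : M) (y : EuclideanSpace ℝ (Fin n)),
      y ∈ chartDomain (chartAt (EuclideanHalfSpace n) r) →
      MDifferentiableAt 𝓘(ℝ, EuclideanSpace ℝ (Fin n)) (𝓡∂ n)
        (chartInv (chartAt (EuclideanHalfSpace n) r)) y := fun r y hy =>
    ((contMDiffOn_chartInv r).contMDiffAt (hnhds r y hy).1).mdifferentiableAt (by simp)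
  have hy := transition_mem_overlap p q hx
  have hτ : MDifferentiableAt 𝓘(ℝ, EuclideanSpace ℝ (Fin n)) 𝓘(ℝ, EuclideanSpace ℝ (Fin n))
      (transition φ ψ) x := ((contDiffOn_transition p q).contDiffAt
        ((isOpen_overlap φ ψ).mem_nhds hx)).contMDiffAt.mdifferentiableAt (by simp)
  have hev : chartInv φ =ᶠ[𝓝 x] chartInv ψ ∘ transition φ ψ := by
    filter_upwards [(isOpen_overlap φ ψ).mem_nhds hx] with z hz
    exact (chartInv_transition hz).symm
  have h1 : chartFrame φ x =
      mfderiv 𝓘(ℝ, EuclideanSpace ℝ (Fin n)) (𝓡∂ n) (chartInv φ) x :=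
    mfderivWithin_of_mem_nhds (hnhds p x hx.1).2
  have h2 : chartFrame ψ (transition φ ψ x) =
      mfderiv 𝓘(ℝ, EuclideanSpace ℝ (Fin n)) (𝓡∂ n) (chartInv ψ) (transition φ ψ x) :=
    mfderivWithin_of_mem_nhds (hnhds q _ hy.1).2
  rw [h1, h2, ← mfderiv_eq_fderiv]
  have h3 := mfderiv_comp x (hm q _ hy.1) hτ
  exact (hev.mfderiv_eq).trans h3

end Transition

/-! ### Transformation laws of the metric and of the volume density. -/

section TransitionMetric

variable {n : ℕ}

/-- The Jacobian matrix of a map of `ℝⁿ`. -/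
def jacobian (τ : EuclideanSpace ℝ (Fin n) → EuclideanSpace ℝ (Fin n))
    (x : EuclideanSpace ℝ (Fin n)) : Matrix (Fin n) (Fin n) ℝ :=
  Matrix.of fun j i => fderiv ℝ τ x (EuclideanSpace.single i 1) j

lemma det_jacobian (τ : EuclideanSpace ℝ (Fin n) → EuclideanSpace ℝ (Fin n))
    (x : EuclideanSpace ℝ (Fin n)) : (jacobian τ x).det = (fderiv ℝ τ x).det := by
  rw [ContinuousLinearMap.det, ← LinearMap.det_toMatrix (EuclideanSpace.basisFun (Fin n) ℝ).toBasis]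
  congr 1

variable [NeZero n] {M : Type*} [TopologicalSpace M]
  [ChartedSpace (EuclideanHalfSpace n) M] [IsManifold (𝓡∂ n) ∞ M]
  (g : Bundle.ContMDiffRiemannianMetric (𝓡∂ n) ∞ (EuclideanSpace ℝ (Fin n))
    (fun q : M => TangentSpace (𝓡∂ n) q))

/-- The density of the Riemannian volume in a chart. -/
def volumeDensity (φ : OpenPartialHomeomorph M (EuclideanHalfSpace n))
    (x : EuclideanSpace ℝ (Fin n)) : ℝ := √(metricCoeff g φ x).det

/-- Change of basis for a bilinear form: the two coordinate frames differ by the Jacobian matrix. -/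
lemma metricCoeff_transition (p q : M) {x : EuclideanSpace ℝ (Fin n)}
    (hx : x ∈ overlap (chartAt (EuclideanHalfSpace n) p) (chartAt (EuclideanHalfSpace n) q)) :
    metricCoeff g (chartAt (EuclideanHalfSpace n) p) x =
      (jacobian (transition (chartAt (EuclideanHalfSpace n) p)
        (chartAt (EuclideanHalfSpace n) q)) x).transpose *
      metricCoeff g (chartAt (EuclideanHalfSpace n) q)
        (transition (chartAt (EuclideanHalfSpace n) p) (chartAt (EuclideanHalfSpace n) q) x) *
      jacobian (transition (chartAt (EuclideanHalfSpace n) p)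
        (chartAt (EuclideanHalfSpace n) q)) x := by
  set φ := chartAt (EuclideanHalfSpace n) p
  set ψ := chartAt (EuclideanHalfSpace n) q
  ext i j
  rw [metricCoeff_apply, chartFrame_eq_comp p q hx, ← chartInv_transition hx]
  simp only [ContinuousLinearMap.comp_apply]
  rw [euclidean_sum_single (fderiv ℝ (transition φ ψ) x (EuclideanSpace.single i 1)),
    euclidean_sum_single (fderiv ℝ (transition φ ψ) x (EuclideanSpace.single j 1))]
  simp only [map_sum, map_smul, sum_apply, smul_apply, smul_eq_mul,
    Matrix.mul_apply, Matrix.transpose_apply, Finset.sum_mul, Finset.mul_sum, jacobian,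
    Matrix.of_apply]
  refine Finset.sum_congr rfl fun b _ => Finset.sum_congr rfl fun a _ => ?_
  rw [metricCoeff_apply]
  ring

lemma det_metricCoeff_pos (p : M) {x : EuclideanSpace ℝ (Fin n)}
    (hx : x ∈ chartImage (chartAt (EuclideanHalfSpace n) p)) :
    0 < (metricCoeff g (chartAt (EuclideanHalfSpace n) p) x).det :=
  (posDef_metricCoeff g p hx).det_pos

lemma volumeDensity_pos (p : M) {x : EuclideanSpace ℝ (Fin n)}
    (hx : x ∈ chartImage (chartAt (EuclideanHalfSpace n) p)) :
    0 < volumeDensity g (chartAt (EuclideanHalfSpace n) p) x :=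
  Real.sqrt_pos.2 (det_metricCoeff_pos g p hx)

lemma contDiffOn_volumeDensity (p : M) :
    ContDiffOn ℝ ∞ (volumeDensity g (chartAt (EuclideanHalfSpace n) p))
      (chartImage (chartAt (EuclideanHalfSpace n) p)) :=
  (contDiffOn_det (contDiffOn_metricCoeff g p)).sqrt fun _ hx => (det_metricCoeff_pos g p hx).ne'

lemma contDiffOn_invMetricCoeff (p : M) (i j : Fin n) :
    ContDiffOn ℝ ∞ (fun x => invMetricCoeff g (chartAt (EuclideanHalfSpace n) p) x i j)
      (chartImage (chartAt (EuclideanHalfSpace n) p)) :=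
  contDiffOn_inv (contDiffOn_metricCoeff g p) (fun _ hx => (det_metricCoeff_pos g p hx).ne') i j

lemma invMetricCoeff_symm (φ : OpenPartialHomeomorph M (EuclideanHalfSpace n))
    (x : EuclideanSpace ℝ (Fin n)) (i j : Fin n) :
    invMetricCoeff g φ x i j = invMetricCoeff g φ x j i := by
  have : (invMetricCoeff g φ x).transpose = invMetricCoeff g φ x := by
    rw [invMetricCoeff, Matrix.transpose_nonsing_inv, metricCoeff_transpose]
  exact congrFun (congrFun this j) i

/-- The metric serves as a witness: a singular Jacobian would make det g vanish in the chart at `p`.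
-/
lemma det_jacobian_transition_ne_zero
    (g : Bundle.ContMDiffRiemannianMetric (𝓡∂ n) ∞ (EuclideanSpace ℝ (Fin n))
      (fun q : M => TangentSpace (𝓡∂ n) q)) (p q : M) {x : EuclideanSpace ℝ (Fin n)}
    (hx : x ∈ overlap (chartAt (EuclideanHalfSpace n) p) (chartAt (EuclideanHalfSpace n) q)) :
    (jacobian (transition (chartAt (EuclideanHalfSpace n) p)
        (chartAt (EuclideanHalfSpace n) q)) x).det ≠ 0 := fun h => by
  have h1 := det_metricCoeff_pos g p (chartDomain_subset_chartImage _ hx.1)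
  rw [metricCoeff_transition g p q hx, Matrix.det_mul, h, mul_zero] at h1
  exact lt_irrefl _ h1

lemma volumeDensity_transition (p q : M) {x : EuclideanSpace ℝ (Fin n)}
    (hx : x ∈ overlap (chartAt (EuclideanHalfSpace n) p) (chartAt (EuclideanHalfSpace n) q)) :
    volumeDensity g (chartAt (EuclideanHalfSpace n) p) x =
      |(fderiv ℝ (transition (chartAt (EuclideanHalfSpace n) p)
        (chartAt (EuclideanHalfSpace n) q)) x).det| *
      volumeDensity g (chartAt (EuclideanHalfSpace n) q)
        (transition (chartAt (EuclideanHalfSpace n) p) (chartAt (EuclideanHalfSpace n) q) x) := by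
  rw [volumeDensity, metricCoeff_transition g p q hx, Matrix.det_mul, Matrix.det_mul,
    Matrix.det_transpose, ← det_jacobian, mul_right_comm, Real.sqrt_mul (mul_self_nonneg _),
    Real.sqrt_mul_self_eq_abs, volumeDensity]

/-- Inverting `metricCoeff_transition` gives that the inverse metric at the image point is J g⁻¹ Jᵀ,
here in entries. -/
lemma invMetricCoeff_transition (p q : M) {x : EuclideanSpace ℝ (Fin n)}
    (hx : x ∈ overlap (chartAt (EuclideanHalfSpace n) p) (chartAt (EuclideanHalfSpace n) q))
    (c d : Fin n) :
    ∑ a, ∑ b, invMetricCoeff g (chartAt (EuclideanHalfSpace n) p) x a b *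
        fderiv ℝ (transition (chartAt (EuclideanHalfSpace n) p)
          (chartAt (EuclideanHalfSpace n) q)) x (EuclideanSpace.single a 1) c *
        fderiv ℝ (transition (chartAt (EuclideanHalfSpace n) p)
          (chartAt (EuclideanHalfSpace n) q)) x (EuclideanSpace.single b 1) d =
      invMetricCoeff g (chartAt (EuclideanHalfSpace n) q)
        (transition (chartAt (EuclideanHalfSpace n) p) (chartAt (EuclideanHalfSpace n) q) x)
        c d := by
  have hJ := isUnit_iff_ne_zero.2 (det_jacobian_transition_ne_zero g p q hx)
  have hG := metricCoeff_transition g p q hx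
  set φ := chartAt (EuclideanHalfSpace n) p
  set ψ := chartAt (EuclideanHalfSpace n) q
  set J := jacobian (transition φ ψ) x with hJdef
  have hJt : IsUnit J.transpose.det := by rwa [Matrix.det_transpose]
  have h1 : J * invMetricCoeff g φ x * J.transpose = invMetricCoeff g ψ (transition φ ψ x) := by
    rw [invMetricCoeff, hG, Matrix.mul_inv_rev, Matrix.mul_inv_rev, ← mul_assoc,
      Matrix.mul_nonsing_inv _ hJ, one_mul, mul_assoc, Matrix.nonsing_inv_mul _ hJt, mul_one,
      invMetricCoeff]
  rw [← h1, Matrix.mul_apply]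
  simp only [Matrix.mul_apply, Finset.sum_mul, Matrix.transpose_apply]
  rw [Finset.sum_comm]
  refine Finset.sum_congr rfl fun b _ => Finset.sum_congr rfl fun a _ => ?_
  simp only [hJdef, jacobian, Matrix.of_apply]
  ring

end TransitionMetric

/-! ### Integration by parts with compact support enforced by two mechanisms. -/

section LocalizedParts

open Filter Metric ContinuousLinearMap

variable {n : ℕ} {Ω K : Set (EuclideanSpace ℝ (Fin n))} {i : Fin n}
  {u v : EuclideanSpace ℝ (Fin n) → ℂ} {Θ : ℂ → ℂ} {r : ℝ}

lemma fderiv_eq_zero_of_ball (hΘ : ∀ ζ ∈ ball (0 : ℂ) r, Θ ζ = 0) {ζ : ℂ} (hζ : ‖ζ‖ < r) :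
    fderiv ℝ Θ ζ = 0 := by
  have : Θ =ᶠ[𝓝 ζ] fun _ => 0 := by
    filter_upwards [isOpen_ball.mem_nhds (mem_ball_zero_iff.2 hζ)] with y hy
    exact hΘ y hy
  rw [this.fderiv_eq, fderiv_fun_const]
  rfl

/-- Off `K` either factor may kill the integrand: the coefficient `c` does so away from the support
of a cutoff, and Θ(u) does so near the boundary of the manifold, where `u` is small. On `K` a
continuous function multiplies an integrable one. -/
lemma integrableOn_mul_comp_mul (hΩ : IsOpen Ω) (hK : IsCompact K) (hKΩ : K ⊆ Ω)
    (hu : ContinuousOn u Ω) (hΘ : Continuous Θ) (hΘr : ∀ ζ ∈ ball (0 : ℂ) r, Θ ζ = 0)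
    {c : EuclideanSpace ℝ (Fin n) → ℝ} (hc : ContinuousOn c Ω)
    (hcK : ∀ x ∈ Ω, x ∉ K → ‖u x‖ < r ∨ c x = 0) (hv : LocallyIntegrableOn v Ω volume) :
    IntegrableOn (fun x => (c x : ℂ) * Θ (u x) * v x) Ω volume := by
  refine IntegrableOn.of_forall_sdiff_eq_zero (s := K) ?_ hΩ.measurableSet fun x hx => ?_
  · exact (hv.integrableOn_compact_subset hKΩ hK).continuousOn_mul
      ((Complex.continuous_ofReal.comp_continuousOn (hc.mono hKΩ)).mul
        (hΘ.comp_continuousOn (hu.mono hKΩ))) hK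
  · rcases hcK x hx.1 hx.2 with h | h
    · rw [hΘr _ (mem_ball_zero_iff.2 h), mul_zero, zero_mul]
    · rw [h, Complex.ofReal_zero, zero_mul, zero_mul]

lemma integrableOn_mul_fderiv_mul (hΩ : IsOpen Ω) (hK : IsCompact K) (hKΩ : K ⊆ Ω)
    (hu : ContinuousOn u Ω) (hΘ : ContDiff ℝ ∞ Θ) (hΘr : ∀ ζ ∈ ball (0 : ℂ) r, Θ ζ = 0)
    {c : EuclideanSpace ℝ (Fin n) → ℝ} (hc : ContinuousOn c Ω)
    (hcK : ∀ x ∈ Ω, x ∉ K → ‖u x‖ < r ∨ c x = 0) {D : EuclideanSpace ℝ (Fin n) → ℂ}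
    (hD : MemLp D 2 (volume.restrict K)) (hv : MemLp v 2 (volume.restrict K)) :
    IntegrableOn (fun x => (c x : ℂ) * fderiv ℝ Θ (u x) (D x) * v x) Ω volume := by
  refine IntegrableOn.of_forall_sdiff_eq_zero (s := K) ?_ hΩ.measurableSet fun x hx => ?_
  · have hT : ContinuousOn (fun x => c x • fderiv ℝ Θ (u x)) K :=
      (hc.mono hKΩ).smul ((hΘ.continuous_fderiv (by simp)).comp_continuousOn (hu.mono hKΩ))
    obtain ⟨C, hC⟩ := hK.exists_bound_of_continuousOn hT
    have h1 : MemLp (fun x => (c x • fderiv ℝ Θ (u x)) (D x)) 2 (volume.restrict K) := by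
      refine hD.of_le_mul (c := C) ?_ ?_
      · exact (ContinuousLinearMap.apply ℝ ℂ).aestronglyMeasurable_comp₂ hD.1
          (hT.aestronglyMeasurable hK.measurableSet)
      · exact (ae_restrict_iff' hK.measurableSet).2 (Eventually.of_forall fun x hx =>
          (ContinuousLinearMap.le_opNorm _ _).trans (by gcongr; exact hC x hx))
    have h2 : Integrable (fun x => (c x • fderiv ℝ Θ (u x)) (D x) * v x) (volume.restrict K) :=
      h1.integrable_mul hv
    simp only [smul_apply, Complex.real_smul] at h2
    exact h2
  · rcases hcK x hx.1 hx.2 with h | h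
    · rw [fderiv_eq_zero_of_ball hΘr h, zero_apply, mul_zero, zero_mul]
    · rw [h, Complex.ofReal_zero, zero_mul, zero_mul]

/-- The value 1 is attained on a neighbourhood of each point of `K`, so multiplication by the cutoff
does not alter derivatives on `K`. -/
lemma exists_smooth_cutoff (hΩ : IsOpen Ω) (hK : IsCompact K) (hKΩ : K ⊆ Ω) :
    ∃ ζ : EuclideanSpace ℝ (Fin n) → ℝ, ContDiff ℝ ∞ ζ ∧ HasCompactSupport ζ ∧ tsupport ζ ⊆ Ω ∧
      ∀ x ∈ K, ∀ᶠ y in 𝓝 x, ζ y = 1 := by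
  obtain ⟨δ, hδ, hδΩ⟩ := hK.exists_cthickening_subset_open hΩ hKΩ
  obtain ⟨ζ, h1, h0, -⟩ := exists_contMDiffMap_one_nhds_of_subset_interior
    𝓘(ℝ, EuclideanSpace ℝ (Fin n)) (n := (⊤ : ℕ∞)) (s := K) (t := cthickening δ K) hK.isClosed
    ((self_subset_thickening hδ K).trans (thickening_subset_interior_cthickening δ K))
  have hs : tsupport ζ ⊆ cthickening δ K :=
    closure_minimal (Function.support_subset_iff'.2 h0) isClosed_cthickening
  exact ⟨ζ, ζ.contMDiff.contDiff, hK.cthickening.of_isClosed_subset (isClosed_tsupport _) hs,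
    hs.trans hδΩ, fun x hx => eventually_nhdsSet_iff_forall.1 h1 x hx⟩

lemma contDiff_mul_of_tsupport_subset (hΩ : IsOpen Ω) {ζ P : EuclideanSpace ℝ (Fin n) → ℝ}
    (hζ : ContDiff ℝ ∞ ζ) (hζs : tsupport ζ ⊆ Ω) (hP : ContDiffOn ℝ ∞ P Ω) :
    ContDiff ℝ ∞ fun x => ζ x * P x := by
  refine contDiff_iff_contDiffAt.2 fun x => ?_
  by_cases hx : x ∈ Ω
  · exact hζ.contDiffAt.mul (hP.contDiffAt (hΩ.mem_nhds hx))
  · have : (fun x => ζ x * P x) =ᶠ[𝓝 x] fun _ => 0 := by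
      filter_upwards [(isClosed_tsupport ζ).isOpen_compl.mem_nhds fun h => hx (hζs h)] with y hy
      rw [image_eq_zero_of_notMem_tsupport hy, zero_mul]
    exact contDiffAt_const.congr_of_eventuallyEq this

/-- Integration by parts against `P Θ(u)`, where the compact support in `Ω` is enforced by the
vanishing of `P` or of `Θ(u)`. -/
theorem HasWeakPartial.integral_comp_smooth' (hΩ : IsOpen Ω) (hK : IsCompact K) (hKΩ : K ⊆ Ω)
    (hu : ContinuousOn u Ω) {D : Fin n → EuclideanSpace ℝ (Fin n) → ℂ}
    (hD : ∀ i, HasWeakPartial Ω i u (D i))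
    (hL : ∀ K ⊆ Ω, IsCompact K → ∀ i, MemLp (D i) 2 (volume.restrict K))
    {v' : EuclideanSpace ℝ (Fin n) → ℂ} (hv : HasWeakPartial Ω i v v')
    (hvL : ∀ K ⊆ Ω, IsCompact K → MemLp v 2 (volume.restrict K))
    (hΘ : ContDiff ℝ ∞ Θ) (hΘr : ∀ ζ ∈ ball (0 : ℂ) r, Θ ζ = 0)
    {P : EuclideanSpace ℝ (Fin n) → ℝ} (hP : ContDiffOn ℝ ∞ P Ω)
    (hPK : ∀ x ∈ Ω, x ∉ K → ‖u x‖ < r ∨ P =ᶠ[𝓝 x] fun _ => 0) :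
    ∫ x in Ω, (P x : ℂ) * Θ (u x) * v' x =
      -∫ x in Ω, ((fderiv ℝ P x (EuclideanSpace.single i 1) : ℂ) * Θ (u x) * v x +
        (P x : ℂ) * fderiv ℝ Θ (u x) (D i x) * v x) := by
  obtain ⟨ζ, hζ, hζc, hζs, hζ1⟩ := exists_smooth_cutoff hΩ hK hKΩ
  have hY := contDiff_mul_of_tsupport_subset hΩ hζ hζs hP
  have hYs : tsupport (fun x => ζ x * P x) ⊆ tsupport ζ :=
    closure_mono fun x hx h0 => hx (by simp [h0])
  have h0 := hv.integral_comp_smooth hΩ hu hD hL hvL hΘ hY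
    (hζc.of_isClosed_subset (isClosed_tsupport _) hYs) (hYs.trans hζs)
  -- At every point either Θ(u) and DΘ(u) vanish, or ζP and P have the same germ: on `K` because ζ
  -- is 1 nearby, off `K` because P is 0 nearby. Hence ζ can be removed from both integrals.
  have key : ∀ x ∈ Ω, ‖u x‖ < r ∨ (fun x => ζ x * P x) =ᶠ[𝓝 x] P := fun x hx => by
    by_cases hxK : x ∈ K
    · right
      filter_upwards [hζ1 x hxK] with y hy
      rw [hy, one_mul]
    · refine (hPK x hx hxK).imp id fun h => ?_
      filter_upwards [h] with y hy
      rw [hy, mul_zero]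
  have e1 : ∫ x in Ω, (P x : ℂ) * Θ (u x) * v' x =
      ∫ x in Ω, ((ζ x * P x : ℝ) : ℂ) * Θ (u x) * v' x := by
    refine setIntegral_congr_fun hΩ.measurableSet fun x hx => ?_
    rcases key x hx with h | h
    · simp only [hΘr _ (mem_ball_zero_iff.2 h), mul_zero]
    · simp only [h.eq_of_nhds]
  rw [e1, h0]
  congr 1
  refine setIntegral_congr_fun hΩ.measurableSet fun x hx => ?_
  rcases key x hx with h | h
  · simp only [hΘr _ (mem_ball_zero_iff.2 h), fderiv_eq_zero_of_ball hΘr h, zero_apply, mul_zero,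
      zero_mul, add_zero]
  · simp only [h.eq_of_nhds, h.fderiv_eq]
    ring

end LocalizedParts

/-! ### Compactness away from the boundary, and the divergence form of the Laplacian. -/

section ChartEnergy

open Filter Metric

variable {n : ℕ} [NeZero n] {M : Type*} [TopologicalSpace M]

/-- The coordinate derivative `∂_a χ` of a real function on the manifold. -/
def coordDeriv (φ : OpenPartialHomeomorph M (EuclideanHalfSpace n)) (χ : M → ℝ) (a : Fin n)
    (x : EuclideanSpace ℝ (Fin n)) : ℝ :=
  fderiv ℝ (fun y => χ (chartInv φ y)) x (EuclideanSpace.single a 1)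

lemma continuousAt_chartInv {φ : OpenPartialHomeomorph M (EuclideanHalfSpace n)}
    {x : EuclideanSpace ℝ (Fin n)} (hx : x ∈ chartDomain φ) : ContinuousAt (chartInv φ) x :=
  (continuousOn_chartInv φ).continuousAt (mem_interior_iff_mem_nhds.1 hx)

lemma comp_chartInv_eventuallyEq_zero {φ : OpenPartialHomeomorph M (EuclideanHalfSpace n)}
    {χ : M → ℝ} {x : EuclideanSpace ℝ (Fin n)} (hx : x ∈ chartDomain φ)
    (hχ : chartInv φ x ∉ tsupport χ) : (fun y => χ (chartInv φ y)) =ᶠ[𝓝 x] fun _ => 0 := by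
  filter_upwards [(continuousAt_chartInv hx).preimage_mem_nhds
    ((isClosed_tsupport χ).isOpen_compl.mem_nhds hχ)] with y hy
  exact image_eq_zero_of_notMem_tsupport hy

lemma coordDeriv_eq_zero {φ : OpenPartialHomeomorph M (EuclideanHalfSpace n)}
    {χ : M → ℝ} {x : EuclideanSpace ℝ (Fin n)} (hx : x ∈ chartDomain φ)
    (hχ : chartInv φ x ∉ tsupport χ) (a : Fin n) : coordDeriv φ χ a x = 0 := by
  rw [coordDeriv, (comp_chartInv_eventuallyEq_zero hx hχ).fderiv_eq, fderiv_fun_const]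
  rfl

variable [ChartedSpace (EuclideanHalfSpace n) M] [IsManifold (𝓡∂ n) ∞ M]

lemma contDiffOn_comp_chartInv (p : M) {χ : M → ℝ} (hχ : ContMDiff (𝓡∂ n) 𝓘(ℝ) ∞ χ) :
    ContDiffOn ℝ ∞ (fun y => χ (chartInv (chartAt (EuclideanHalfSpace n) p) y))
      (chartImage (chartAt (EuclideanHalfSpace n) p)) := by
  rw [← contMDiffOn_iff_contDiffOn]
  exact hχ.comp_contMDiffOn (contMDiffOn_chartInv p)

lemma continuousOn_coordDeriv (p : M) {χ : M → ℝ} (hχ : ContMDiff (𝓡∂ n) 𝓘(ℝ) ∞ χ) (a : Fin n) :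
    ContinuousOn (coordDeriv (chartAt (EuclideanHalfSpace n) p) χ a)
      (chartDomain (chartAt (EuclideanHalfSpace n) p)) :=
  (((contDiffOn_comp_chartInv p hχ).mono
    (chartDomain_subset_chartImage _)).continuousOn_fderiv_of_isOpen
      (isOpen_chartDomain _) (by simp)).clm_apply continuousOn_const

/-- On the part of the support of `χ` where `f` is not small, a chart is valued in a compact
subset of the open half-space if `f` vanishes on the boundary. -/
lemma exists_compact_of_boundary_eq_zero [CompactSpace M] (p : M) {f : C(M, ℂ)}
    (hf : ∀ q ∈ (𝓡∂ n).boundary M, f q = 0) {χ : M → ℝ}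
    (hχ : tsupport χ ⊆ (chartAt (EuclideanHalfSpace n) p).source) {r : ℝ} (hr : 0 < r) :
    ∃ K ⊆ chartDomain (chartAt (EuclideanHalfSpace n) p), IsCompact K ∧
      ∀ x ∈ chartDomain (chartAt (EuclideanHalfSpace n) p), x ∉ K →
        ‖f (chartInv (chartAt (EuclideanHalfSpace n) p) x)‖ < r ∨
          chartInv (chartAt (EuclideanHalfSpace n) p) x ∉ tsupport χ := by
  set φ := chartAt (EuclideanHalfSpace n) p
  have hK₀ : IsCompact (tsupport χ ∩ {q | r ≤ ‖f q‖}) :=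
    ((isClosed_tsupport χ).inter (isClosed_le continuous_const f.continuous.norm)).isCompact
  -- The set where |f| ≥ r is closed and misses the boundary, since f = 0 there; intersected with
  -- the support of χ it is a compact set of interior points covered by the chart.
  refine ⟨φ.extend (𝓡∂ n) '' (tsupport χ ∩ {q | r ≤ ‖f q‖}), ?_, ?_, fun x hx hxK => ?_⟩
  · rintro _ ⟨q, ⟨hq, hqr⟩, rfl⟩
    have hb : q ∉ (𝓡∂ n).boundary M := fun h => by
      have : r ≤ ‖f q‖ := hqr
      rw [hf q h, norm_zero] at this
      exact this.not_gt hr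
    rw [mem_chartDomain_iff p (extend_mem_chartImage (hχ hq)), chartInv_extend (hχ hq),
      ← ModelWithCorners.compl_boundary]
    exact hb
  · exact hK₀.image_of_continuousOn ((φ.continuousOn_extend (I := 𝓡∂ n)).mono fun q hq => by
      rw [φ.extend_source]; exact hχ hq.1)
  · by_contra! h
    exact hxK ⟨chartInv φ x, ⟨h.2, h.1⟩, extend_chartInv (chartDomain_subset_chartImage _ hx)⟩

variable (g : Bundle.ContMDiffRiemannianMetric (𝓡∂ n) ∞ (EuclideanSpace ℝ (Fin n))
    (fun q : M => TangentSpace (𝓡∂ n) q))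

/-- The coefficients `√(det g) g^{ab}` of the Laplacian in divergence form. -/
def divCoeff (φ : OpenPartialHomeomorph M (EuclideanHalfSpace n)) (a b : Fin n)
    (x : EuclideanSpace ℝ (Fin n)) : ℝ := volumeDensity g φ x * invMetricCoeff g φ x a b

lemma contDiffOn_divCoeff (p : M) (a b : Fin n) :
    ContDiffOn ℝ ∞ (divCoeff g (chartAt (EuclideanHalfSpace n) p) a b)
      (chartImage (chartAt (EuclideanHalfSpace n) p)) :=
  (contDiffOn_volumeDensity g p).mul (contDiffOn_invMetricCoeff g p a b)

/-- The Laplacian in divergence form. -/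
lemma volumeDensity_mul_laplaceExpr (p : M) {x : EuclideanSpace ℝ (Fin n)}
    (hx : x ∈ chartDomain (chartAt (EuclideanHalfSpace n) p))
    (D₁ : Fin n → EuclideanSpace ℝ (Fin n) → ℂ)
    (D₂ : Fin n → Fin n → EuclideanSpace ℝ (Fin n) → ℂ) :
    (volumeDensity g (chartAt (EuclideanHalfSpace n) p) x : ℂ) *
        laplaceExpr g (chartAt (EuclideanHalfSpace n) p) D₁ D₂ x =
      (∑ a, ∑ b, (divCoeff g (chartAt (EuclideanHalfSpace n) p) a b x : ℂ) * D₂ b a x) +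
      ∑ a, ∑ b, (fderiv ℝ (divCoeff g (chartAt (EuclideanHalfSpace n) p) a b) x
        (EuclideanSpace.single a 1) : ℂ) * D₁ b x := by
  set φ := chartAt (EuclideanHalfSpace n) p
  have hn : chartImage φ ∈ 𝓝 x := mem_interior_iff_mem_nhds.1 hx
  have hdiff : ∀ {F : EuclideanSpace ℝ (Fin n) → ℝ}, ContDiffOn ℝ ∞ F (chartImage φ) →
      DifferentiableAt ℝ F x := fun hF => (hF.contDiffAt hn).differentiableAt (by simp)
  have hdiv : ∀ b, ∑ a, fderiv ℝ (divCoeff g φ a b) x (EuclideanSpace.single a 1) =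
      -(volumeDensity g φ x * ∑ i, ∑ j, invMetricCoeff g φ x i j * christoffel g φ b i j x) :=
    fun b => sum_fderiv_sqrt_det_mul_inv (fun i j => hdiff (contDiffOn_metricCoeff g p i j))
      (fun i j => hdiff (contDiffOn_invMetricCoeff g p i j))
      (hdiff (contDiffOn_det (contDiffOn_metricCoeff g p)))
      (by filter_upwards [hn] with y hy using det_metricCoeff_pos g p hy)
      (metricCoeff_transpose g φ) (fun l i j => dMetricCoeff g φ l i j x) (fun l i j => rfl) b
  have e1 : ∑ a, ∑ b, (divCoeff g φ a b x : ℂ) * D₂ b a x =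
      (volumeDensity g φ x : ℂ) * ∑ i, ∑ j, (invMetricCoeff g φ x i j : ℂ) * D₂ i j x := by
    -- The outer derivative of the divergence is ∂_a, hence `D₂ b a`. The indices are exchanged by
    -- the symmetry of g^{ab}, so the symmetry of weak second derivatives is not needed.
    rw [Finset.sum_comm]
    simp only [Finset.mul_sum]
    refine Finset.sum_congr rfl fun i _ => Finset.sum_congr rfl fun j _ => ?_
    rw [divCoeff, invMetricCoeff_symm g φ x j i]
    push_cast
    ring
  have e2 : ∑ a, ∑ b, (fderiv ℝ (divCoeff g φ a b) x (EuclideanSpace.single a 1) : ℂ) * D₁ b x =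
      -((volumeDensity g φ x : ℂ) * ∑ i, ∑ j, ∑ k, (invMetricCoeff g φ x i j : ℂ) *
        (christoffel g φ k i j x : ℂ) * D₁ k x) := by
    rw [Finset.sum_comm]
    have h1 : ∀ b, ∑ a, (fderiv ℝ (divCoeff g φ a b) x (EuclideanSpace.single a 1) : ℂ) * D₁ b x =
        -((volumeDensity g φ x : ℂ) * ∑ i, ∑ j, (invMetricCoeff g φ x i j : ℂ) *
        (christoffel g φ b i j x : ℂ) * D₁ b x) := fun b => by
      rw [← Finset.sum_mul, ← Complex.ofReal_sum, hdiv b]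
      push_cast
      simp only [← Finset.sum_mul]
      ring
    simp only [h1, Finset.sum_neg_distrib, ← Finset.mul_sum]
    congr 2
    rw [Finset.sum_comm]
    exact Finset.sum_congr rfl fun i _ => Finset.sum_comm
  rw [e1, e2, laplaceExpr]
  ring

end ChartEnergy

/-! ### Green's formula in one chart. -/

section ChartGreen

open Filter Metric

lemma HasWeakPartial.ae_eq {n : ℕ} {Ω : Set (EuclideanSpace ℝ (Fin n))} {i : Fin n}
    {u v u' v' : EuclideanSpace ℝ (Fin n) → ℂ} (hΩ : IsOpen Ω) (h : HasWeakPartial Ω i u v)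
    (h' : HasWeakPartial Ω i u' v') (hu : ∀ᵐ x ∂volume.restrict Ω, u x = u' x) :
    ∀ᵐ x ∂volume.restrict Ω, v x = v' x := by
  filter_upwards [(h.add (h'.smul (-1))).ae_zero hΩ
    (by filter_upwards [hu] with x hx; simp [hx])] with x hx
  simpa [add_neg_eq_zero] using hx

lemma sum_sum_integral_add {α ι : Type*} [Fintype ι] [MeasurableSpace α] {μ : Measure α}
    {F G : ι → ι → α → ℂ} (hF : ∀ a b, Integrable (F a b) μ) (hG : ∀ a b, Integrable (G a b) μ) :
    ∑ a, ∑ b, (∫ x, F a b x ∂μ + ∫ x, G a b x ∂μ) =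
      ∫ x, ∑ a, ∑ b, (F a b x + G a b x) ∂μ := by
  have h : ∀ a b, Integrable (fun x => F a b x + G a b x) μ := fun a b => (hF a b).add (hG a b)
  rw [integral_finsetSum _ fun a _ => integrable_finsetSum _ fun b _ => h a b]
  refine Finset.sum_congr rfl fun a _ => ?_
  rw [integral_finsetSum _ fun b _ => h a b]
  exact Finset.sum_congr rfl fun b _ => (integral_add (hF a b) (hG a b)).symm

variable {n : ℕ} [NeZero n] {M : Type*} [TopologicalSpace M]
  [ChartedSpace (EuclideanHalfSpace n) M] [IsManifold (𝓡∂ n) ∞ M]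
  (g : Bundle.ContMDiffRiemannianMetric (𝓡∂ n) ∞ (EuclideanSpace ℝ (Fin n))
    (fun q : M => TangentSpace (𝓡∂ n) q))

/-- The weak derivatives provided by the Sobolev space satisfy the Laplace equation. -/
lemma exists_weakDerivs {f h : M → ℂ} (hS : MemSobolevTwo (n := n) 2 f) (hh : HasLaplacian g f h)
    (p : M) : ∃ D₁ D₂, HasWeakDerivs (chartAt (EuclideanHalfSpace n) p) f D₁ D₂ ∧
      (∀ K ⊆ chartImage (chartAt (EuclideanHalfSpace n) p), IsCompact K → ∀ i,
        MemLp (D₁ i) 2 (volume.restrict (K ∩ chartDomain (chartAt (EuclideanHalfSpace n) p)))) ∧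
      ∀ᵐ x ∂volume.restrict (chartDomain (chartAt (EuclideanHalfSpace n) p)),
        h (chartInv (chartAt (EuclideanHalfSpace n) p) x) =
          laplaceExpr g (chartAt (EuclideanHalfSpace n) p) D₁ D₂ x := by
  have hp := IsManifold.chart_mem_maximalAtlas (I := 𝓡∂ n) (n := ∞) p
  obtain ⟨D₁, D₂, hD, hL⟩ := hS _ hp
  obtain ⟨D₁', D₂', hD', hL'⟩ := hh _ hp
  refine ⟨D₁, D₂, hD, fun K hK hKc => (hL K hK hKc).2.1, ?_⟩
  -- The Sobolev condition and the Laplace equation each come with their own weak derivatives;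
  -- uniqueness almost everywhere identifies them.
  have h1 : ∀ i, ∀ᵐ x ∂volume.restrict (chartDomain (chartAt (EuclideanHalfSpace n) p)),
      D₁' i x = D₁ i x := fun i =>
    (hD'.1 i).ae_eq (isOpen_chartDomain _) (hD.1 i) (Eventually.of_forall fun _ => rfl)
  have h2 : ∀ i j, ∀ᵐ x ∂volume.restrict (chartDomain (chartAt (EuclideanHalfSpace n) p)),
      D₂' i j x = D₂ i j x := fun i j =>
    (hD'.2 i j).ae_eq (isOpen_chartDomain _) (hD.2 i j) (h1 i)
  filter_upwards [hL', ae_all_iff.2 h1, ae_all_iff.2 fun i => ae_all_iff.2 (h2 i)] with x a b c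
  rw [a]
  simp only [laplaceExpr, b, c]

variable [CompactSpace M]

/-- Green's formula in a chart, against `χ Θ(f)` where `Θ` vanishes near zero. -/
theorem integral_mul_laplacian (p : M) {f : C(M, ℂ)} {h : M → ℂ}
    (hf : ∀ q ∈ (𝓡∂ n).boundary M, f q = 0)
    {D₁ : Fin n → EuclideanSpace ℝ (Fin n) → ℂ}
    {D₂ : Fin n → Fin n → EuclideanSpace ℝ (Fin n) → ℂ}
    (hD : HasWeakDerivs (chartAt (EuclideanHalfSpace n) p) f D₁ D₂)
    (hL : ∀ K ⊆ chartDomain (chartAt (EuclideanHalfSpace n) p), IsCompact K →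
      ∀ i, MemLp (D₁ i) 2 (volume.restrict K))
    (hlap : ∀ᵐ x ∂volume.restrict (chartDomain (chartAt (EuclideanHalfSpace n) p)),
      h (chartInv (chartAt (EuclideanHalfSpace n) p) x) =
        laplaceExpr g (chartAt (EuclideanHalfSpace n) p) D₁ D₂ x)
    {χ : M → ℝ} (hχ : ContMDiff (𝓡∂ n) 𝓘(ℝ) ∞ χ)
    (hχs : tsupport χ ⊆ (chartAt (EuclideanHalfSpace n) p).source)
    {Θ : ℂ → ℂ} (hΘ : ContDiff ℝ ∞ Θ) {r : ℝ} (hr : 0 < r)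
    (hΘr : ∀ ζ ∈ ball (0 : ℂ) r, Θ ζ = 0) :
    ∫ x in chartDomain (chartAt (EuclideanHalfSpace n) p),
        ((χ (chartInv (chartAt (EuclideanHalfSpace n) p) x) *
          volumeDensity g (chartAt (EuclideanHalfSpace n) p) x : ℝ) : ℂ) *
        Θ (f (chartInv (chartAt (EuclideanHalfSpace n) p) x)) *
        h (chartInv (chartAt (EuclideanHalfSpace n) p) x) =
      -(∑ a, ∑ b, ∫ x in chartDomain (chartAt (EuclideanHalfSpace n) p),
          ((divCoeff g (chartAt (EuclideanHalfSpace n) p) a b x *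
            coordDeriv (chartAt (EuclideanHalfSpace n) p) χ a x : ℝ) : ℂ) *
          Θ (f (chartInv (chartAt (EuclideanHalfSpace n) p) x)) * D₁ b x) -
        ∑ a, ∑ b, ∫ x in chartDomain (chartAt (EuclideanHalfSpace n) p),
          ((χ (chartInv (chartAt (EuclideanHalfSpace n) p) x) *
            divCoeff g (chartAt (EuclideanHalfSpace n) p) a b x : ℝ) : ℂ) *
          fderiv ℝ Θ (f (chartInv (chartAt (EuclideanHalfSpace n) p) x)) (D₁ a x) * D₁ b x := by
  obtain ⟨K, hKΩ, hK, hKf⟩ := exists_compact_of_boundary_eq_zero p hf hχs hr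
  set φ := chartAt (EuclideanHalfSpace n) p with hφ
  have hΩ : IsOpen (chartDomain φ) := isOpen_chartDomain φ
  have hu : ContinuousOn (fun x => f (chartInv φ x)) (chartDomain φ) :=
    f.continuous.comp_continuousOn ((continuousOn_chartInv φ).mono (chartDomain_subset_chartImage _))
  have hX : ContDiffOn ℝ ∞ (fun x => χ (chartInv φ x)) (chartDomain φ) :=
    (contDiffOn_comp_chartInv p hχ).mono (chartDomain_subset_chartImage _)
  have hA : ∀ a b, ContDiffOn ℝ ∞ (divCoeff g φ a b) (chartDomain φ) := fun a b =>
    (contDiffOn_divCoeff g p a b).mono (chartDomain_subset_chartImage _)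
  have hdA : ∀ a b, ContinuousOn
      (fun x => fderiv ℝ (divCoeff g φ a b) x (EuclideanSpace.single a 1)) (chartDomain φ) :=
    fun a b => ((hA a b).continuousOn_fderiv_of_isOpen hΩ (by simp)).clm_apply continuousOn_const
  have hX0 : ∀ x ∈ chartDomain φ, x ∉ K → ‖f (chartInv φ x)‖ < r ∨
      (fun y => χ (chartInv φ y)) =ᶠ[𝓝 x] fun _ => 0 := fun x hx hxK =>
    (hKf x hx hxK).imp id fun h => comp_chartInv_eventuallyEq_zero hx h
  have hX0' : ∀ {c : EuclideanSpace ℝ (Fin n) → ℝ}, ∀ x ∈ chartDomain φ, x ∉ K →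
      ‖f (chartInv φ x)‖ < r ∨ χ (chartInv φ x) * c x = 0 := fun x hx hxK =>
    (hX0 x hx hxK).imp id fun h => by rw [show χ (chartInv φ x) = 0 from h.eq_of_nhds, zero_mul]
  have i1 : ∀ a b, IntegrableOn (fun x => ((χ (chartInv φ x) * divCoeff g φ a b x : ℝ) : ℂ) *
      Θ (f (chartInv φ x)) * D₂ b a x) (chartDomain φ) := fun a b =>
    integrableOn_mul_comp_mul hΩ hK hKΩ hu hΘ.continuous hΘr
      (hX.continuousOn.mul (hA a b).continuousOn) hX0' (hD.2 b a).2.1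
  have i2 : ∀ a b, IntegrableOn (fun x => ((χ (chartInv φ x) *
      fderiv ℝ (divCoeff g φ a b) x (EuclideanSpace.single a 1) : ℝ) : ℂ) *
      Θ (f (chartInv φ x)) * D₁ b x) (chartDomain φ) := fun a b =>
    integrableOn_mul_comp_mul hΩ hK hKΩ hu hΘ.continuous hΘr
      (hX.continuousOn.mul (hdA a b)) hX0' (hD.1 b).2.1
  have i3 : ∀ a b, IntegrableOn (fun x => ((divCoeff g φ a b x * coordDeriv φ χ a x : ℝ) : ℂ) *
      Θ (f (chartInv φ x)) * D₁ b x) (chartDomain φ) := fun a b =>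
    integrableOn_mul_comp_mul hΩ hK hKΩ hu hΘ.continuous hΘr
      ((hA a b).continuousOn.mul (continuousOn_coordDeriv p hχ a))
      (fun x hx hxK => (hKf x hx hxK).imp id fun h => by
        rw [coordDeriv_eq_zero hx h, mul_zero]) (hD.1 b).2.1
  have i4 : ∀ a b, IntegrableOn (fun x => ((χ (chartInv φ x) * divCoeff g φ a b x : ℝ) : ℂ) *
      fderiv ℝ Θ (f (chartInv φ x)) (D₁ a x) * D₁ b x) (chartDomain φ) := fun a b =>
    integrableOn_mul_fderiv_mul hΩ hK hKΩ hu hΘ hΘr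
      (hX.continuousOn.mul (hA a b).continuousOn) hX0' (hL K hKΩ hK a) (hL K hKΩ hK b)
  -- Integration by parts with P = χ√(det g)g^{ab}. Of the three resulting terms, the one that
  -- differentiates √(det g)g^{ab} cancels against the first-order part of the divergence form.
  have parts : ∀ a b, ∫ x in chartDomain φ, ((χ (chartInv φ x) * divCoeff g φ a b x : ℝ) : ℂ) *
      Θ (f (chartInv φ x)) * D₂ b a x =
      -((∫ x in chartDomain φ, ((divCoeff g φ a b x * coordDeriv φ χ a x : ℝ) : ℂ) *
          Θ (f (chartInv φ x)) * D₁ b x) +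
        (∫ x in chartDomain φ, ((χ (chartInv φ x) *
          fderiv ℝ (divCoeff g φ a b) x (EuclideanSpace.single a 1) : ℝ) : ℂ) *
          Θ (f (chartInv φ x)) * D₁ b x) +
        ∫ x in chartDomain φ, ((χ (chartInv φ x) * divCoeff g φ a b x : ℝ) : ℂ) *
          fderiv ℝ Θ (f (chartInv φ x)) (D₁ a x) * D₁ b x) := fun a b => by
    rw [HasWeakPartial.integral_comp_smooth' hΩ hK hKΩ hu hD.1 hL (hD.2 b a)
      (fun K hK hKc => hL K hK hKc b) hΘ hΘr (hX.mul (hA a b)) fun x hx hxK =>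
        (hX0 x hx hxK).imp id fun h => by
          filter_upwards [h] with y hy
          simp [hy]]
    rw [← integral_add' (i3 a b) (i2 a b), ← integral_add' ((i3 a b).add (i2 a b)) (i4 a b)]
    congr 1
    refine setIntegral_congr_fun hΩ.measurableSet fun x hx => ?_
    have e : fderiv ℝ (fun x => χ (chartInv φ x) * divCoeff g φ a b x) x
        (EuclideanSpace.single a 1) = divCoeff g φ a b x * coordDeriv φ χ a x +
          χ (chartInv φ x) * fderiv ℝ (divCoeff g φ a b) x (EuclideanSpace.single a 1) := by
      rw [fderiv_fun_mul ((hX.contDiffAt (hΩ.mem_nhds hx)).differentiableAt (by simp))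
        (((hA a b).contDiffAt (hΩ.mem_nhds hx)).differentiableAt (by simp))]
      simp [coordDeriv]
      ring
    simp only [Pi.add_apply, e]
    push_cast
    ring
  have key : ∫ x in chartDomain φ, ((χ (chartInv φ x) * volumeDensity g φ x : ℝ) : ℂ) *
        Θ (f (chartInv φ x)) * h (chartInv φ x) =
      ∑ a, ∑ b, ((∫ x in chartDomain φ, ((χ (chartInv φ x) * divCoeff g φ a b x : ℝ) : ℂ) *
        Θ (f (chartInv φ x)) * D₂ b a x) + ∫ x in chartDomain φ, ((χ (chartInv φ x) *
          fderiv ℝ (divCoeff g φ a b) x (EuclideanSpace.single a 1) : ℝ) : ℂ) *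
          Θ (f (chartInv φ x)) * D₁ b x) := by
    rw [sum_sum_integral_add i1 i2]
    refine integral_congr_ae ?_
    filter_upwards [hlap, ae_restrict_mem hΩ.measurableSet] with x hx hxΩ
    have := volumeDensity_mul_laplaceExpr g p hxΩ D₁ D₂
    rw [← hφ, ← hx] at this
    push_cast
    rw [show (χ (chartInv φ x) : ℂ) * (volumeDensity g φ x : ℂ) * Θ (f (chartInv φ x)) *
      h (chartInv φ x) = (χ (chartInv φ x) : ℂ) * Θ (f (chartInv φ x)) *
        ((volumeDensity g φ x : ℂ) * h (chartInv φ x)) by ring, this]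
    simp only [mul_add, Finset.mul_sum, Finset.sum_add_distrib]
    congr 1 <;> refine Finset.sum_congr rfl fun a _ => Finset.sum_congr rfl fun b _ => by ring
  rw [key]
  simp only [parts, Finset.sum_add_distrib, Finset.sum_neg_distrib]
  ring

end ChartGreen

/-! ### Chart independence of the product of two gradients. -/

section CrossTerm

open Filter Metric

lemma HasWeakPartial.mono {n : ℕ} {Ω Ω' : Set (EuclideanSpace ℝ (Fin n))} {i : Fin n}
    {u v : EuclideanSpace ℝ (Fin n) → ℂ} (h : HasWeakPartial Ω i u v) (hΩ : Ω' ⊆ Ω) :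
    HasWeakPartial Ω' i u v := by
  refine ⟨h.1.mono_set hΩ, h.2.1.mono_set hΩ, fun ψ hψ hc hs => ?_⟩
  have h0 := h.2.2 ψ hψ hc (hs.trans hΩ)
  have h1 : ∀ x, x ∉ tsupport ψ → fderiv ℝ ψ x (EuclideanSpace.single i 1) • u x = 0 :=
    fun x hx => by
      rw [image_eq_zero_of_notMem_tsupport fun h => hx (tsupport_fderiv_subset ℝ h)]
      simp
  have h2 : ∀ x, x ∉ tsupport ψ → ψ x • v x = 0 := fun x hx => by
    rw [image_eq_zero_of_notMem_tsupport hx, zero_smul]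
  rw [setIntegral_eq_integral_of_forall_compl_eq_zero fun x hx => h1 x fun h => hx (hΩ (hs h)),
    setIntegral_eq_integral_of_forall_compl_eq_zero fun x hx => h2 x fun h => hx (hΩ (hs h))] at h0
  rwa [setIntegral_eq_integral_of_forall_compl_eq_zero fun x hx => h1 x fun h => hx (hs h),
    setIntegral_eq_integral_of_forall_compl_eq_zero fun x hx => h2 x fun h => hx (hs h)]

/-- Index bookkeeping for `gradPairing_transition`, where `t` is the absolute Jacobian determinant,
`w` the density, `A` the inverse metric, `J` the Jacobian matrix, and `X`, `D` are the two gradients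
in the new chart. -/
lemma sum_mul_sum_mul_sum {ι R : Type*} [Fintype ι] [CommRing R] (t w : R) (A J : ι → ι → R)
    (X D : ι → R) :
    ∑ a, ∑ b, t * w * A a b * (∑ c, J a c * X c) * (∑ d, J b d * D d) =
      t * ∑ c, ∑ d, w * (∑ a, ∑ b, A a b * J a c * J b d) * X c * D d := by
  have h1 : ∀ a b, t * w * A a b * (∑ c, J a c * X c) * (∑ d, J b d * D d) =
      ∑ c, ∑ d, t * (w * (A a b * J a c * J b d) * X c * D d) := fun a b => by
    rw [mul_assoc, Finset.sum_mul_sum, Finset.mul_sum]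
    refine Finset.sum_congr rfl fun c _ => ?_
    rw [Finset.mul_sum]
    exact Finset.sum_congr rfl fun d _ => by ring
  have h2 : ∀ c d, t * (w * (∑ a, ∑ b, A a b * J a c * J b d) * X c * D d) =
      ∑ a, ∑ b, t * (w * (A a b * J a c * J b d) * X c * D d) := fun c d => by
    simp only [Finset.mul_sum, Finset.sum_mul]
  simp only [Finset.mul_sum _ _ t, h1, h2]
  calc _ = ∑ a, ∑ c, ∑ b, ∑ d, t * (w * (A a b * J a c * J b d) * X c * D d) :=
        Finset.sum_congr rfl fun a _ => Finset.sum_comm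
    _ = ∑ c, ∑ a, ∑ b, ∑ d, t * (w * (A a b * J a c * J b d) * X c * D d) := Finset.sum_comm
    _ = ∑ c, ∑ a, ∑ d, ∑ b, t * (w * (A a b * J a c * J b d) * X c * D d) :=
        Finset.sum_congr rfl fun c _ => Finset.sum_congr rfl fun a _ => Finset.sum_comm
    _ = _ := Finset.sum_congr rfl fun c _ => Finset.sum_comm

variable {n : ℕ} [NeZero n] {M : Type*} [TopologicalSpace M]
  [ChartedSpace (EuclideanHalfSpace n) M] [IsManifold (𝓡∂ n) ∞ M]

lemma coordDeriv_transition (p q : M) {χ : M → ℝ} (hχ : ContMDiff (𝓡∂ n) 𝓘(ℝ) ∞ χ) (a : Fin n)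
    {x : EuclideanSpace ℝ (Fin n)}
    (hx : x ∈ overlap (chartAt (EuclideanHalfSpace n) p) (chartAt (EuclideanHalfSpace n) q)) :
    coordDeriv (chartAt (EuclideanHalfSpace n) p) χ a x =
      ∑ c, fderiv ℝ (transition (chartAt (EuclideanHalfSpace n) p)
          (chartAt (EuclideanHalfSpace n) q)) x (EuclideanSpace.single a 1) c *
        coordDeriv (chartAt (EuclideanHalfSpace n) q) χ c
          (transition (chartAt (EuclideanHalfSpace n) p) (chartAt (EuclideanHalfSpace n) q) x) := by
  have hτ := ((contDiffOn_transition p q).contDiffAt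
    ((isOpen_overlap _ _).mem_nhds hx)).differentiableAt (by simp)
  have hy := (transition_mem_overlap p q hx).1
  have hX := ((contDiffOn_comp_chartInv q hχ).contDiffAt
    (mem_interior_iff_mem_nhds.1 hy)).differentiableAt (by simp)
  set φ := chartAt (EuclideanHalfSpace n) p
  set ψ := chartAt (EuclideanHalfSpace n) q
  have hev : (fun y => χ (chartInv φ y)) =ᶠ[𝓝 x]
      (fun y => χ (chartInv ψ y)) ∘ transition φ ψ := by
    filter_upwards [(isOpen_overlap φ ψ).mem_nhds hx] with z hz
    rw [Function.comp_apply, chartInv_transition hz]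
  rw [coordDeriv, hev.fderiv_eq, fderiv_comp x hX hτ, ContinuousLinearMap.comp_apply]
  conv_lhs => rw [euclidean_sum_single (fderiv ℝ (transition φ ψ) x (EuclideanSpace.single a 1))]
  simp only [map_sum, map_smul, smul_eq_mul, coordDeriv]

variable (g : Bundle.ContMDiffRiemannianMetric (𝓡∂ n) ∞ (EuclideanSpace ℝ (Fin n))
    (fun q : M => TangentSpace (𝓡∂ n) q))

/-- The product of the gradients of `χ` and of a function with derivatives `D`, as a density. -/
def gradPairing (φ : OpenPartialHomeomorph M (EuclideanHalfSpace n)) (χ : M → ℝ)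
    (D : Fin n → EuclideanSpace ℝ (Fin n) → ℂ) (x : EuclideanSpace ℝ (Fin n)) : ℂ :=
  ∑ a, ∑ b, ((divCoeff g φ a b x * coordDeriv φ χ a x : ℝ) : ℂ) * D b x

variable {f : C(M, ℂ)} {p q : M} {D D' : Fin n → EuclideanSpace ℝ (Fin n) → ℂ}

/-- The Jacobian factors of the two gradients are absorbed by the inverse metric, so only the factor
|det| of the volume density survives. The identity holds almost everywhere because the weak chain
rule does. -/
lemma gradPairing_transition
    (hD : ∀ i, HasWeakPartial (chartDomain (chartAt (EuclideanHalfSpace n) p)) i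
      (f ∘ chartInv (chartAt (EuclideanHalfSpace n) p)) (D i))
    (hD' : ∀ i, HasWeakPartial (chartDomain (chartAt (EuclideanHalfSpace n) q)) i
      (f ∘ chartInv (chartAt (EuclideanHalfSpace n) q)) (D' i))
    (hL' : ∀ K ⊆ chartDomain (chartAt (EuclideanHalfSpace n) q), IsCompact K →
      ∀ i, MemLp (D' i) 2 (volume.restrict K))
    {χ : M → ℝ} (hχ : ContMDiff (𝓡∂ n) 𝓘(ℝ) ∞ χ) :
    ∀ᵐ x ∂volume.restrict
        (overlap (chartAt (EuclideanHalfSpace n) p) (chartAt (EuclideanHalfSpace n) q)),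
      gradPairing g (chartAt (EuclideanHalfSpace n) p) χ D x =
        |(fderiv ℝ (transition (chartAt (EuclideanHalfSpace n) p)
          (chartAt (EuclideanHalfSpace n) q)) x).det| •
        gradPairing g (chartAt (EuclideanHalfSpace n) q) χ D'
          (transition (chartAt (EuclideanHalfSpace n) p) (chartAt (EuclideanHalfSpace n) q) x) := by
  have hdet : ∀ x ∈ overlap (chartAt (EuclideanHalfSpace n) p) (chartAt (EuclideanHalfSpace n) q),
      (fderiv ℝ (transition (chartAt (EuclideanHalfSpace n) p)
        (chartAt (EuclideanHalfSpace n) q)) x).det ≠ 0 := fun x hx => by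
    rw [← det_jacobian]
    exact det_jacobian_transition_ne_zero g p q hx
  have hmaps : Set.MapsTo (transition (chartAt (EuclideanHalfSpace n) p)
      (chartAt (EuclideanHalfSpace n) q))
      (overlap (chartAt (EuclideanHalfSpace n) p) (chartAt (EuclideanHalfSpace n) q))
      (chartDomain (chartAt (EuclideanHalfSpace n) q)) := fun x hx =>
    (transition_mem_overlap p q hx).1
  have hchain : ∀ i, _ := fun i => HasWeakPartial.chain_rule (isOpen_overlap _ _)
    (isOpen_chartDomain _) (contDiffOn_transition p q) hmaps (injOn_transition _ _) hdet
    (u₁ := f ∘ chartInv (chartAt (EuclideanHalfSpace n) p))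
    (u₂ := f ∘ chartInv (chartAt (EuclideanHalfSpace n) q))
    (fun x hx => by simp only [Function.comp_apply, chartInv_transition hx])
    (f.continuous.comp_continuousOn
      ((continuousOn_chartInv _).mono (chartDomain_subset_chartImage _))) hD' hL'
    ((hD i).mono Set.inter_subset_left)
  filter_upwards [ae_all_iff.2 hchain, ae_restrict_mem (isOpen_overlap _ _).measurableSet]
    with x hx hxo
  have hA := invMetricCoeff_transition g p q hxo
  have hw := volumeDensity_transition g p q hxo
  have hX := fun a => coordDeriv_transition p q hχ a hxo
  set φ := chartAt (EuclideanHalfSpace n) p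
  set ψ := chartAt (EuclideanHalfSpace n) q
  set τ := transition φ ψ
  simp only [gradPairing, divCoeff, hw, hX, hx, ← hA, Complex.real_smul]
  push_cast
  exact sum_mul_sum_mul_sum _ _ _ _ _ _

/-- Independence of the chart for the integral of the product of two gradients. -/
lemma integral_gradPairing_eq
    (hD : ∀ i, HasWeakPartial (chartDomain (chartAt (EuclideanHalfSpace n) p)) i
      (f ∘ chartInv (chartAt (EuclideanHalfSpace n) p)) (D i))
    (hD' : ∀ i, HasWeakPartial (chartDomain (chartAt (EuclideanHalfSpace n) q)) i
      (f ∘ chartInv (chartAt (EuclideanHalfSpace n) q)) (D' i))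
    (hL' : ∀ K ⊆ chartDomain (chartAt (EuclideanHalfSpace n) q), IsCompact K →
      ∀ i, MemLp (D' i) 2 (volume.restrict K))
    {χ : M → ℝ} (hχ : ContMDiff (𝓡∂ n) 𝓘(ℝ) ∞ χ)
    (hχs : tsupport χ ⊆ (chartAt (EuclideanHalfSpace n) p).source) {Φ : M → ℂ}
    (hΦ : Function.support Φ ⊆ (chartAt (EuclideanHalfSpace n) q).source) :
    ∫ x in chartDomain (chartAt (EuclideanHalfSpace n) p),
        Φ (chartInv (chartAt (EuclideanHalfSpace n) p) x) *
          gradPairing g (chartAt (EuclideanHalfSpace n) p) χ D x =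
      ∫ x in chartDomain (chartAt (EuclideanHalfSpace n) q),
        Φ (chartInv (chartAt (EuclideanHalfSpace n) q) x) *
          gradPairing g (chartAt (EuclideanHalfSpace n) q) χ D' x := by
  have htr := gradPairing_transition g hD hD' hL' hχ
  have hfd : ∀ x ∈ overlap (chartAt (EuclideanHalfSpace n) p) (chartAt (EuclideanHalfSpace n) q),
      HasFDerivWithinAt (transition (chartAt (EuclideanHalfSpace n) p)
        (chartAt (EuclideanHalfSpace n) q)) (fderiv ℝ (transition
        (chartAt (EuclideanHalfSpace n) p) (chartAt (EuclideanHalfSpace n) q)) x)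
        (overlap (chartAt (EuclideanHalfSpace n) p) (chartAt (EuclideanHalfSpace n) q)) x :=
    fun x hx => (((contDiffOn_transition p q).contDiffAt
      ((isOpen_overlap _ _).mem_nhds hx)).differentiableAt
        (by simp)).hasFDerivAt.hasFDerivWithinAt
  have himg := image_transition_overlap (n := n) p q
  set φ := chartAt (EuclideanHalfSpace n) p
  set ψ := chartAt (EuclideanHalfSpace n) q
  -- `Φ` lives in the chart at `q` and dχ in the chart at `p`, so both integrals reduce to the
  -- overlap, where the change of variables produces exactly the factor of `gradPairing_transition`.
  have e1 : ∫ x in chartDomain φ, Φ (chartInv φ x) * gradPairing g φ χ D x =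
      ∫ x in overlap φ ψ, Φ (chartInv φ x) * gradPairing g φ χ D x := by
    refine setIntegral_eq_of_subset_of_forall_sdiff_eq_zero (isOpen_chartDomain φ).measurableSet
      Set.inter_subset_left fun x hx => ?_
    have : Φ (chartInv φ x) = 0 := by
      by_contra h
      exact hx.2 ⟨hx.1, hΦ h⟩
    rw [this, zero_mul]
  have e2 : ∫ x in chartDomain ψ, Φ (chartInv ψ x) * gradPairing g ψ χ D' x =
      ∫ x in overlap ψ φ, Φ (chartInv ψ x) * gradPairing g ψ χ D' x := by
    refine setIntegral_eq_of_subset_of_forall_sdiff_eq_zero (isOpen_chartDomain ψ).measurableSet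
      Set.inter_subset_left fun x hx => ?_
    have : ∀ a, coordDeriv ψ χ a x = 0 := coordDeriv_eq_zero hx.1 fun h => hx.2 ⟨hx.1, hχs h⟩
    simp [gradPairing, this]
  rw [e1, e2, ← himg, integral_image_eq_integral_abs_det_fderiv_smul volume
    (isOpen_overlap φ ψ).measurableSet hfd (injOn_transition φ ψ)]
  refine integral_congr_ae ?_
  filter_upwards [htr, ae_restrict_mem (isOpen_overlap φ ψ).measurableSet] with x hx hxo
  rw [hx, chartInv_transition hxo, mul_smul_comm]

end CrossTerm

/-! ### Green's formula on the manifold by a partition of unity. -/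

section GlobalGreen

open Filter Metric

variable {n : ℕ} [NeZero n] {M : Type*} [TopologicalSpace M]
  [ChartedSpace (EuclideanHalfSpace n) M] [IsManifold (𝓡∂ n) ∞ M]
  (g : Bundle.ContMDiffRiemannianMetric (𝓡∂ n) ∞ (EuclideanSpace ℝ (Fin n))
    (fun q : M => TangentSpace (𝓡∂ n) q))

lemma mul_mul_gradPairing (φ : OpenPartialHomeomorph M (EuclideanHalfSpace n)) (χ : M → ℝ)
    (D : Fin n → EuclideanSpace ℝ (Fin n) → ℂ) (x : EuclideanSpace ℝ (Fin n)) (s : ℝ) (t : ℂ) :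
    (s : ℂ) * t * gradPairing g φ χ D x =
      ∑ a, ∑ b, ((s * (divCoeff g φ a b x * coordDeriv φ χ a x) : ℝ) : ℂ) * t * D b x := by
  simp only [gradPairing, Finset.mul_sum]
  refine Finset.sum_congr rfl fun a _ => Finset.sum_congr rfl fun b _ => ?_
  push_cast
  ring

/-- In a single chart the pairing is linear in dχ, and the derivatives of functions with constant
sum add up to zero. -/
lemma sum_gradPairing {ι : Type*} [Fintype ι] (p : M) {χ : ι → M → ℝ}
    (hχ : ∀ k, ContMDiff (𝓡∂ n) 𝓘(ℝ) ∞ (χ k)) (hχ1 : ∀ q, ∑ k, χ k q = 1)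
    (D : Fin n → EuclideanSpace ℝ (Fin n) → ℂ) {x : EuclideanSpace ℝ (Fin n)}
    (hx : x ∈ chartDomain (chartAt (EuclideanHalfSpace n) p)) :
    ∑ k, gradPairing g (chartAt (EuclideanHalfSpace n) p) (χ k) D x = 0 := by
  have h0 : ∀ a, ∑ k, coordDeriv (chartAt (EuclideanHalfSpace n) p) (χ k) a x = 0 := fun a => by
    have h1 := HasFDerivAt.fun_sum (u := Finset.univ) fun k _ =>
      (((contDiffOn_comp_chartInv p (hχ k)).contDiffAt
        (mem_interior_iff_mem_nhds.1 hx)).differentiableAt (by simp)).hasFDerivAt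
    simp only [hχ1] at h1
    have h2 := h1.unique (hasFDerivAt_const (1 : ℝ) x)
    have h3 := DFunLike.congr_fun h2 (EuclideanSpace.single a 1)
    simpa [coordDeriv] using h3
  simp only [gradPairing]
  rw [Finset.sum_comm]
  refine Finset.sum_eq_zero fun a _ => ?_
  rw [Finset.sum_comm]
  refine Finset.sum_eq_zero fun b _ => ?_
  rw [← Finset.sum_mul, ← Complex.ofReal_sum, ← Finset.mul_sum, h0, mul_zero, Complex.ofReal_zero,
    zero_mul]

variable [CompactSpace M] {f : C(M, ℂ)} {Θ : ℂ → ℂ} {r : ℝ}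

/-- Either cutoff may be the one supported in the chart. Both cases occur when a factor χ_l is
inserted next to dχ_k and the term is moved from chart k to chart l. -/
lemma integrableOn_mul_coordDeriv_mul (p : M) (hf : ∀ q ∈ (𝓡∂ n).boundary M, f q = 0)
    {D : Fin n → EuclideanSpace ℝ (Fin n) → ℂ}
    (hD : ∀ i, LocallyIntegrableOn (D i) (chartDomain (chartAt (EuclideanHalfSpace n) p)))
    {χ ρ : M → ℝ} (hχ : ContMDiff (𝓡∂ n) 𝓘(ℝ) ∞ χ) (hρ : Continuous ρ)
    (hs : tsupport ρ ⊆ (chartAt (EuclideanHalfSpace n) p).source ∨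
      tsupport χ ⊆ (chartAt (EuclideanHalfSpace n) p).source)
    (hΘ : Continuous Θ) (hr : 0 < r) (hΘr : ∀ ζ ∈ ball (0 : ℂ) r, Θ ζ = 0) (a b : Fin n) :
    IntegrableOn (fun x => ((ρ (chartInv (chartAt (EuclideanHalfSpace n) p) x) *
      (divCoeff g (chartAt (EuclideanHalfSpace n) p) a b x *
        coordDeriv (chartAt (EuclideanHalfSpace n) p) χ a x) : ℝ) : ℂ) *
      Θ (f (chartInv (chartAt (EuclideanHalfSpace n) p) x)) * D b x)
      (chartDomain (chartAt (EuclideanHalfSpace n) p)) := by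
  obtain ⟨K, hKΩ, hK, hKf⟩ : ∃ K ⊆ chartDomain (chartAt (EuclideanHalfSpace n) p),
      IsCompact K ∧ ∀ x ∈ chartDomain (chartAt (EuclideanHalfSpace n) p), x ∉ K →
        ‖f (chartInv (chartAt (EuclideanHalfSpace n) p) x)‖ < r ∨
          ρ (chartInv (chartAt (EuclideanHalfSpace n) p) x) *
          (divCoeff g (chartAt (EuclideanHalfSpace n) p) a b x *
          coordDeriv (chartAt (EuclideanHalfSpace n) p) χ a x) = 0 := by
    rcases hs with h | h
    · obtain ⟨K, hKΩ, hK, hKf⟩ := exists_compact_of_boundary_eq_zero p hf h hr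
      exact ⟨K, hKΩ, hK, fun x hx hxK => (hKf x hx hxK).imp id fun h => by
        rw [image_eq_zero_of_notMem_tsupport h, zero_mul]⟩
    · obtain ⟨K, hKΩ, hK, hKf⟩ := exists_compact_of_boundary_eq_zero p hf h hr
      exact ⟨K, hKΩ, hK, fun x hx hxK => (hKf x hx hxK).imp id fun h => by
        rw [coordDeriv_eq_zero hx h, mul_zero, mul_zero]⟩
  have hi : ContinuousOn (chartInv (chartAt (EuclideanHalfSpace n) p))
      (chartDomain (chartAt (EuclideanHalfSpace n) p)) :=
    (continuousOn_chartInv _).mono (chartDomain_subset_chartImage _)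
  exact integrableOn_mul_comp_mul (isOpen_chartDomain _) hK hKΩ
    (f.continuous.comp_continuousOn hi) hΘ hΘr
    ((hρ.comp_continuousOn hi).mul
      (((contDiffOn_divCoeff g p a b).continuousOn.mono (chartDomain_subset_chartImage _)).mul
      (continuousOn_coordDeriv p hχ a))) hKf (hD b)

lemma integrableOn_mul_gradPairing (p : M) (hf : ∀ q ∈ (𝓡∂ n).boundary M, f q = 0)
    {D : Fin n → EuclideanSpace ℝ (Fin n) → ℂ}
    (hD : ∀ i, LocallyIntegrableOn (D i) (chartDomain (chartAt (EuclideanHalfSpace n) p)))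
    {χ ρ : M → ℝ} (hχ : ContMDiff (𝓡∂ n) 𝓘(ℝ) ∞ χ) (hρ : Continuous ρ)
    (hs : tsupport ρ ⊆ (chartAt (EuclideanHalfSpace n) p).source ∨
      tsupport χ ⊆ (chartAt (EuclideanHalfSpace n) p).source)
    (hΘ : Continuous Θ) (hr : 0 < r) (hΘr : ∀ ζ ∈ ball (0 : ℂ) r, Θ ζ = 0) :
    IntegrableOn (fun x => (ρ (chartInv (chartAt (EuclideanHalfSpace n) p) x) : ℂ) *
      Θ (f (chartInv (chartAt (EuclideanHalfSpace n) p) x)) *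
      gradPairing g (chartAt (EuclideanHalfSpace n) p) χ D x)
      (chartDomain (chartAt (EuclideanHalfSpace n) p)) := by
  simp only [mul_mul_gradPairing]
  exact integrable_finsetSum _ fun a _ => integrable_finsetSum _ fun b _ =>
    integrableOn_mul_coordDeriv_mul g p hf hD hχ hρ hs hΘ hr hΘr a b

variable {ι : Type*} [Fintype ι] {P : ι → M} {χ : ι → M → ℝ}
  {D₁ : ι → Fin n → EuclideanSpace ℝ (Fin n) → ℂ}
  {D₂ : ι → Fin n → Fin n → EuclideanSpace ℝ (Fin n) → ℂ}

/-- The terms that contain the derivatives of a partition of unity cancel. -/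
lemma sum_integral_gradPairing (hf : ∀ q ∈ (𝓡∂ n).boundary M, f q = 0)
    (hχ : ∀ k, ContMDiff (𝓡∂ n) 𝓘(ℝ) ∞ (χ k)) (hχ1 : ∀ q, ∑ k, χ k q = 1)
    (hχs : ∀ k, tsupport (χ k) ⊆ (chartAt (EuclideanHalfSpace n) (P k)).source)
    (hD : ∀ k i, HasWeakPartial (chartDomain (chartAt (EuclideanHalfSpace n) (P k))) i
      (f ∘ chartInv (chartAt (EuclideanHalfSpace n) (P k))) (D₁ k i))
    (hL : ∀ k, ∀ K ⊆ chartDomain (chartAt (EuclideanHalfSpace n) (P k)), IsCompact K →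
      ∀ i, MemLp (D₁ k i) 2 (volume.restrict K))
    (hΘ : Continuous Θ) (hr : 0 < r) (hΘr : ∀ ζ ∈ ball (0 : ℂ) r, Θ ζ = 0) :
    ∑ k, ∫ x in chartDomain (chartAt (EuclideanHalfSpace n) (P k)),
      Θ (f (chartInv (chartAt (EuclideanHalfSpace n) (P k)) x)) *
        gradPairing g (chartAt (EuclideanHalfSpace n) (P k)) (χ k) (D₁ k) x = 0 := by
  have hint : ∀ k l j, tsupport (χ l) ⊆ (chartAt (EuclideanHalfSpace n) (P k)).source ∨
      tsupport (χ j) ⊆ (chartAt (EuclideanHalfSpace n) (P k)).source →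
      IntegrableOn (fun x => (χ l (chartInv (chartAt (EuclideanHalfSpace n) (P k)) x) : ℂ) *
        Θ (f (chartInv (chartAt (EuclideanHalfSpace n) (P k)) x)) *
        gradPairing g (chartAt (EuclideanHalfSpace n) (P k)) (χ j) (D₁ k) x)
        (chartDomain (chartAt (EuclideanHalfSpace n) (P k))) := fun k l j h =>
    integrableOn_mul_gradPairing g (P k) hf (fun i => (hD k i).2.1) (hχ j) (hχ l).continuous h hΘ
      hr hΘr
  -- Insert 1 = ∑ χ_l in chart k, transport the (k, l) term to chart l, and sum over k first: in the
  -- fixed chart l the sum of the dχ_k is zero.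
  calc _ = ∑ k, ∑ l, ∫ x in chartDomain (chartAt (EuclideanHalfSpace n) (P k)),
        (χ l (chartInv (chartAt (EuclideanHalfSpace n) (P k)) x) : ℂ) *
        Θ (f (chartInv (chartAt (EuclideanHalfSpace n) (P k)) x)) *
        gradPairing g (chartAt (EuclideanHalfSpace n) (P k)) (χ k) (D₁ k) x := by
        refine Finset.sum_congr rfl fun k _ => ?_
        rw [← integral_finsetSum _ fun l _ => hint k l k (Or.inr (hχs k))]
        simp only [← Finset.sum_mul, ← Complex.ofReal_sum, hχ1, Complex.ofReal_one, one_mul]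
    _ = ∑ k, ∑ l, ∫ x in chartDomain (chartAt (EuclideanHalfSpace n) (P l)),
        (χ l (chartInv (chartAt (EuclideanHalfSpace n) (P l)) x) : ℂ) *
        Θ (f (chartInv (chartAt (EuclideanHalfSpace n) (P l)) x)) *
        gradPairing g (chartAt (EuclideanHalfSpace n) (P l)) (χ k) (D₁ l) x := by
        refine Finset.sum_congr rfl fun k _ => Finset.sum_congr rfl fun l _ => ?_
        refine integral_gradPairing_eq g (hD k) (hD l) (hL l) (hχ k) (hχs k)
          (Φ := fun q => (χ l q : ℂ) * Θ (f q)) fun q hq => hχs l (subset_tsupport _ ?_)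
        intro h
        exact hq (by simp [h])
    _ = ∑ l, ∑ k, ∫ x in chartDomain (chartAt (EuclideanHalfSpace n) (P l)),
        (χ l (chartInv (chartAt (EuclideanHalfSpace n) (P l)) x) : ℂ) *
        Θ (f (chartInv (chartAt (EuclideanHalfSpace n) (P l)) x)) *
        gradPairing g (chartAt (EuclideanHalfSpace n) (P l)) (χ k) (D₁ l) x := Finset.sum_comm
    _ = 0 := by
        refine Finset.sum_eq_zero fun l _ => ?_
        rw [← integral_finsetSum _ fun k _ => hint l l k (Or.inl (hχs l))]
        simp only [← Finset.mul_sum]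
        rw [setIntegral_congr_fun (g := fun _ => 0) (isOpen_chartDomain _).measurableSet
          fun x hx => by simp only [sum_gradPairing g (P l) hχ hχ1 (D₁ l) hx, mul_zero]]
        simp

/-- Green's formula on the manifold, against `Θ(f)` where `Θ` vanishes near zero. -/
theorem sum_integral_mul_laplacian {h : M → ℂ} (hf : ∀ q ∈ (𝓡∂ n).boundary M, f q = 0)
    (hχ : ∀ k, ContMDiff (𝓡∂ n) 𝓘(ℝ) ∞ (χ k)) (hχ1 : ∀ q, ∑ k, χ k q = 1)
    (hχs : ∀ k, tsupport (χ k) ⊆ (chartAt (EuclideanHalfSpace n) (P k)).source)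
    (hD : ∀ k, HasWeakDerivs (chartAt (EuclideanHalfSpace n) (P k)) f (D₁ k) (D₂ k))
    (hL : ∀ k, ∀ K ⊆ chartDomain (chartAt (EuclideanHalfSpace n) (P k)), IsCompact K →
      ∀ i, MemLp (D₁ k i) 2 (volume.restrict K))
    (hlap : ∀ k, ∀ᵐ x ∂volume.restrict (chartDomain (chartAt (EuclideanHalfSpace n) (P k))),
      h (chartInv (chartAt (EuclideanHalfSpace n) (P k)) x) =
        laplaceExpr g (chartAt (EuclideanHalfSpace n) (P k)) (D₁ k) (D₂ k) x)
    (hΘ : ContDiff ℝ ∞ Θ) (hr : 0 < r) (hΘr : ∀ ζ ∈ ball (0 : ℂ) r, Θ ζ = 0) :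
    ∑ k, ∫ x in chartDomain (chartAt (EuclideanHalfSpace n) (P k)),
        ((χ k (chartInv (chartAt (EuclideanHalfSpace n) (P k)) x) *
          volumeDensity g (chartAt (EuclideanHalfSpace n) (P k)) x : ℝ) : ℂ) *
        Θ (f (chartInv (chartAt (EuclideanHalfSpace n) (P k)) x)) *
        h (chartInv (chartAt (EuclideanHalfSpace n) (P k)) x) =
      -∑ k, ∑ a, ∑ b, ∫ x in chartDomain (chartAt (EuclideanHalfSpace n) (P k)),
          ((χ k (chartInv (chartAt (EuclideanHalfSpace n) (P k)) x) *
            divCoeff g (chartAt (EuclideanHalfSpace n) (P k)) a b x : ℝ) : ℂ) *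
          fderiv ℝ Θ (f (chartInv (chartAt (EuclideanHalfSpace n) (P k)) x)) (D₁ k a x) *
            D₁ k b x := by
  have h0 := sum_integral_gradPairing g hf hχ hχ1 hχs (fun k => (hD k).1) hL hΘ.continuous hr hΘr
  have e : ∀ k, ∑ a, ∑ b, ∫ x in chartDomain (chartAt (EuclideanHalfSpace n) (P k)),
          ((divCoeff g (chartAt (EuclideanHalfSpace n) (P k)) a b x *
            coordDeriv (chartAt (EuclideanHalfSpace n) (P k)) (χ k) a x : ℝ) : ℂ) *
          Θ (f (chartInv (chartAt (EuclideanHalfSpace n) (P k)) x)) * D₁ k b x =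
        ∫ x in chartDomain (chartAt (EuclideanHalfSpace n) (P k)),
          Θ (f (chartInv (chartAt (EuclideanHalfSpace n) (P k)) x)) *
          gradPairing g (chartAt (EuclideanHalfSpace n) (P k)) (χ k) (D₁ k) x := fun k => by
    have hi := integrableOn_mul_coordDeriv_mul g (P k) hf (fun i => ((hD k).1 i).2.1) (hχ k)
      (continuous_const (y := (1 : ℝ))) (Or.inr (hχs k)) hΘ.continuous hr hΘr
    simp only [one_mul] at hi
    have e1 := fun x => mul_mul_gradPairing g (chartAt (EuclideanHalfSpace n) (P k)) (χ k) (D₁ k) x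
      1 (Θ (f (chartInv (chartAt (EuclideanHalfSpace n) (P k)) x)))
    simp only [one_mul, Complex.ofReal_one] at e1
    simp only [e1]
    rw [integral_finsetSum _ fun a _ => integrable_finsetSum _ fun b _ => hi a b]
    exact Finset.sum_congr rfl fun a _ => (integral_finsetSum _ fun b _ => hi a b).symm
  rw [Finset.sum_congr rfl fun k _ => integral_mul_laplacian g (P k) hf (hD k) (hL k) (hlap k)
    (hχ k) (hχs k) hΘ hr hΘr]
  simp only [e, Finset.sum_sub_distrib, Finset.sum_neg_distrib, h0, neg_zero, zero_sub]

end GlobalGreen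

/-! ### Approximation of conjugation and the limits of the two sides of Green's formula. -/

section Limits

open Filter Metric

/-- Smooth functions that vanish near zero and approximate complex conjugation. -/
lemma exists_conj_approx : ∃ (Θ : ℕ → ℂ → ℂ) (C : ℝ), (∀ m, ContDiff ℝ ∞ (Θ m)) ∧
    (∀ m, ∃ r, 0 < r ∧ ∀ ζ ∈ ball (0 : ℂ) r, Θ m ζ = 0) ∧ (∀ m ζ, ‖Θ m ζ‖ ≤ ‖ζ‖) ∧
    (∀ m ζ, ‖fderiv ℝ (Θ m) ζ‖ ≤ C) ∧
    ∀ ζ, ζ ≠ 0 → ∀ᶠ m in atTop, Θ m ζ = Complex.conjCLE ζ ∧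
      fderiv ℝ (Θ m) ζ = (Complex.conjCLE : ℂ →L[ℝ] ℂ) := by
  let ρ : ContDiffBump (0 : ℂ) := ⟨1, 2, one_pos, one_lt_two⟩
  -- Ψ is 0 on the unit disc and equals conjugation outside the disc of radius 2. The rescalings
  -- s⁻¹Ψ(sζ) have derivative DΨ(sζ), so a bound for DΨ serves all of them.
  let Ψ : ℂ → ℂ := fun ζ => (1 - ρ ζ) • Complex.conjCLE ζ
  have hΨ : ContDiff ℝ ∞ Ψ :=
    (contDiff_const.sub ρ.contDiff).smul Complex.conjCLE.contDiff
  have hΨ0 : ∀ ζ, ‖ζ‖ < 1 → Ψ ζ = 0 := fun ζ hζ => by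
    simp only [Ψ]
    rw [ρ.one_of_mem_closedBall (mem_closedBall_zero_iff.2 hζ.le), sub_self, zero_smul]
  have hΨ2 : ∀ ζ, 2 < ‖ζ‖ → Ψ =ᶠ[𝓝 ζ] Complex.conjCLE := fun ζ hζ => by
    filter_upwards [(isOpen_lt continuous_const continuous_norm).mem_nhds hζ] with y hy
    simp only [Ψ]
    rw [ρ.zero_of_le_dist (by rw [dist_zero_right]; exact le_of_lt hy), sub_zero, one_smul]
  have hΨn : ∀ ζ, ‖Ψ ζ‖ ≤ ‖ζ‖ := fun ζ => by
    simp only [Ψ]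
    rw [norm_smul, Real.norm_of_nonneg (sub_nonneg.2 ρ.le_one)]
    simp only [Complex.conjCLE_apply, RCLike.norm_conj]
    exact mul_le_of_le_one_left (norm_nonneg _) (sub_le_self _ ρ.nonneg)
  have hΨ' : ∀ ζ, 2 < ‖ζ‖ → fderiv ℝ Ψ ζ = (Complex.conjCLE : ℂ →L[ℝ] ℂ) := fun ζ hζ => by
    rw [(hΨ2 ζ hζ).fderiv_eq]
    exact Complex.conjCLE.fderiv
  obtain ⟨C, hC⟩ := (isCompact_closedBall (0 : ℂ) 2).exists_bound_of_continuousOn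
    (hΨ.continuous_fderiv (by simp)).continuousOn
  let s : ℕ → ℝ := fun m => m + 1
  have hs : ∀ m, 0 < s m := fun m => by positivity
  have hd : ∀ m ζ, fderiv ℝ (fun ζ => (s m)⁻¹ • Ψ (s m • ζ)) ζ = fderiv ℝ Ψ (s m • ζ) :=
    fun m ζ => by
      have h1 : HasFDerivAt Ψ (fderiv ℝ Ψ (s m • ζ)) (s m • ζ) :=
        (hΨ.differentiable (by simp) _).hasFDerivAt
      have h2 := (h1.comp ζ ((hasFDerivAt_id ζ).const_smul (s m))).const_smul (s m)⁻¹
      refine h2.fderiv.trans ?_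
      ext
      all_goals simp [(hs m).ne']
  refine ⟨fun m ζ => (s m)⁻¹ • Ψ (s m • ζ), max C ‖(Complex.conjCLE : ℂ →L[ℝ] ℂ)‖, fun m =>
    (hΨ.comp (contDiff_id.const_smul (s m))).const_smul _, fun m => ⟨(s m)⁻¹, inv_pos.2 (hs m),
    fun ζ hζ => ?_⟩, fun m ζ => ?_, fun m ζ => ?_, fun ζ hζ => ?_⟩
  · show (s m)⁻¹ • Ψ (s m • ζ) = 0
    rw [hΨ0 _ ?_, smul_zero]
    rw [norm_smul, Real.norm_of_nonneg (hs m).le, ← mul_inv_cancel₀ (hs m).ne']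
    exact mul_lt_mul_of_pos_left (mem_ball_zero_iff.1 hζ) (hs m)
  · rw [norm_smul, norm_inv, Real.norm_of_nonneg (hs m).le, inv_mul_le_iff₀ (hs m)]
    refine (hΨn _).trans_eq ?_
    rw [norm_smul, Real.norm_of_nonneg (hs m).le]
  · rw [hd]
    by_cases h : 2 < ‖s m • ζ‖
    · rw [hΨ' _ h]
      exact le_max_right _ _
    · exact (hC _ (mem_closedBall_zero_iff.2 (not_lt.1 h))).trans (le_max_left _ _)
  · have h1 : ∀ᶠ m in atTop, 2 < ‖s m • ζ‖ := by
      have h2 : Tendsto (fun m => s m * ‖ζ‖) atTop atTop :=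
        (tendsto_atTop_add_const_right _ 1 tendsto_natCast_atTop_atTop).atTop_mul_const
          (norm_pos_iff.2 hζ)
      filter_upwards [h2.eventually_gt_atTop 2] with m hm
      rwa [norm_smul, Real.norm_of_nonneg (hs m).le]
    filter_upwards [h1] with m hm
    refine ⟨?_, by rw [hd, hΨ' _ hm]⟩
    rw [(hΨ2 _ hm).eq_of_nhds, map_smul, smul_smul, inv_mul_cancel₀ (hs m).ne', one_smul]

variable {n : ℕ} {Ω S K : Set (EuclideanSpace ℝ (Fin n))} {c : EuclideanSpace ℝ (Fin n) → ℝ}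
  {u v D : EuclideanSpace ℝ (Fin n) → ℂ}

/-- `K` may touch the boundary hyperplane and so leave `Ω`. Continuity of `c` on the larger set `S`
bounds it on `K`, while `v` is controlled only on `K ∩ Ω`. -/
lemma integrableOn_mul_of_compact (hΩ : IsOpen Ω) (hK : IsCompact K) (hKS : K ⊆ S)
    (hc : ContinuousOn c S) (hc0 : ∀ x ∈ Ω, x ∉ K → c x = 0)
    (hv : IntegrableOn v (K ∩ Ω)) : IntegrableOn (fun x => (c x : ℂ) * v x) Ω := by
  have hm : MeasurableSet (K ∩ Ω) := hK.measurableSet.inter hΩ.measurableSet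
  refine IntegrableOn.of_forall_sdiff_eq_zero (s := K ∩ Ω) ?_ hΩ.measurableSet fun x hx => ?_
  · have hcK : ContinuousOn (fun x => (c x : ℂ)) K :=
      Complex.continuous_ofReal.comp_continuousOn (hc.mono hKS)
    obtain ⟨C, hC⟩ := hK.exists_bound_of_continuousOn hcK
    exact Integrable.bdd_mul hv ((hcK.mono Set.inter_subset_left).aestronglyMeasurable hm)
      ((ae_restrict_iff' hm).2 (Eventually.of_forall fun x hx => hC x hx.1))
  · rw [hc0 x hx.1 fun h => hx.2 ⟨h, hx.1⟩, Complex.ofReal_zero, zero_mul]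

lemma aestronglyMeasurable_mul_clm_mul {μ : Measure (EuclideanSpace ℝ (Fin n))}
    {T : ℂ → ℂ →L[ℝ] ℂ} (hT : StronglyMeasurable T) (hc : AEStronglyMeasurable c μ)
    (hu : AEMeasurable u μ) (hD : AEStronglyMeasurable D μ) (hv : AEStronglyMeasurable v μ) :
    AEStronglyMeasurable (fun x => (c x : ℂ) * T (u x) (D x) * v x) μ := by
  have h1 : AEStronglyMeasurable (fun x => T (u x)) μ :=
    hT.aestronglyMeasurable.comp_aemeasurable hu
  have h2 : AEStronglyMeasurable (fun x => T (u x) (D x)) μ :=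
    (ContinuousLinearMap.apply ℝ ℂ).aestronglyMeasurable_comp₂ hD h1
  exact ((Complex.continuous_ofReal.comp_aestronglyMeasurable hc).mul h2).mul hv

lemma norm_mul_clm_mul_le {T : ℂ →L[ℝ] ℂ} {C : ℝ} (hT : ‖T‖ ≤ C) (s : ℝ) (d w : ℂ) :
    ‖(s : ℂ) * T d * w‖ ≤ C * ‖(s : ℂ) * (d * w)‖ := by
  rw [norm_mul, norm_mul, norm_mul, norm_mul]
  have := (T.le_opNorm d).trans (mul_le_mul_of_nonneg_right hT (norm_nonneg d))
  calc ‖(s : ℂ)‖ * ‖T d‖ * ‖w‖ ≤ ‖(s : ℂ)‖ * (C * ‖d‖) * ‖w‖ := by gcongr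
    _ = _ := by ring

lemma integrableOn_mul_clm_mul (hΩ : IsOpen Ω) (hΩS : Ω ⊆ S) (hK : IsCompact K) (hKS : K ⊆ S)
    (hc : ContinuousOn c S) (hc0 : ∀ x ∈ Ω, x ∉ K → c x = 0) (hu : ContinuousOn u Ω)
    (hDm : AEStronglyMeasurable D (volume.restrict Ω))
    (hvm : AEStronglyMeasurable v (volume.restrict Ω))
    (hD : MemLp D 2 (volume.restrict (K ∩ Ω))) (hv : MemLp v 2 (volume.restrict (K ∩ Ω)))
    {T : ℂ → ℂ →L[ℝ] ℂ} (hT : StronglyMeasurable T) {C : ℝ} (hTC : ∀ ζ, ‖T ζ‖ ≤ C) :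
    IntegrableOn (fun x => (c x : ℂ) * T (u x) (D x) * v x) Ω := by
  refine Integrable.mono' ((integrableOn_mul_of_compact hΩ hK hKS hc hc0
    (hD.integrable_mul hv)).norm.const_mul C) ?_ (Eventually.of_forall fun x =>
      norm_mul_clm_mul_le (hTC _) _ _ _)
  exact aestronglyMeasurable_mul_clm_mul hT ((hc.mono hΩS).aestronglyMeasurable hΩ.measurableSet)
    (hu.aemeasurable hΩ.measurableSet) hDm hvm

/-- Dominated convergence with majorant C|cDv|, integrable by the Cauchy–Schwarz inequality.
Pointwise convergence is enough, so the limit `T'` may be discontinuous. -/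
lemma tendsto_integral_mul_clm_mul (hΩ : IsOpen Ω) (hΩS : Ω ⊆ S) (hK : IsCompact K) (hKS : K ⊆ S)
    (hc : ContinuousOn c S) (hc0 : ∀ x ∈ Ω, x ∉ K → c x = 0) (hu : ContinuousOn u Ω)
    (hDm : AEStronglyMeasurable D (volume.restrict Ω))
    (hvm : AEStronglyMeasurable v (volume.restrict Ω))
    (hD : MemLp D 2 (volume.restrict (K ∩ Ω))) (hv : MemLp v 2 (volume.restrict (K ∩ Ω)))
    {T : ℕ → ℂ → ℂ →L[ℝ] ℂ} (hT : ∀ m, StronglyMeasurable (T m)) {C : ℝ}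
    (hTC : ∀ m ζ, ‖T m ζ‖ ≤ C) {T' : ℂ → ℂ →L[ℝ] ℂ}
    (hlim : ∀ ζ, Tendsto (fun m => T m ζ) atTop (𝓝 (T' ζ))) :
    Tendsto (fun m => ∫ x in Ω, (c x : ℂ) * T m (u x) (D x) * v x) atTop
      (𝓝 (∫ x in Ω, (c x : ℂ) * T' (u x) (D x) * v x)) := by
  refine tendsto_integral_of_dominated_convergence
    (fun x => C * ‖(c x : ℂ) * (D x * v x)‖) (fun m => ?_)
    ((integrableOn_mul_of_compact hΩ hK hKS hc hc0 (hD.integrable_mul hv)).norm.const_mul C)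
    (fun m => Eventually.of_forall fun x => norm_mul_clm_mul_le (hTC m _) _ _ _)
    (Eventually.of_forall fun x => ?_)
  · exact aestronglyMeasurable_mul_clm_mul (hT m)
      ((hc.mono hΩS).aestronglyMeasurable hΩ.measurableSet)
      (hu.aemeasurable hΩ.measurableSet) hDm hvm
  · have h : Tendsto (fun m => T m (u x) (D x)) atTop (𝓝 (T' (u x) (D x))) :=
      ((ContinuousLinearMap.apply ℝ ℂ (D x)).continuous.tendsto _).comp (hlim (u x))
    exact (h.const_mul _).mul_const _

lemma tendsto_integral_mul_comp_mul_self (hΩ : IsOpen Ω) (hΩS : Ω ⊆ S) (hK : IsCompact K)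
    (hKS : K ⊆ S) (hc : ContinuousOn c S) (hc0 : ∀ x ∈ Ω, x ∉ K → c x = 0)
    (hu : ContinuousOn u Ω) (hui : IntegrableOn (fun x => u x * u x) (K ∩ Ω))
    {Θ : ℕ → ℂ → ℂ} (hΘ : ∀ m, Continuous (Θ m)) (hΘC : ∀ m ζ, ‖Θ m ζ‖ ≤ ‖ζ‖)
    (hlim : ∀ ζ, Tendsto (fun m => Θ m ζ) atTop (𝓝 (Complex.conjCLE ζ))) (z : ℂ) :
    Tendsto (fun m => ∫ x in Ω, (c x : ℂ) * Θ m (u x) * (z * u x)) atTop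
      (𝓝 (z * ((∫ x in Ω, c x * Complex.normSq (u x) : ℝ) : ℂ))) := by
  have h : z * ((∫ x in Ω, c x * Complex.normSq (u x) : ℝ) : ℂ) =
      ∫ x in Ω, (c x : ℂ) * Complex.conjCLE (u x) * (z * u x) := by
    rw [← integral_complex_ofReal, ← integral_const_mul]
    refine integral_congr_ae (Eventually.of_forall fun x => ?_)
    simp only [Complex.conjCLE_apply, Complex.ofReal_mul, Complex.normSq_eq_conj_mul_self]
    ring
  rw [h]
  refine tendsto_integral_of_dominated_convergence
    (fun x => ‖z‖ * ‖(c x : ℂ) * (u x * u x)‖) (fun m => ?_)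
    ((integrableOn_mul_of_compact hΩ hK hKS hc hc0 hui).norm.const_mul _)
    (fun m => Eventually.of_forall fun x => ?_) (Eventually.of_forall fun x => ?_)
  · exact ContinuousOn.aestronglyMeasurable (((Complex.continuous_ofReal.comp_continuousOn
      (hc.mono hΩS)).mul ((hΘ m).comp_continuousOn hu)).mul (continuousOn_const.mul hu))
      hΩ.measurableSet
  · simp only [norm_mul]
    calc ‖(c x : ℂ)‖ * ‖Θ m (u x)‖ * (‖z‖ * ‖u x‖) ≤ ‖(c x : ℂ)‖ * ‖u x‖ * (‖z‖ * ‖u x‖) := by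
          gcongr
          exact hΘC m _
      _ = _ := by ring
  · exact ((hlim (u x)).const_mul _).mul_const _

end Limits

/-! ### The energy identity and the absence of eigenfunctions. -/

section Injectivity

open Filter Metric

/-- The real and imaginary parts of `D` each contribute a real quadratic form, and the mixed terms
cancel by symmetry of `A`. -/
lemma exists_nonneg_of_posSemidef {n : ℕ} {A : Matrix (Fin n) (Fin n) ℝ} (hA : A.PosSemidef)
    (D : Fin n → ℂ) :
    ∃ s : ℝ, 0 ≤ s ∧ ∑ a, ∑ b, (A a b : ℂ) * Complex.conjCLE (D a) * D b = s := by
  have hq : ∀ X : Fin n → ℝ, 0 ≤ ∑ a, ∑ b, A a b * X a * X b := fun X => by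
    have h := hA.dotProduct_mulVec_nonneg X
    simp only [star_trivial, dotProduct, Matrix.mulVec, Finset.mul_sum] at h
    refine h.trans_eq (Finset.sum_congr rfl fun a _ => Finset.sum_congr rfl fun b _ => by ring)
  have hs : ∀ a b, A a b = A b a := fun a b => by
    simpa using hA.1.apply b a
  refine ⟨_, add_nonneg (hq fun a => (D a).re) (hq fun a => (D a).im), ?_⟩
  apply Complex.ext
  · simp only [Complex.re_sum, Complex.ofReal_re, ← Finset.sum_add_distrib]
    refine Finset.sum_congr rfl fun a _ => Finset.sum_congr rfl fun b _ => ?_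
    simp [mul_assoc]
    ring
  · have h0 : ∑ a, ∑ b, A a b * (D a).im * (D b).re = ∑ a, ∑ b, A a b * (D a).re * (D b).im := by
      rw [Finset.sum_comm]
      refine Finset.sum_congr rfl fun a _ => Finset.sum_congr rfl fun b _ => ?_
      rw [hs]
      ring
    simp only [Complex.im_sum, Complex.ofReal_im]
    rw [← sub_eq_zero.2 h0.symm]
    simp only [← Finset.sum_sub_distrib]
    refine Finset.sum_congr rfl fun a _ => Finset.sum_congr rfl fun b _ => ?_
    simp [mul_assoc]
    ring

lemma exists_nonneg_setIntegral {α : Type*} [MeasurableSpace α] {μ : Measure α} {s : Set α}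
    (hs : MeasurableSet s) {F : α → ℂ} (hF : ∀ x ∈ s, ∃ t : ℝ, 0 ≤ t ∧ F x = t) :
    ∃ e : ℝ, 0 ≤ e ∧ ∫ x in s, F x ∂μ = e := by
  refine ⟨∫ x in s, (F x).re ∂μ, setIntegral_nonneg hs fun x hx => ?_, ?_⟩
  · obtain ⟨t, ht, h⟩ := hF x hx
    rwa [h, Complex.ofReal_re]
  · rw [← integral_complex_ofReal]
    refine setIntegral_congr_fun hs fun x hx => ?_
    obtain ⟨t, ht, h⟩ := hF x hx
    simp only [h, Complex.ofReal_re]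

/-- If s were not zero, z = -e/s would be real and nonpositive. -/
lemma eq_zero_of_mul_eq_neg {z : ℂ} (hz : z ∉ Complex.ofReal '' Set.Iic 0) {s e : ℝ} (hs : 0 ≤ s)
    (he : 0 ≤ e) (h : z * s = -e) : s = 0 := by
  by_contra h0
  refine hz ⟨-e / s, div_nonpos_of_nonpos_of_nonneg (neg_nonpos.2 he) hs, ?_⟩
  push_cast
  rw [← h, mul_div_cancel_right₀ _ (Complex.ofReal_ne_zero.2 h0)]

variable {n : ℕ} [NeZero n] {M : Type*} [TopologicalSpace M]
  [ChartedSpace (EuclideanHalfSpace n) M]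

lemma exists_finite_partition_of_unity [T2Space M] [CompactSpace M] [IsManifold (𝓡∂ n) ∞ M] :
    ∃ (t : Finset M) (χ : t → M → ℝ), (∀ k, ContMDiff (𝓡∂ n) 𝓘(ℝ) ∞ (χ k)) ∧
      (∀ q, ∑ k, χ k q = 1) ∧ (∀ k q, 0 ≤ χ k q) ∧
      ∀ k : t, tsupport (χ k) ⊆ (chartAt (EuclideanHalfSpace n) (k : M)).source := by
  obtain ⟨t, ht⟩ := CompactSpace.elim_nhds_subcover
    (fun q : M => (chartAt (EuclideanHalfSpace n) q).source) fun q => chart_source_mem_nhds _ q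
  obtain ⟨ρ, hρ⟩ := SmoothPartitionOfUnity.exists_isSubordinate (𝓡∂ n) (s := (Set.univ : Set M))
    isClosed_univ (fun k : t => (chartAt (EuclideanHalfSpace n) (k : M)).source)
    (fun k => (chartAt (EuclideanHalfSpace n) (k : M)).open_source) (fun q _ => by
      have : q ∈ ⋃ x ∈ t, (chartAt (EuclideanHalfSpace n) x).source := by rw [ht]; trivial
      simpa using this)
  refine ⟨t, fun k => ρ k, fun k => (ρ k).contMDiff, fun q => ?_, fun k q => ρ.nonneg k q, hρ⟩
  rw [← finsum_eq_sum_of_fintype]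
  exact ρ.sum_eq_one (Set.mem_univ q)

variable [IsManifold (𝓡∂ n) ∞ M]
  (g : Bundle.ContMDiffRiemannianMetric (𝓡∂ n) ∞ (EuclideanSpace ℝ (Fin n))
    (fun q : M => TangentSpace (𝓡∂ n) q))

/-- A nonnegative continuous integrand with zero integral vanishes on the open set `chartDomain`,
and by density on the whole chart image, which includes boundary points. The density of the volume
is positive, so the factor |f|² must vanish where χ does not. -/
lemma eqOn_zero_of_integral_eq_zero (p : M) {f : C(M, ℂ)} {χ : M → ℝ} (hχ : Continuous χ)
    (hχ0 : ∀ q, 0 ≤ χ q)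
    (hint : IntegrableOn (fun x => χ (chartInv (chartAt (EuclideanHalfSpace n) p) x) *
      volumeDensity g (chartAt (EuclideanHalfSpace n) p) x *
      Complex.normSq (f (chartInv (chartAt (EuclideanHalfSpace n) p) x)))
      (chartDomain (chartAt (EuclideanHalfSpace n) p)))
    (h : ∫ x in chartDomain (chartAt (EuclideanHalfSpace n) p),
      χ (chartInv (chartAt (EuclideanHalfSpace n) p) x) *
      volumeDensity g (chartAt (EuclideanHalfSpace n) p) x *
      Complex.normSq (f (chartInv (chartAt (EuclideanHalfSpace n) p) x)) = 0)
    {q : M} (hq : q ∈ (chartAt (EuclideanHalfSpace n) p).source) (hχq : χ q ≠ 0) : f q = 0 := by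
  have hw := fun x => volumeDensity_pos g p (x := x)
  have hwc := (contDiffOn_volumeDensity g p).continuousOn
  have hcl := extChartAt_target_subset_closure_interior (I := 𝓡∂ n) (x := p)
  change chartImage (chartAt (EuclideanHalfSpace n) p) ⊆
    closure (chartDomain (chartAt (EuclideanHalfSpace n) p)) at hcl
  set φ := chartAt (EuclideanHalfSpace n) p
  have hi := continuousOn_chartInv φ
  have hcont : ContinuousOn (fun x => χ (chartInv φ x) * volumeDensity g φ x *
      Complex.normSq (f (chartInv φ x))) (chartImage φ) :=
    ((hχ.comp_continuousOn hi).mul hwc).mul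
      (Complex.continuous_normSq.comp_continuousOn (f.continuous.comp_continuousOn hi))
  have h1 := (setIntegral_eq_zero_iff_of_nonneg_ae ((ae_restrict_iff'
    (isOpen_chartDomain φ).measurableSet).2 (Eventually.of_forall fun x hx =>
      mul_nonneg (mul_nonneg (hχ0 _) (hw x (chartDomain_subset_chartImage φ hx)).le)
        (Complex.normSq_nonneg _))) hint).1 h
  have h2 := Measure.eqOn_open_of_ae_eq h1 (isOpen_chartDomain φ)
    (hcont.mono (chartDomain_subset_chartImage φ)) continuousOn_const
  have h3 := h2.of_subset_closure hcont continuousOn_const (chartDomain_subset_chartImage φ) hcl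
  have h4 := h3 (extend_mem_chartImage hq)
  simp only [chartInv_extend hq, Pi.zero_apply, mul_eq_zero, hχq, false_or,
    (hw _ (extend_mem_chartImage hq)).ne', Complex.normSq_eq_zero] at h4
  exact h4

variable [T2Space M] [CompactSpace M]

/-- Outside `(-∞, 0]` the Dirichlet Laplacian has no eigenvalues. -/
theorem eq_zero_of_hasLaplacian_smul {f : C(M, ℂ)} {z : ℂ}
    (hz : z ∉ Complex.ofReal '' Set.Iic 0) (hS : MemSobolevTwo (n := n) 2 f)
    (hf : ∀ q ∈ (𝓡∂ n).boundary M, f q = 0) (hlap : HasLaplacian g f (z • f : C(M, ℂ))) :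
    f = 0 := by
  obtain ⟨t, χ, hχ, hχ1, hχ0, hχs⟩ := exists_finite_partition_of_unity (n := n) (M := M)
  choose D₁ D₂ hD hL hD₂ using exists_weakDerivs g hS hlap
  obtain ⟨Θ, C, hΘ, hΘr, hΘn, hΘC, hΘlim⟩ := exists_conj_approx
  choose r hr hΘr using hΘr
  let φ : M → OpenPartialHomeomorph M (EuclideanHalfSpace n) := chartAt (EuclideanHalfSpace n)
  let K : t → Set (EuclideanSpace ℝ (Fin n)) := fun k => (φ k).extend (𝓡∂ n) '' tsupport (χ k)
  have hK : ∀ k, IsCompact (K k) := fun k =>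
    (isClosed_tsupport (χ k)).isCompact.image_of_continuousOn
      (((φ k).continuousOn_extend (I := 𝓡∂ n)).mono fun q hq => by
        rw [(φ k).extend_source]; exact hχs k hq)
  have hKS : ∀ k, K k ⊆ chartImage (φ k) := by
    rintro k _ ⟨q, hq, rfl⟩
    exact extend_mem_chartImage (hχs k hq)
  have hΩS : ∀ k, chartDomain (φ k) ⊆ chartImage (φ k) := fun k =>
    chartDomain_subset_chartImage (φ k)
  have hΩ : ∀ k, IsOpen (chartDomain (φ k)) := fun k => isOpen_chartDomain (φ k)
  have hX0 : ∀ k : t, ∀ x ∈ chartDomain (φ k), x ∉ K k → χ k (chartInv (φ k) x) = 0 :=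
    fun k x hx hxK => image_eq_zero_of_notMem_tsupport fun h =>
      hxK ⟨_, h, extend_chartInv (hΩS k hx)⟩
  have hi : ∀ k, ContinuousOn (chartInv (φ k)) (chartImage (φ k)) := fun k =>
    continuousOn_chartInv (φ k)
  have hX : ∀ k : t, ContinuousOn (fun x => χ k (chartInv (φ k) x)) (chartImage (φ k)) :=
    fun k => (hχ k).continuous.comp_continuousOn (hi k)
  have hu : ∀ k, ContinuousOn (fun x => f (chartInv (φ k) x)) (chartImage (φ k)) := fun k =>
    f.continuous.comp_continuousOn (hi k)
  have hcw : ∀ k : t, ContinuousOn (fun x => χ k (chartInv (φ k) x) * volumeDensity g (φ k) x)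
      (chartImage (φ k)) := fun k =>
    (hX k).mul (contDiffOn_volumeDensity g (k : M)).continuousOn
  have hca : ∀ (k : t) a b, ContinuousOn
      (fun x => χ k (chartInv (φ k) x) * divCoeff g (φ k) a b x) (chartImage (φ k)) :=
    fun k a b => (hX k).mul (contDiffOn_divCoeff g (k : M) a b).continuousOn
  have hui : ∀ (k : t) {v : EuclideanSpace ℝ (Fin n) → ℂ}, ContinuousOn v (chartImage (φ k)) →
      IntegrableOn v (K k ∩ chartDomain (φ k)) := fun k v hv =>
    ((hv.mono (hKS k)).integrableOn_compact (hK k)).mono_set Set.inter_subset_left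
  have hDm : ∀ (k : t) a, AEStronglyMeasurable (D₁ k a) (volume.restrict (chartDomain (φ k))) :=
    fun k a => ((hD k).1 a).2.1.aestronglyMeasurable
  have hDL : ∀ (k : t) a, MemLp (D₁ k a) 2 (volume.restrict (K k ∩ chartDomain (φ k))) :=
    fun k a => hL k (K k) (hKS k) (hK k) a
  have green := fun m => sum_integral_mul_laplacian g (P := fun k : t => (k : M)) hf hχ hχ1 hχs
    (fun k => hD k) (fun k K' hK' hKc i => by
      have := hL k K' (hK'.trans (hΩS k)) hKc i
      rwa [Set.inter_eq_left.2 hK'] at this) (fun k => hD₂ k) (hΘ m) (hr m) (hΘr m)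
  -- The pointwise limit of the derivatives of Θ_m. It is 0 at the origin because every Θ_m vanishes
  -- near 0.
  let T : ℂ → ℂ →L[ℝ] ℂ := fun ζ => if ζ = 0 then 0 else (Complex.conjCLE : ℂ →L[ℝ] ℂ)
  have hT : StronglyMeasurable T := StronglyMeasurable.ite (measurableSet_singleton 0)
    stronglyMeasurable_const stronglyMeasurable_const
  have hTm : ∀ m, StronglyMeasurable (fderiv ℝ (Θ m)) := fun m =>
    ((hΘ m).continuous_fderiv (by simp)).stronglyMeasurable
  have hTlim : ∀ ζ, Tendsto (fun m => fderiv ℝ (Θ m) ζ) atTop (𝓝 (T ζ)) := fun ζ => by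
    by_cases h : ζ = 0
    · refine tendsto_const_nhds.congr fun m => ?_
      simp only [T, h, if_true]
      rw [fderiv_eq_zero_of_ball (hΘr m) (by simpa using hr m)]
    · refine tendsto_const_nhds.congr' ?_
      filter_upwards [hΘlim ζ h] with m hm
      simp only [T, h, if_false, hm.2]
  have hTC : ∀ ζ, ‖T ζ‖ ≤ C := fun ζ =>
    le_of_tendsto (hTlim ζ).norm (Eventually.of_forall fun m => hΘC m ζ)
  have hΘlim' : ∀ ζ, Tendsto (fun m => Θ m ζ) atTop (𝓝 (Complex.conjCLE ζ)) := fun ζ => by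
    by_cases h : ζ = 0
    · refine tendsto_const_nhds.congr fun m => ?_
      rw [h, hΘr m 0 (mem_ball_self (hr m)), map_zero]
    · refine tendsto_const_nhds.congr' ?_
      filter_upwards [hΘlim ζ h] with m hm
      rw [hm.1]
  have lim1 := tendsto_finsetSum Finset.univ fun (k : t) _ =>
    tendsto_integral_mul_comp_mul_self (hΩ k) (hΩS k) (hK k) (hKS k) (hcw k)
      (fun x hx hxK => by rw [hX0 k x hx hxK, zero_mul]) ((hu k).mono (hΩS k))
      (hui k ((hu k).mul (hu k))) (fun m => (hΘ m).continuous) hΘn hΘlim' z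
  have lim2 := (tendsto_finsetSum Finset.univ fun (k : t) _ => tendsto_finsetSum Finset.univ
    fun (a : Fin n) _ => tendsto_finsetSum Finset.univ fun (b : Fin n) _ =>
    tendsto_integral_mul_clm_mul (hΩ k) (hΩS k) (hK k) (hKS k) (hca k a b)
      (fun x hx hxK => by rw [hX0 k x hx hxK, zero_mul]) ((hu k).mono (hΩS k))
      (hDm k a) (hDm k b) (hDL k a) (hDL k b) hTm hΘC hTlim).neg
  -- The limit of Green's formula: z∫|f|² = -∫|∇f|², the last integral taken over {f ≠ 0} and both
  -- distributed over the charts by χ_k.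
  have energy := tendsto_nhds_unique (lim1.congr green) lim2
  have hE : ∀ k : t, ∃ e : ℝ, 0 ≤ e ∧ ∑ a, ∑ b, ∫ x in chartDomain (φ k),
      ((χ k (chartInv (φ k) x) * divCoeff g (φ k) a b x : ℝ) : ℂ) *
        T (f (chartInv (φ k) x)) (D₁ k a x) * D₁ k b x = e := fun k => by
    have hint := fun a b => integrableOn_mul_clm_mul (hΩ k) (hΩS k) (hK k) (hKS k) (hca k a b)
      (fun x hx hxK => by rw [hX0 k x hx hxK, zero_mul]) ((hu k).mono (hΩS k))
      (hDm k a) (hDm k b) (hDL k a) (hDL k b) hT hTC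
    rw [Finset.sum_congr rfl fun a _ => (integral_finsetSum _ fun b _ => hint a b).symm,
      ← integral_finsetSum _ fun a _ => integrable_finsetSum _ fun b _ => hint a b]
    refine exists_nonneg_setIntegral (hΩ k).measurableSet fun x hx => ?_
    -- Where f vanishes so does `T`, whatever the gradient is; elsewhere the integrand is χ√(det g)
    -- times the Hermitian form of g⁻¹ at the gradient.
    by_cases h : f (chartInv (φ k) x) = 0
    · exact ⟨0, le_rfl, by simp [T, h]⟩
    · obtain ⟨s, hs, hs'⟩ := exists_nonneg_of_posSemidef
        (posDef_metricCoeff g (k : M) (hΩS k hx)).inv.posSemidef (fun a => D₁ k a x)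
      refine ⟨χ k (chartInv (φ k) x) * volumeDensity g (φ k) x * s,
        mul_nonneg (mul_nonneg (hχ0 k _) (volumeDensity_pos g (k : M) (hΩS k hx)).le) hs, ?_⟩
      rw [Complex.ofReal_mul, ← hs']
      simp only [T, h, if_false, Finset.mul_sum, divCoeff, invMetricCoeff]
      refine Finset.sum_congr rfl fun a _ => Finset.sum_congr rfl fun b _ => ?_
      push_cast
      simp only [φ]
      ring
  choose e he hE using hE
  simp only [hE] at energy
  rw [← Finset.mul_sum, ← Complex.ofReal_sum, ← Complex.ofReal_sum] at energy
  have hpos : ∀ k : t, 0 ≤ ∫ x in chartDomain (φ k), χ k (chartInv (φ k) x) *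
      volumeDensity g (φ k) x * Complex.normSq (f (chartInv (φ k) x)) := fun k =>
    setIntegral_nonneg (hΩ k).measurableSet fun x hx => mul_nonneg (mul_nonneg (hχ0 k _)
      (volumeDensity_pos g (k : M) (hΩS k hx)).le) (Complex.normSq_nonneg _)
  have hzero := eq_zero_of_mul_eq_neg hz (Finset.sum_nonneg fun k _ => hpos k)
    (Finset.sum_nonneg fun k _ => he k) energy
  rw [Finset.sum_eq_zero_iff_of_nonneg fun k _ => hpos k] at hzero
  ext q
  -- Each chart only yields f = 0 where its χ_k is nonzero, and at every point some χ_k is.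
  obtain ⟨k, hk⟩ : ∃ k, χ k q ≠ 0 := by
    by_contra! h
    have := hχ1 q
    simp [h] at this
  have hint : IntegrableOn (fun x => χ k (chartInv (φ k) x) * volumeDensity g (φ k) x *
      Complex.normSq (f (chartInv (φ k) x))) (chartDomain (φ k)) := by
    have h1 := integrableOn_mul_of_compact (hΩ k) (hK k) (hKS k) (hcw k)
      (fun x hx hxK => by rw [hX0 k x hx hxK, zero_mul])
      (hui k (Complex.continuous_ofReal.comp_continuousOn
        (Complex.continuous_normSq.comp_continuousOn (hu k))))
    have h2 := h1.re
    refine h2.congr (Eventually.of_forall fun x => ?_)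
    simp [← Complex.ofReal_mul]
  exact eqOn_zero_of_integral_eq_zero g (k : M) (hχ k).continuous (hχ0 k) hint
    (hzero k (Finset.mem_univ k)) (hχs k (subset_tsupport _ hk)) hk

end Injectivity

end LaplaceBeltrami

end

theorem proposition2p1 {n : ℕ} [NeZero n] {M : Type*} [TopologicalSpace M] [T2Space M]
    [CompactSpace M] [ChartedSpace (EuclideanHalfSpace n) M] [IsManifold (𝓡∂ n) ∞ M]
    (g : Bundle.ContMDiffRiemannianMetric (𝓡∂ n) ∞ (EuclideanSpace ℝ (Fin n))
      (fun q : M => TangentSpace (𝓡∂ n) q))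
    (z : ℂ) (hz : z ∉ Complex.ofReal '' Set.Iic 0) :
    Function.Injective (fun f : (LaplaceBeltrami.dirichletLaplacian g).domain =>
      z • (f : C(M, ℂ)) - LaplaceBeltrami.dirichletLaplacian g f) := by
  intro f₁ f₂ h
  -- By linearity the difference of two functions with the same image solves the eigenvalue
  -- equation.
  have h0 : z • ((f₁ - f₂ : (LaplaceBeltrami.dirichletLaplacian g).domain) : C(M, ℂ)) =
      LaplaceBeltrami.dirichletLaplacian g (f₁ - f₂) := by
    rw [LinearPMap.map_sub, Submodule.coe_sub, smul_sub, ← sub_eq_zero]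
    rw [← sub_eq_zero] at h
    rw [← h]
    exact sub_sub_sub_comm _ _ _ _
  have hl := LaplaceBeltrami.dirichletLaplacian_spec g (f₁ - f₂)
  rw [← h0] at hl
  have hm := (f₁ - f₂).2
  have := LaplaceBeltrami.eq_zero_of_hasLaplacian_smul g hz (hm.1 2 (by norm_num) (by norm_num))
    hm.2.1 hl
  exact sub_eq_zero.1 (Subtype.ext this)
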